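/- **Diagrams.** Let $s\ge 1$. A diagram $\Gamma$ with $s$ faces is a graph obtained by gluing in pairs the sides of $s$ oriented polygons $D_1,\dots,D_s$, each with a marked corner, into a closed surface (orientable or not). Let $E$, $V$ be its edge and vertex sets and let $c_j(e)\in\{0,1,2\}$ be the number of times that $e$ appears in $\partial D_j$. The set $\mathcal T_s$ of typical diagrams consists of the connected diagrams whose $s$ marked vertices are distinct and of degree $2$ and whose other vertices have degree $3$, together with, if $s=1$, the single vertex without edges. For a symmetric Markov matrix $P$ on a finite set $S$ put $$F_{\Gamma,P}(\{n_j\})=\sum_{\eta:V\to S}\ \sum_{\substack{m_j\ge 0,\ w_e\ge 1\\ 2m_j+\sum_e c_j(e)w_e=n_j}}\ \prod_{e=\{u,v\}\in E}(P^{w_e})_{\eta(u)\eta(v)} .$$ Put $\mathfrak C(\{t_i\})=\{(\alpha_e)_{e\in E}:\alpha_e\ge0,\ \sum_e c_i(e)\alpha_e\le t_i \text{ for all } i\}$, and let $C_\Gamma$ be the limit, as all $n_j\to\infty$ with $\sum_j n_j$ even, of the number of pairs $(m,w)$ in the second sum divided by $\mathrm{Vol}\,\mathfrak C(\{n_j\})$.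 **Models.** For $d\ge1$, $D\ge2$, $M\ge 1$, $\lambda\in[0,1)$, the Wegner orbital model on $(\mathbb Z/D)^d\times\{1,\dots,M\}$ has variance profile $P=\mathcal P\otimes\frac1M\mathbf J_M$, where $\mathbf J_M$ is the all-ones $M\times M$ matrix and $\mathcal P$ is the transition matrix of the walk on $(\mathbb Z/D)^d$ that stays put with probability $1-\lambda$ and makes each of the $2d$ steps $\pm e_k$ with probability $\frac{\lambda}{2d}$ (for $D=2$ the two steps $\pm e_k$ coincide and both are counted). Let $F^{(\mathrm{Wegner})}_\Gamma(\{n_i\};\lambda)$ be its diagram function, and let $F^{(\mathrm{G\beta E})}_\Gamma(\{n_i\},M)$ be the one of the profile $\frac1M\mathbf J_M$. For $k\in\mathbb Z^d$ let $$p^{(\mathrm{Skellam})}(k,\tau)=\sum_{m\in\mathbb Z^d}\prod_{j=1}^d e^{-2\tau/d}I_{|k_j+m_jD|}(2\tau/d),$$ where $I_\nu$ is the modified Bessel function of the first kind. Let $f(x,\tau)=(2\pi\tau)^{-1/2}e^{-x^2/(2\tau)}$ and $\theta(x,\tau)=\sum_{k\in\mathbb Z}f(x+k,\tau)$ for $x\in\mathbb{R}$,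 $\tau>0$. **Theorem.** Fix $s\ge1$ and $\Gamma\in\mathcal T_s$. The limit $C_\Gamma$ exists and is positive. Let $\lambda=\lambda_M\in[0,1)$ and let $n_i=n_i(M)$ be positive integers (in (ii) and (iii), non-negative integers, which tend to infinity under the assumptions made there). As $M\to\infty$ the following hold. (i) *Frozen regime.* Let $d\ge1$ and $D\ge2$ be fixed and $M^{1/3}\lambda\to0$. If $n_i\le CM$ for a fixed $C>0$ and $n_i\lambda\to0$ for all $i$ (the latter is automatic if $n_i\le CM^{1/3}$), then $$\frac{1}{n_1\cdots n_s}F^{(\mathrm{Wegner})}_\Gamma(\{n_i\};\lambda)=\frac{1+o(1)}{n_1\cdots n_s}F^{(\mathrm{Wegner})}_\Gamma(\{n_i\};0)=\frac{1+o(1)}{n_1\cdots n_s}D^dF^{(\mathrm{G\beta E})}_\Gamma(\{n_i\},M).$$ In (ii) and (iii) assume moreover that $\Gamma$ has at least one edge and that $\sum_i n_i$ is even, and let $t_1,\dots,t_s>0$. (ii) *Skellam regime.* Let $d\ge1$ and $D\ge2$ be fixed and $M^{1/3}\lambda\to\mu\in(0,\infty)$. If $n_i\lambda\to t_i$ for all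 $i$, then $$\frac{1}{n_1\cdots n_s}F^{(\mathrm{Wegner})}_\Gamma(\{n_i\};\lambda)=(1+o(1))\frac{C_\Gamma}{t_1\cdots t_s}\,\mu^{-|E|+s}\sum_{x:V\to(\mathbb Z/D)^d}\ \int_{\mathfrak C(\{t_i\})}\prod_{e=\{u,v\}\in E}p^{(\mathrm{Skellam})}\Big(x_u-x_v,\frac{\alpha_e}{2}\Big)\prod_{e}d\alpha_e .$$ (iii) *Diffusive regime.* Let $d=1$, let $D=D_M\ge2$ possibly depend on $M$, let $M^{1/3}\lambda\to\infty$, and put $N=DM$, $W=\sqrt\lambda\,M$. Assume that $n_i(1-\lambda)\to\infty$ for all $i$ (automatic in each of the cases below if $\lambda$ stays away from $1$). Then $$\frac{1}{n_1\cdots n_s}F^{(\mathrm{Wegner})}_\Gamma(\{n_i\};\lambda)=(1+o(1))\,\mathcal L_\Gamma ,$$ where $\mathcal L_\Gamma$ is given as follows. * If $W\gg N^{5/6}$ and $n_i\sim t_iN^{1/3}$ for all $i$: $\ \mathcal L_\Gamma=\frac{C_\Gamma}{t_1\cdots t_s}\mathrm{Vol}\,\mathfrak C(\{t_i\})$. *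 If $(\log N)^{1/2}\ll W\ll N^{5/6}$ and $n_i\sim t_iW^{2/5}$ for all $i$: for every $v_0\in V$, $$\mathcal L_\Gamma=NW^{-6/5}\frac{C_\Gamma}{t_1\cdots t_s}\int_{\mathbb R^{V\setminus\{v_0\}}}\int_{\mathfrak C(\{t_i\})}\prod_{e=\{u,v\}}f(x_u-x_v,\alpha_e)\prod_e d\alpha_e\prod_{v\ne v_0}dx_v,\qquad x_{v_0}=0 .$$ * If $W\sim(\gamma N)^{5/6}$ for some $\gamma>0$ and $n_i\sim t_iW^{2/5}$ for all $i$: $$\mathcal L_\Gamma=\gamma^{|E|-|V|}\frac{C_\Gamma}{t_1\cdots t_s}\int_{[0,1)^V}\int_{\mathfrak C(\{t_i\})}\prod_{e=\{u,v\}}\theta(x_u-x_v,\alpha_e\gamma^2)\prod_e d\alpha_e\prod_v dx_v .$$ -/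

import Mathlib

open Filter Topology MeasureTheory Asymptotics

noncomputable section

/-- A ribbon graph on a closed (not necessarily orientable) surface with `s` labelled faces, each
with a marked boundary vertex, presented as a gluing of oriented polygons.

* Face `i` is an oriented polygon with `perim i` sides. The sides are numbered along the
  orientation, starting from the marked corner. A polygon with no side still has one corner.
* The sides are glued in pairs: edge `e` is obtained from the two sides `glue.symm (e, false)` and
  `glue.symm (e, true)`.
* If `twist e = false` the two sides are identified with opposite orientations (as in an orientable
  gluing), and if `twist e = true` with the same orientation. -/
structure RibbonGraph (s : ℕ) where
  perim : Fin s → ℕ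
  numEdges : ℕ
  glue : (Σ i : Fin s, Fin (perim i)) ≃ Fin numEdges × Bool
  twist : Fin numEdges → Bool

namespace RibbonGraph

variable {s : ℕ} (Γ : RibbonGraph s)

/-- The edge set of the graph. -/
abbrev Edge : Type := Fin Γ.numEdges

/-- The polygon sides. -/
abbrev Side : Type := Σ i : Fin s, Fin (Γ.perim i)

/-- The polygon corners. -/
abbrev Corner : Type := Σ i : Fin s, Fin (max (Γ.perim i) 1)

/-- The two sides which form the edge `e`. -/
def side (e : Γ.Edge) (b : Bool) : Γ.Side := Γ.glue.symm (e, b)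

/-- The corner at which a side starts. -/
def startCorner (x : Γ.Side) : Γ.Corner := ⟨x.1, Fin.castLE (le_max_left _ _) x.2⟩

/-- The corner at which a side ends: the next one along the polygon, cyclically. -/
def endCorner (x : Γ.Side) : Γ.Corner :=
  ⟨x.1, ⟨(x.2.val + 1) % Γ.perim x.1,
    lt_of_lt_of_le (Nat.mod_lt _ (Nat.zero_lt_of_lt x.2.isLt)) (le_max_left _ _)⟩⟩

/-- The corner identifications produced by gluing the sides. -/
inductive Glued : Γ.Corner → Γ.Corner → Prop
  | start_end (e : Γ.Edge) (h : Γ.twist e = false) :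
      Glued (Γ.startCorner (Γ.side e false)) (Γ.endCorner (Γ.side e true))
  | end_start (e : Γ.Edge) (h : Γ.twist e = false) :
      Glued (Γ.endCorner (Γ.side e false)) (Γ.startCorner (Γ.side e true))
  | start_start (e : Γ.Edge) (h : Γ.twist e = true) :
      Glued (Γ.startCorner (Γ.side e false)) (Γ.startCorner (Γ.side e true))
  | end_end (e : Γ.Edge) (h : Γ.twist e = true) :
      Glued (Γ.endCorner (Γ.side e false)) (Γ.endCorner (Γ.side e true))

/-- The vertices of the graph: corners modulo the equivalence relation generated by the gluing. -/
def Vertex : Type := Quot Γ.Glued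

instance instFiniteVertex : Finite Γ.Vertex :=
  Finite.of_surjective (Quot.mk Γ.Glued) Quot.mk_surjective

instance instFintypeVertex : Fintype Γ.Vertex := Fintype.ofFinite _

instance instDecidableEqVertex : DecidableEq Γ.Vertex := Classical.decEq _

/-- The first endpoint of an edge. -/
def src (e : Γ.Edge) : Γ.Vertex := Quot.mk _ (Γ.startCorner (Γ.side e false))

/-- The second endpoint of an edge. -/
def tgt (e : Γ.Edge) : Γ.Vertex := Quot.mk _ (Γ.endCorner (Γ.side e false))

/-- The marked vertex of a face. -/
def marked (i : Fin s) : Γ.Vertex := Quot.mk _ ⟨i, ⟨0, lt_max_of_lt_right Nat.one_pos⟩⟩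

/-- The degree of a vertex (a loop counts twice). -/
def degree (v : Γ.Vertex) : ℕ :=
  ∑ e : Γ.Edge, ((if Γ.src e = v then 1 else 0) + (if Γ.tgt e = v then 1 else 0))

/-- Connectedness of the graph. -/
def Connected : Prop :=
  ∀ u v : Γ.Vertex, Relation.EqvGen (fun a b => ∃ e : Γ.Edge, Γ.src e = a ∧ Γ.tgt e = b) u v

/-- Connected, with `s` distinct marked vertices of degree `2` and all other vertices of
degree `3`. -/
structure IsTrivalent : Prop where
  connected : Γ.Connected
  marked_injective : Function.Injective Γ.marked
  degree_marked : ∀ i, Γ.degree (Γ.marked i) = 2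
  degree_unmarked : ∀ v, v ∉ Set.range Γ.marked → Γ.degree v = 3

/-- The single-vertex graph without edges (with one face). -/
def IsSingleVertex : Prop := s = 1 ∧ Γ.numEdges = 0

/-- The typical connected diagrams with `s` marked points. -/
def IsTypical : Prop := Γ.IsTrivalent ∨ Γ.IsSingleVertex

/-- The number of times that the edge `e` appears in the boundary of face `j`. -/
def mult (j : Fin s) (e : Γ.Edge) : ℕ :=
  (if (Γ.side e false).1 = j then 1 else 0) + (if (Γ.side e true).1 = j then 1 else 0)

/-- The integer solutions `(m, w)`, with `m_j ≥ 0` and `w_e ≥ 1`, of the system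
`2 m_j + ∑_{e ∈ ∂D_j} w_e = n_j`, `j = 1, …, s`; see `mem_solutions`. -/
def solutions (n : Fin s → ℕ) : Finset ((Fin s → ℕ) × (Γ.Edge → ℕ)) :=
  ((Fintype.piFinset fun j => Finset.range (n j + 1)) ×ˢ
    (Fintype.piFinset fun _ => Finset.Icc 1 (∑ j, n j))).filter
    fun q => ∀ j, 2 * q.1 j + ∑ e, Γ.mult j e * q.2 e = n j

theorem mem_solutions (n : Fin s → ℕ) (q : (Fin s → ℕ) × (Γ.Edge → ℕ)) :
    q ∈ Γ.solutions n ↔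
      (∀ e, 1 ≤ q.2 e) ∧ ∀ j, 2 * q.1 j + ∑ e, Γ.mult j e * q.2 e = n j := by
  simp only [solutions, Finset.mem_filter, Finset.mem_product, Fintype.mem_piFinset,
    Finset.mem_range, Finset.mem_Icc]
  constructor
  · rintro ⟨⟨_, h⟩, h'⟩
    exact ⟨fun e => (h e).1, h'⟩
  · rintro ⟨h, h'⟩
    refine ⟨⟨fun j => ?_, fun e => ⟨h e, ?_⟩⟩, h'⟩
    · have := h' j
      omega
    · have h1 : 1 ≤ Γ.mult (Γ.side e false).1 e := by simp [mult]
      have h2 : Γ.mult (Γ.side e false).1 e * q.2 e ≤ ∑ e', Γ.mult (Γ.side e false).1 e' * q.2 e' :=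
        Finset.single_le_sum (f := fun e' => Γ.mult (Γ.side e false).1 e' * q.2 e')
          (fun _ _ => Nat.zero_le _) (Finset.mem_univ e)
      have h3 : n (Γ.side e false).1 ≤ ∑ j, n j :=
        Finset.single_le_sum (f := n) (fun _ _ => Nat.zero_le _) (Finset.mem_univ _)
      have h4 := h' (Γ.side e false).1
      have h5 : 1 * q.2 e ≤ Γ.mult (Γ.side e false).1 e * q.2 e := Nat.mul_le_mul_right _ h1
      omega

/-- The diagram function `F_Γ({n_j})` of the variance profile `P = (σ²_{xy})` (no deformation):
the entries of `P ^ w` are the `w`-step transition probabilities. -/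
def diagramFunction {S : Type} [Fintype S] [DecidableEq S] (P : Matrix S S ℝ) (n : Fin s → ℕ) : ℝ :=
  ∑ η : Γ.Vertex → S, ∑ q ∈ Γ.solutions n,
    ∏ e : Γ.Edge, (P ^ q.2 e) (η (Γ.src e)) (η (Γ.tgt e))

/-- The region `∑_e c_i(e) α_e ≤ t_i`, `α_e ≥ 0`, of edge weights. -/
def region (t : Fin s → ℝ) : Set (Γ.Edge → ℝ) :=
  {a | (∀ e, 0 ≤ a e) ∧ ∀ i, ∑ e, (Γ.mult i e : ℝ) * a e ≤ t i}

/-- Number of integer solutions over the volume of the corresponding polytope. -/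
def countRatio (n : Fin s → ℕ) : ℝ :=
  ((Γ.solutions n).card : ℝ) / volume.real (Γ.region fun j => (n j : ℝ))

/-- All `n_j → ∞` with `n_1 + ⋯ + n_s` even. -/
def evenAtTop (s : ℕ) : Filter (Fin s → ℕ) := atTop ⊓ 𝓟 {n | Even (∑ j, n j)}

/-- The combinatorial constant `C_Γ`. -/
def combConst : ℝ := limUnder (evenAtTop s) Γ.countRatio

end RibbonGraph

/-- The variance profile of the Gaussian orthogonal or unitary ensemble of size `M`. -/
def gbeProfile (M : ℕ) : Matrix (Fin M) (Fin M) ℝ := Matrix.of fun _ _ => 1 / (M : ℝ)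

/-- The number of ways to reach block `j` from block `i` by one of the `2d` steps `± e_k` on the
torus `(ℤ/D)^d`. For `D ≥ 3` it is `1` if `|i - j|_1 = 1` and `0` otherwise; for `D = 2` the two
steps `e_k` and `- e_k` agree and are both counted. -/
def neighborCount {d D : ℕ} (i j : Fin d → ZMod D) : ℕ :=
  (Finset.univ.filter fun q : Fin d × Bool =>
    j = i + Pi.single q.1 (if q.2 then (1 : ZMod D) else -1)).card

/-- The variance profile of the Wegner orbital model with coupling `lam`, on `(ℤ/D)^d` with blocks
of size `M`. -/
def wegnerProfile (d D M : ℕ) (lam : ℝ) :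
    Matrix ((Fin d → ZMod D) × Fin M) ((Fin d → ZMod D) × Fin M) ℝ :=
  Matrix.of fun x y =>
    (if x.1 = y.1 then (1 - lam) / (M : ℝ) else 0) +
      (neighborCount x.1 y.1 : ℝ) * (lam / (2 * (d : ℝ) * (M : ℝ)))

/-- The diagram function of the Wegner orbital model. -/
def wegnerF {s : ℕ} (Γ : RibbonGraph s) (d D M : ℕ) [NeZero D] (lam : ℝ) (n : Fin s → ℕ) : ℝ :=
  Γ.diagramFunction (wegnerProfile d D M lam) n

/-- The diagram function of the Gaussian orthogonal or unitary ensemble of size `M`. -/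
def gbeF {s : ℕ} (Γ : RibbonGraph s) (M : ℕ) (n : Fin s → ℕ) : ℝ :=
  Γ.diagramFunction (gbeProfile M) n

/-- The modified Bessel function of the first kind, of integer order `ν ≥ 0`. -/
def besselI (ν : ℕ) (x : ℝ) : ℝ :=
  ∑' k : ℕ, (x / 2) ^ (2 * k + ν) / ((k.factorial : ℝ) * ((k + ν).factorial : ℝ))

/-- The periodic Skellam transition probability. -/
def skellam (d D : ℕ) (k : Fin d → ℤ) (τ : ℝ) : ℝ :=
  ∑' m : Fin d → ℤ, ∏ j, (Real.exp (-(2 * τ / d)) * besselI (k j + m j * D).natAbs (2 * τ / d))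

/-- The periodic Skellam kernel between two points of the torus. -/
def skellamKernel {d D : ℕ} (x y : Fin d → ZMod D) (τ : ℝ) : ℝ :=
  skellam d D (fun j => ((x j - y j).val : ℤ)) τ

/-- The centred Gaussian density of variance `τ`: the `2`-stable density `f_2(x, τ)`. -/
def gaussDensity (x τ : ℝ) : ℝ :=
  τ ^ (-(1 / 2 : ℝ)) * ProbabilityTheory.gaussianPDFReal 0 1 (τ ^ (-(1 / 2 : ℝ)) * x)

/-- The `2`-stable theta function. -/
def theta (x τ : ℝ) : ℝ := ∑' k : ℤ, gaussDensity (x + k) τ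

namespace RibbonGraph

variable {s : ℕ} (Γ : RibbonGraph s)

/-- The sum over block labels and the integral over edge weights of the product of Skellam
kernels. The kernel of the block walk run for a rescaled time `a` is the Skellam kernel at `a / 2`,
since in each of the `2d` directions the walk makes a Poisson number of jumps of mean `a / (2d)`. -/
def skellamIntegral (d D : ℕ) [NeZero D] (t : Fin s → ℝ) : ℝ :=
  ∑ x : Γ.Vertex → Fin d → ZMod D,
    ∫ a in Γ.region t, ∏ e, skellamKernel (x (Γ.src e)) (x (Γ.tgt e)) (a e / 2)

/-- The supercritical limiting diagram function. -/
def limitSuper (t : Fin s → ℝ) : ℝ :=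
  Γ.combConst / (∏ i, t i) * volume.real (Γ.region t)

/-- Extension of a family indexed by the vertices other than `v₀` by the value `0` at `v₀`. -/
def pin (v₀ : Γ.Vertex) (x : {v : Γ.Vertex // v ≠ v₀} → ℝ) (v : Γ.Vertex) : ℝ :=
  if h : v = v₀ then 0 else x ⟨v, h⟩

/-- The subcritical limiting diagram function (`d = 1`, `α = 2`), with `x_{v₀} = 0`. -/
def limitSub (v₀ : Γ.Vertex) (t : Fin s → ℝ) : ℝ :=
  Γ.combConst / (∏ i, t i) *
    ∫ x : {v : Γ.Vertex // v ≠ v₀} → ℝ, ∫ a in Γ.region t,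
      ∏ e, gaussDensity (Γ.pin v₀ x (Γ.src e) - Γ.pin v₀ x (Γ.tgt e)) (a e)

/-- The critical limiting diagram function (`d = 1`, `α = 2`); the circle `ℝ/ℤ` is represented by
the fundamental domain `[0, 1)`. -/
def limitCrit (t : Fin s → ℝ) (τ : ℝ) : ℝ :=
  Γ.combConst / (∏ i, t i) *
    ∫ x in Set.univ.pi (fun _ : Γ.Vertex => Set.Ico (0 : ℝ) 1), ∫ a in Γ.region t,
      ∏ e, theta (x (Γ.src e) - x (Γ.tgt e)) (a e * τ)

end RibbonGraph

end

/-! Since `J_M / M` is idempotent, for `w ≥ 1` the power `P ^ w` of the profile is the `w`-step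
kernel of the walk between blocks, divided by `M`. Hence (`wegnerF_eq`) the diagram function is `M ^
(|V| - |E|)` times a sum, over block labellings of the vertices and over solutions `(m, w)`, of the
product over the edges of the walk kernels at times `w e`. All regimes are asymptotics of this one
sum.

Solutions: `m` is determined by `w`, and `w` is subject to linear inequalities and to a parity
condition. On a connected diagram the face-edge incidence matrix modulo `2` reaches every vector of
even sum, so the admissible residues of `w` form a coset of its kernel, whose size does not depend
on `n`. Each residue class is a lattice of mesh `2`, so sums over `w` on a scale `L` become
integrals over the polytope with density `C_Γ = |ker| / 2 ^ |E|` (`tendsto_countRatio`,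
`tendsto_sum_solutions`). The passage to the limit is dominated convergence: the edge kernels are
bounded by multiples of `(w e / L) ^ (-1/2)`, which is integrable at `0`.

Kernels: if `n λ → 0`, the walk does not move and only the constant labellings survive
(`frozen_isEquivalent`). On the time scale `1 / λ` the walk converges to its continuous-time
version, whose kernel is the Skellam kernel because `exp (a (u + u⁻¹)) = ∑ I_|k|(2a) u ^ k`
(`tendsto_blockWalk_pow`). On longer scales a Fourier argument gives a Gaussian local limit at
distances of order `ℓ = √(λ L)` (`tendsto_lazyWalk`), and shifting the contour gives a bound with
exponential decay in space (`lazyWalk_le`), which allows the labels to be summed by dominated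
convergence as well (`tendsto_sum_labels`). The three diffusive cases compare the length `D` of the
cycle with `ℓ`: the walk is equidistributed if `D ≪ ℓ`, has a theta kernel if `D` is comparable to
`ℓ`, and a Gaussian kernel on the line if `D ≫ ℓ`; in the last case translation invariance leaves
the factor `D / ℓ = N W ^ (-6/5)`.

The powers of `M` balance because of `3 |V| = 2 |E| + s`. -/

noncomputable section

/-! ### Vertex count and parity classes of the edge weights -/

namespace RibbonGraph

variable {s : ℕ} (Γ : RibbonGraph s)

theorem sum_degree : ∑ v, Γ.degree v = 2 * Γ.numEdges := by
  unfold degree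
  rw [Finset.sum_comm]
  simp [Finset.sum_add_distrib, mul_comm]

/-- Raising the degree of each of the `s` marked vertices by one makes every degree `3`; then
compare with the degree sum. This identity balances the powers of `M` in the Skellam and diffusive
limits. -/
theorem IsTrivalent.three_mul_card {Γ : RibbonGraph s} (h : Γ.IsTrivalent) :
    3 * Fintype.card Γ.Vertex = 2 * Γ.numEdges + s := by
  have h1 : ∀ v, Γ.degree v + (if v ∈ Finset.univ.image Γ.marked then 1 else 0) = 3 := by
    intro v
    split_ifs with hv
    · simp only [Finset.mem_image, Finset.mem_univ, true_and] at hv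
      obtain ⟨i, rfl⟩ := hv
      rw [h.degree_marked]
    · rw [h.degree_unmarked]
      simpa using hv
  have h2 := Finset.sum_congr rfl fun v (_ : v ∈ Finset.univ) => h1 v
  rw [Finset.sum_add_distrib, Γ.sum_degree, Finset.sum_ite_mem, Finset.univ_inter] at h2
  simp only [Finset.sum_const, smul_eq_mul, mul_one, Finset.card_univ] at h2
  rw [Finset.card_image_of_injective _ h.marked_injective, Finset.card_univ,
    Fintype.card_fin] at h2
  omega

theorem Connected.congr {Γ : RibbonGraph s} (h : Γ.Connected) {β : Type*} (f : Γ.Vertex → β)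
    (hf : ∀ e, f (Γ.src e) = f (Γ.tgt e)) (u v : Γ.Vertex) : f u = f v := by
  induction h u v with
  | rel x y hxy => obtain ⟨e, rfl, rfl⟩ := hxy; exact hf e
  | refl => rfl
  | symm _ _ _ ih => exact ih.symm
  | trans _ _ _ _ _ ih1 ih2 => exact ih1.trans ih2

theorem IsSingleVertex.subsingleton {Γ : RibbonGraph s} (h : Γ.IsSingleVertex) :
    Subsingleton Γ.Vertex := by
  obtain ⟨rfl, h0⟩ := h
  have hp : ∀ i, Γ.perim i = 0 := by
    intro i
    by_contra hi
    have := (Γ.glue ⟨i, ⟨0, Nat.pos_of_ne_zero hi⟩⟩).1.isLt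
    omega
  have : Subsingleton Γ.Corner := by
    constructor
    rintro ⟨i, a⟩ ⟨j, b⟩
    obtain rfl := Subsingleton.elim i j
    congr 1
    ext
    have h1 := a.isLt
    have h2 := b.isLt
    have hm : max (Γ.perim i) 1 = 1 := by rw [hp]; rfl
    omega
  exact Quot.mk_surjective.subsingleton

theorem IsTypical.connected {Γ : RibbonGraph s} (h : Γ.IsTypical) : Γ.Connected := by
  rcases h with h | h
  · exact h.connected
  · intro u v
    have := h.subsingleton
    rw [Subsingleton.elim u v]
    exact Relation.EqvGen.refl _

theorem IsTypical.three_mul_card {Γ : RibbonGraph s} (h : Γ.IsTypical) (hE : 1 ≤ Γ.numEdges) :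
    3 * Fintype.card Γ.Vertex = 2 * Γ.numEdges + s := by
  rcases h with h | h
  · exact h.three_mul_card
  · have := h.2
    omega

/-- The face-edge incidence matrix modulo `2`. -/
def parityMap : (Γ.Edge → ZMod 2) →ₗ[ZMod 2] (Fin s → ZMod 2) :=
  Matrix.mulVecLin (Matrix.of fun j e => (Γ.mult j e : ZMod 2))

theorem parityMap_apply (r : Γ.Edge → ZMod 2) (j : Fin s) :
    Γ.parityMap r j = ∑ e, (Γ.mult j e : ZMod 2) * r e := by
  simp [parityMap, Matrix.mulVec, dotProduct]

theorem parityMap_single (e : Γ.Edge) :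
    Γ.parityMap (Pi.single e 1) =
      Pi.single (Γ.side e false).1 1 + Pi.single (Γ.side e true).1 1 := by
  ext j
  rw [parityMap_apply, Finset.sum_eq_single e]
  · simp [mult, Pi.single_apply, eq_comm]
  · intro b _ hb
    simp [hb]
  · simp

/-- In the cokernel of the incidence matrix the column of an edge identifies the two faces glued
along it. Glued corners lie on such faces, so the class of the face of a corner descends to
vertices, and connectedness of the graph makes it constant. -/
theorem mk_single_eq {Γ : RibbonGraph s} (hc : Γ.Connected) (i j : Fin s) :
    (Submodule.Quotient.mk (Pi.single i 1) : (Fin s → ZMod 2) ⧸ LinearMap.range Γ.parityMap) =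
      Submodule.Quotient.mk (Pi.single j 1) := by
  have hcol : ∀ e, (Submodule.Quotient.mk (Pi.single (Γ.side e false).1 1) :
      (Fin s → ZMod 2) ⧸ LinearMap.range Γ.parityMap) =
      Submodule.Quotient.mk (Pi.single (Γ.side e true).1 1) := by
    intro e
    rw [Submodule.Quotient.eq]
    refine ⟨Pi.single e 1, ?_⟩
    rw [Γ.parityMap_single]
    ext k
    have : ∀ a b : ZMod 2, a + b = a - b := by decide
    simp [this]
  let F : Γ.Vertex → (Fin s → ZMod 2) ⧸ LinearMap.range Γ.parityMap :=
    Quot.lift (fun c => Submodule.Quotient.mk (Pi.single c.1 1)) (by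
      rintro a b (⟨e, _⟩ | ⟨e, _⟩ | ⟨e, _⟩ | ⟨e, _⟩) <;> exact hcol e)
  -- Both endpoints of an edge are represented by corners of one side, hence of one face, so the
  -- edge condition is definitional.
  exact hc.congr F (fun e => rfl) (Γ.marked i) (Γ.marked j)

/-- The cokernel is spanned by the class common to all faces, so a vector maps to the sum of its
entries times this class. -/
theorem exists_parityMap_eq {Γ : RibbonGraph s} (hc : Γ.Connected) (n : Fin s → ZMod 2)
    (hn : ∑ j, n j = 0) : ∃ r, Γ.parityMap r = n := by
  rcases Nat.eq_zero_or_pos s with rfl | hs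
  · exact ⟨0, Subsingleton.elim _ _⟩
  change n ∈ LinearMap.range Γ.parityMap
  rw [← Submodule.Quotient.mk_eq_zero]
  have h1 : n = ∑ i, n i • (Pi.single i 1 : Fin s → ZMod 2) := by
    ext j
    simp [Finset.sum_apply, Pi.single_apply]
  rw [← Submodule.mkQ_apply, h1, map_sum]
  simp only [map_smul, Submodule.mkQ_apply]
  rw [Finset.sum_congr rfl fun i _ => congrArg (n i • ·) (mk_single_eq hc i ⟨0, hs⟩),
    ← Finset.sum_smul, hn, zero_smul]

/-- The residues modulo `2` of the edge weights of solutions. -/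
def parityClasses (n : Fin s → ℕ) : Finset (Γ.Edge → ZMod 2) :=
  Finset.univ.filter fun r => Γ.parityMap r = fun j => (n j : ZMod 2)

/-- The classes form a coset of the kernel of `parityMap`; translation by one solution identifies
them with the kernel. -/
theorem card_parityClasses {Γ : RibbonGraph s} (hc : Γ.Connected) {n : Fin s → ℕ}
    (hn : Even (∑ j, n j)) : (Γ.parityClasses n).card = (Γ.parityClasses 0).card := by
  obtain ⟨r₀, hr₀⟩ := exists_parityMap_eq hc (fun j => (n j : ZMod 2)) (by
    rw [← Nat.cast_sum]
    exact (ZMod.natCast_eq_zero_iff_even).2 hn)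
  refine Finset.card_nbij' (· - r₀) (· + r₀) ?_ ?_ ?_ ?_
  · intro r hr
    simp only [parityClasses, Finset.coe_filter, Finset.mem_univ, true_and, Set.mem_ofPred_eq]
      at hr ⊢
    rw [map_sub, hr, hr₀]
    ext j; simp
  · intro r hr
    simp only [parityClasses, Finset.coe_filter, Finset.mem_univ, true_and, Set.mem_ofPred_eq]
      at hr ⊢
    rw [map_add, hr, hr₀]
    ext j; simp
  · intro r _; simp
  · intro r _; simp

/-- The limiting value of `countRatio`. -/
def parityConst : ℝ := (Γ.parityClasses 0).card / 2 ^ Γ.numEdges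

theorem parityConst_pos : 0 < Γ.parityConst := by
  unfold parityConst
  have : 0 < (Γ.parityClasses 0).card :=
    Finset.card_pos.2 ⟨0, by simp [parityClasses]; rfl⟩
  positivity

/-- The positive weights of a given residue modulo `2` are the `classPoint r k`, `k ≥ 0`. -/
def classPoint (r : Γ.Edge → ZMod 2) (k : Γ.Edge → ℕ) (e : Γ.Edge) : ℕ :=
  2 * k e + if r e = 0 then 2 else 1

theorem one_le_classPoint (r : Γ.Edge → ZMod 2) (k : Γ.Edge → ℕ) (e : Γ.Edge) :
    2 * k e + 1 ≤ Γ.classPoint r k e := by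
  unfold classPoint; split_ifs <;> omega

theorem classPoint_le (r : Γ.Edge → ZMod 2) (k : Γ.Edge → ℕ) (e : Γ.Edge) :
    Γ.classPoint r k e ≤ 2 * k e + 2 := by
  unfold classPoint; split_ifs <;> omega

theorem cast_classPoint (r : Γ.Edge → ZMod 2) (k : Γ.Edge → ℕ) (e : Γ.Edge) :
    (Γ.classPoint r k e : ZMod 2) = r e := by
  unfold classPoint
  have h2 : (2 : ZMod 2) = 0 := rfl
  generalize r e = a
  push_cast
  rw [h2, zero_mul, zero_add]
  revert a; decide

/-- The weight vector `w` is admissible for the perimeters `n`. -/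
def Fits (n : Fin s → ℕ) (w : Γ.Edge → ℕ) : Prop := ∀ j, ∑ e, Γ.mult j e * w e ≤ n j

variable {Γ} in
theorem Fits.le {n : Fin s → ℕ} {w : Γ.Edge → ℕ} (h : Γ.Fits n w) (e : Γ.Edge) :
    w e ≤ n (Γ.side e false).1 := by
  have h1 : 1 ≤ Γ.mult (Γ.side e false).1 e := by simp [mult]
  have h2 : Γ.mult (Γ.side e false).1 e * w e ≤ ∑ e', Γ.mult (Γ.side e false).1 e' * w e' :=
    Finset.single_le_sum (f := fun e' => Γ.mult (Γ.side e false).1 e' * w e')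
      (fun _ _ => Nat.zero_le _) (Finset.mem_univ e)
  have h5 : 1 * w e ≤ Γ.mult (Γ.side e false).1 e * w e := Nat.mul_le_mul_right _ h1
  have := h (Γ.side e false).1
  omega

theorem fits_of_mem_solutions {n : Fin s → ℕ} {q : (Fin s → ℕ) × (Γ.Edge → ℕ)}
    (hq : q ∈ Γ.solutions n) : Γ.Fits n q.2 := by
  intro j
  have := ((Γ.mem_solutions n q).1 hq).2 j
  omega

open Classical in
/-- The admissible weights of a given residue modulo `2`, in terms of their integer quotients. -/
def classSet (n : Fin s → ℕ) (r : Γ.Edge → ZMod 2) : Finset (Γ.Edge → ℕ) :=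
  (Fintype.piFinset fun _ => Finset.range (∑ j, n j + 1)).filter
    fun k => Γ.Fits n (Γ.classPoint r k)

theorem mem_classSet {n : Fin s → ℕ} {r : Γ.Edge → ZMod 2} {k : Γ.Edge → ℕ} :
    k ∈ Γ.classSet n r ↔ Γ.Fits n (Γ.classPoint r k) := by
  simp only [classSet, Finset.mem_filter, Fintype.mem_piFinset, Finset.mem_range]
  refine ⟨fun h => h.2, fun h => ⟨fun e => ?_, h⟩⟩
  have h1 := h.le e
  have h2 : n (Γ.side e false).1 ≤ ∑ j, n j :=
    Finset.single_le_sum (f := n) (fun _ _ => Nat.zero_le _) (Finset.mem_univ _)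
  have h3 := Γ.one_le_classPoint r k e
  omega

/-- The `m j` are determined by `w`: they exist as soon as `w` fits and its residue makes each
remainder `n j - ∑ mult * w` even. This turns the sum over the Diophantine system into finitely many
sums over lattice points of a polytope. -/
theorem sum_solutions (n : Fin s → ℕ) (g : (Γ.Edge → ℕ) → ℝ) :
    ∑ q ∈ Γ.solutions n, g q.2 =
      ∑ r ∈ Γ.parityClasses n, ∑ k ∈ Γ.classSet n r, g (Γ.classPoint r k) := by
  -- The quotient is `(w - 1) / 2` and not `w / 2`, because weights start at `1`: an even weight has
  -- offset `2`, an odd one offset `1`.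
  have hpar : ∀ w : ℕ, 1 ≤ w → 2 * ((w - 1) / 2) + (if (w : ZMod 2) = 0 then 2 else 1) = w := by
    intro w hw
    split_ifs with h
    · rw [ZMod.natCast_eq_zero_iff_even] at h
      obtain ⟨k, rfl⟩ := h
      omega
    · rw [ZMod.natCast_eq_zero_iff_even, Nat.not_even_iff_odd] at h
      obtain ⟨k, rfl⟩ := h
      omega
  rw [Finset.sum_sigma']
  refine Finset.sum_bij'
    (fun q _ => (⟨fun e => (q.2 e : ZMod 2), fun e => (q.2 e - 1) / 2⟩ :
      Σ _ : Γ.Edge → ZMod 2, Γ.Edge → ℕ))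
    (fun p _ => (fun j => (n j - ∑ e, Γ.mult j e * Γ.classPoint p.1 p.2 e) / 2,
      Γ.classPoint p.1 p.2)) ?_ ?_ ?_ ?_ ?_
  · intro q hq
    have h := (Γ.mem_solutions n q).1 hq
    have hcp : Γ.classPoint (fun e => (q.2 e : ZMod 2)) (fun e => (q.2 e - 1) / 2) = q.2 := by
      ext e; exact hpar _ (h.1 e)
    simp only [Finset.mem_sigma, mem_classSet, hcp]
    refine ⟨?_, Γ.fits_of_mem_solutions hq⟩
    simp only [parityClasses, Finset.mem_filter, Finset.mem_univ, true_and]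
    ext j
    rw [parityMap_apply, ← h.2 j]
    push_cast
    have h2 : (2 : ZMod 2) = 0 := rfl
    simp [h2]
  · rintro ⟨r, k⟩ hp
    simp only [Finset.mem_sigma, mem_classSet] at hp
    rw [mem_solutions]
    refine ⟨fun e => ?_, fun j => ?_⟩
    · have := Γ.one_le_classPoint r k e
      change 1 ≤ Γ.classPoint r k e
      omega
    · have h1 := hp.2 j
      have h2 := congrFun (Finset.mem_filter.1 hp.1).2 j
      rw [parityMap_apply] at h2
      have h3 : ((n j - ∑ e, Γ.mult j e * Γ.classPoint r k e : ℕ) : ZMod 2) = 0 := by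
        rw [Nat.cast_sub h1, ← h2]
        push_cast
        simp [cast_classPoint]
      rw [ZMod.natCast_eq_zero_iff_even] at h3
      have := Nat.two_mul_div_two_of_even h3
      change 2 * ((n j - ∑ e, Γ.mult j e * Γ.classPoint r k e) / 2) +
        ∑ e, Γ.mult j e * Γ.classPoint r k e = n j
      omega
  · intro q hq
    have h := (Γ.mem_solutions n q).1 hq
    have hcp : Γ.classPoint (fun e => (q.2 e : ZMod 2)) (fun e => (q.2 e - 1) / 2) = q.2 := by
      ext e; exact hpar _ (h.1 e)
    ext1
    · simp only [hcp]
      ext j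
      have := h.2 j
      omega
    · exact hcp
  · rintro ⟨r, k⟩ hp
    simp only [cast_classPoint]
    congr 1
    ext e
    have h1 := Γ.one_le_classPoint r k e
    have h2 := Γ.classPoint_le r k e
    omega
  · intro q hq
    have h := (Γ.mem_solutions n q).1 hq
    have hcp : Γ.classPoint (fun e => (q.2 e : ZMod 2)) (fun e => (q.2 e - 1) / 2) = q.2 := by
      ext e; exact hpar _ (h.1 e)
    simp only [hcp]

end RibbonGraph

/-! ### Lattice sums as integrals of step functions -/

section Lattice

variable {ι : Type*}

/-- The lattice point below `ρ y`. -/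
def floorPoint (ρ : ℝ) (y : ι → ℝ) (i : ι) : ℤ := ⌊ρ * y i⌋

theorem measurable_floorPoint (ρ : ℝ) : Measurable (floorPoint (ι := ι) ρ) :=
  measurable_pi_lambda _ fun i =>
    Int.measurable_floor.comp (measurable_const.mul (measurable_pi_apply i))

theorem tendsto_floorPoint_div {ρ : ℕ → ℝ} (hρ : Tendsto ρ atTop atTop) (y : ι → ℝ) (i : ι) :
    Tendsto (fun M => (floorPoint (ρ M) y i : ℝ) / ρ M) atTop (𝓝 (y i)) := by
  have h1 : Tendsto (fun M => y i - (ρ M)⁻¹) atTop (𝓝 (y i)) := by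
    simpa using tendsto_const_nhds.sub (tendsto_inv_atTop_zero.comp hρ)
  refine tendsto_of_tendsto_of_tendsto_of_le_of_le' h1 tendsto_const_nhds ?_ ?_
  · filter_upwards [hρ.eventually_gt_atTop 0] with M hM
    rw [le_div_iff₀ hM, sub_mul, inv_mul_cancel₀ hM.ne', floorPoint, mul_comm]
    exact (Int.sub_one_lt_floor _).le
  · filter_upwards [hρ.eventually_gt_atTop 0] with M hM
    rw [div_le_iff₀ hM, mul_comm (y i)]
    exact Int.floor_le _

variable [Fintype ι]

open Classical in
-- Each lattice point owns a cube of side `ρ⁻¹`, on which the step function is constant. The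
-- identity is exact, so limits of Riemann sums reduce to dominated convergence.
theorem sum_eq_integral_floorPoint {ρ : ℝ} (hρ : 0 < ρ) (J : Finset (ι → ℤ)) (G : (ι → ℤ) → ℝ) :
    (ρ ^ Fintype.card ι)⁻¹ * ∑ z ∈ J, G z =
      ∫ y, if floorPoint ρ y ∈ J then G (floorPoint ρ y) else 0 := by
  have h1 : ∀ y : ι → ℝ, (if floorPoint ρ y ∈ J then G (floorPoint ρ y) else 0) =
      ∑ z ∈ J, (floorPoint ρ ⁻¹' {z}).indicator (fun _ => G z) y := by
    intro y
    simp [Set.indicator_apply]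
  have h2 : ∀ z : ι → ℤ, (floorPoint ρ ⁻¹' {z} : Set (ι → ℝ)) =
      Set.univ.pi fun i => Set.Ico ((z i : ℝ) / ρ) (((z i : ℝ) + 1) / ρ) := by
    intro z
    ext y
    simp only [Set.mem_preimage, Set.mem_singleton_iff, Set.mem_pi, Set.mem_univ, true_imp_iff,
      Set.mem_Ico, funext_iff]
    refine forall_congr' fun i => ?_
    rw [floorPoint, Int.floor_eq_iff, div_le_iff₀ hρ, lt_div_iff₀ hρ, mul_comm ρ]
  have h3 : ∀ z : ι → ℤ, volume (floorPoint ρ ⁻¹' {z} : Set (ι → ℝ)) =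
      ENNReal.ofReal (ρ ^ Fintype.card ι)⁻¹ := by
    intro z
    rw [h2, Real.volume_pi_Ico]
    have : ∀ i, ((z i : ℝ) + 1) / ρ - (z i : ℝ) / ρ = ρ⁻¹ := fun i => by
      rw [← sub_div]; simp
    simp only [this, Finset.prod_const, Finset.card_univ]
    rw [← ENNReal.ofReal_pow (by positivity), inv_pow]
  have hm : ∀ z : ι → ℤ, MeasurableSet (floorPoint ρ ⁻¹' {z} : Set (ι → ℝ)) := fun z =>
    measurable_floorPoint ρ (measurableSet_singleton z)
  simp_rw [h1]
  rw [integral_finsetSum]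
  · rw [Finset.mul_sum]
    refine Finset.sum_congr rfl fun z _ => ?_
    rw [integral_indicator (hm z), setIntegral_const, Measure.real, h3,
      ENNReal.toReal_ofReal (by positivity), smul_eq_mul]
  · intro z _
    rw [integrable_indicator_iff (hm z)]
    exact integrableOn_const (by rw [h3]; exact ENNReal.ofReal_ne_top)

open Classical in
theorem aestronglyMeasurable_comp_floorPoint (ρ : ℝ) (J : Finset (ι → ℤ)) (G : (ι → ℤ) → ℝ) :
    AEStronglyMeasurable
      (fun y : ι → ℝ => if floorPoint ρ y ∈ J then G (floorPoint ρ y) else 0) volume := by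
  have : Measurable fun z : ι → ℤ => if z ∈ J then G z else 0 := measurable_of_countable _
  exact (this.comp (measurable_floorPoint ρ)).aestronglyMeasurable

end Lattice

/-! ### Uniform bound for sums over solutions and their integral form -/

section Sums

theorem sum_inv_sqrt_le (m : ℕ) : ∑ k ∈ Finset.Icc 1 m, (√(k : ℝ))⁻¹ ≤ 2 * √m := by
  induction m with
  | zero => simp
  | succ m ih =>
    rw [Finset.sum_Icc_succ_top (by omega)]
    have h0 : (0 : ℝ) ≤ m := Nat.cast_nonneg m
    have h1 : 0 < √((m + 1 : ℕ) : ℝ) := Real.sqrt_pos.2 (by positivity)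
    have h2 := Real.sq_sqrt (show (0 : ℝ) ≤ ((m + 1 : ℕ) : ℝ) by positivity)
    have h3 := Real.sq_sqrt h0
    push_cast at h1 h2 ⊢
    have h4 : (√((m : ℝ) + 1))⁻¹ * √((m : ℝ) + 1) = 1 := inv_mul_cancel₀ h1.ne'
    have h5 : 0 < (√((m : ℝ) + 1))⁻¹ := inv_pos.2 h1
    have h6 : 0 ≤ √(m : ℝ) := Real.sqrt_nonneg _
    have h7 : √(m : ℝ) ≤ √((m : ℝ) + 1) := Real.sqrt_le_sqrt (by linarith)
    -- One step of the telescoping comparison of `∑ 1 / √k` with `2 √m`.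
    have h8 : (√((m : ℝ) + 1))⁻¹ ≤ 2 * (√((m : ℝ) + 1) - √(m : ℝ)) := by
      rw [inv_le_iff_one_le_mul₀ h1]
      nlinarith
    linarith

theorem sum_inv_sqrt_div_le {L : ℝ} (hL : 0 < L) {T : ℝ} (hT : 0 ≤ T) {m : ℕ}
    (hm : (m : ℝ) ≤ T * L) :
    ∑ k ∈ Finset.Icc 1 m, (√((k : ℝ) / L))⁻¹ ≤ 2 * √T * L := by
  have h1 : ∀ k : ℕ, (√((k : ℝ) / L))⁻¹ = √L * (√(k : ℝ))⁻¹ := fun k => by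
    rw [Real.sqrt_div (Nat.cast_nonneg k), inv_div, div_eq_mul_inv]
  simp_rw [h1, ← Finset.mul_sum]
  calc √L * ∑ k ∈ Finset.Icc 1 m, (√(k : ℝ))⁻¹ ≤ √L * (2 * √(T * L)) := by
        refine mul_le_mul_of_nonneg_left ((sum_inv_sqrt_le m).trans ?_) (Real.sqrt_nonneg _)
        exact mul_le_mul_of_nonneg_left (Real.sqrt_le_sqrt hm) (by norm_num)
    _ = 2 * √T * L := by
        rw [Real.sqrt_mul hT]
        linear_combination 2 * √T * Real.mul_self_sqrt hL.le

end Sums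

namespace RibbonGraph

variable {s : ℕ} (Γ : RibbonGraph s)

/-- Dropping all constraints except the upper bound on each weight leaves a sum over a box, which
factorises over the edges. The bound is linear in `B`, so it dominates the sums over labels when `B`
depends on the labels. -/
theorem abs_sum_solutions_le {L T B : ℝ} (hL : 0 < L) (hT : 0 ≤ T) {n : Fin s → ℕ}
    (hn : ∀ i, (n i : ℝ) ≤ T * L) {g : (Γ.Edge → ℕ) → ℝ} (hB0 : 0 ≤ B)
    (hB : ∀ w : Γ.Edge → ℕ, (∀ e, 1 ≤ w e) → (∀ e, (w e : ℝ) ≤ T * L) →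
      |g w| ≤ B * ∏ e, (√((w e : ℝ) / L))⁻¹) :
    |(L ^ Γ.numEdges)⁻¹ * ∑ q ∈ Γ.solutions n, g q.2| ≤ B * (2 * √T) ^ Γ.numEdges := by
  have hTL : 0 ≤ T * L := by positivity
  set m := ⌊T * L⌋₊
  have hm : (m : ℝ) ≤ T * L := Nat.floor_le hTL
  have hw : ∀ q ∈ Γ.solutions n, ∀ e, (q.2 e : ℝ) ≤ T * L := fun q hq e =>
    (Nat.cast_le.2 ((Γ.fits_of_mem_solutions hq).le e)).trans (hn _)
  -- Each `m j` can be recovered from `w`.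
  have hinj : Set.InjOn (fun q : (Fin s → ℕ) × (Γ.Edge → ℕ) => q.2) (Γ.solutions n) := by
    intro q hq q' hq' h
    have h1 := (Γ.mem_solutions n q).1 hq
    have h2 := (Γ.mem_solutions n q').1 hq'
    simp only at h
    refine Prod.ext (funext fun j => ?_) h
    have h3 := h1.2 j
    have h4 := h2.2 j
    rw [h] at h3
    omega
  have key : ∑ q ∈ Γ.solutions n, |g q.2| ≤ B * (2 * √T * L) ^ Γ.numEdges := by
    calc ∑ q ∈ Γ.solutions n, |g q.2|
        ≤ ∑ q ∈ Γ.solutions n, B * ∏ e, (√((q.2 e : ℝ) / L))⁻¹ :=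
          Finset.sum_le_sum fun q hq => hB _ ((Γ.mem_solutions n q).1 hq).1 (hw q hq)
      _ = ∑ w ∈ (Γ.solutions n).image (fun q => q.2), B * ∏ e, (√((w e : ℝ) / L))⁻¹ :=
          (Finset.sum_image (f := fun w : Γ.Edge → ℕ => B * ∏ e, (√((w e : ℝ) / L))⁻¹) hinj).symm
      _ ≤ ∑ w ∈ Fintype.piFinset (fun _ : Γ.Edge => Finset.Icc 1 m),
            B * ∏ e, (√((w e : ℝ) / L))⁻¹ := by
          refine Finset.sum_le_sum_of_subset_of_nonneg ?_ fun w _ _ => ?_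
          · intro w hwm
            obtain ⟨q, hq, rfl⟩ := Finset.mem_image.1 hwm
            rw [Fintype.mem_piFinset]
            exact fun e => Finset.mem_Icc.2
              ⟨((Γ.mem_solutions n q).1 hq).1 e, Nat.le_floor (hw q hq e)⟩
          · exact mul_nonneg hB0 (Finset.prod_nonneg fun e _ => by positivity)
      _ = B * ∏ _e : Γ.Edge, ∑ k ∈ Finset.Icc 1 m, (√((k : ℝ) / L))⁻¹ := by
          rw [← Finset.mul_sum, Finset.prod_univ_sum]
      _ ≤ B * ∏ _e : Γ.Edge, (2 * √T * L) := by
          refine mul_le_mul_of_nonneg_left ?_ hB0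
          refine Finset.prod_le_prod (fun e _ => Finset.sum_nonneg fun k _ => by positivity)
            fun e _ => sum_inv_sqrt_div_le hL hT hm
      _ = _ := by simp
  rw [abs_mul, abs_of_pos (by positivity : 0 < (L ^ Γ.numEdges)⁻¹)]
  calc (L ^ Γ.numEdges)⁻¹ * |∑ q ∈ Γ.solutions n, g q.2|
      ≤ (L ^ Γ.numEdges)⁻¹ * (B * (2 * √T * L) ^ Γ.numEdges) := by
        gcongr
        exact (Finset.abs_sum_le_sum_abs _ _).trans key
    _ = _ := by
        rw [mul_pow _ L]
        field_simp

open Classical in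
-- Weights in a fixed residue class have spacing `2`, hence `2 / L` after rescaling; the factor `2 ^
-- (-|E|)` of the limit constant arises here.
theorem sum_classSet_eq_integral {L : ℝ} (hL : 0 < L) (n : Fin s → ℕ) (r : Γ.Edge → ZMod 2)
    (g : (Γ.Edge → ℕ) → ℝ) :
    (L ^ Γ.numEdges)⁻¹ * ∑ k ∈ Γ.classSet n r, g (Γ.classPoint r k) =
      (2 ^ Γ.numEdges)⁻¹ * ∫ a : Γ.Edge → ℝ,
        if (∀ e, 0 ≤ a e) ∧ Γ.Fits n (Γ.classPoint r fun e => ⌊L / 2 * a e⌋₊) then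
          g (Γ.classPoint r fun e => ⌊L / 2 * a e⌋₊) else 0 := by
  have hL2 : 0 < L / 2 := by positivity
  have h := sum_eq_integral_floorPoint hL2
    ((Γ.classSet n r).image fun (k : Γ.Edge → ℕ) (e : Γ.Edge) => (k e : ℤ))
    (fun z => g (Γ.classPoint r fun e => (z e).toNat))
  rw [Finset.sum_image (by
    intro k _ k' _ h
    ext e
    have := congrFun h e
    simpa using this)] at h
  simp only [Int.toNat_natCast, Fintype.card_fin] at h
  have e1 : (L ^ Γ.numEdges)⁻¹ = (2 ^ Γ.numEdges)⁻¹ * ((L / 2) ^ Γ.numEdges)⁻¹ := by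
    rw [← mul_inv, ← mul_pow]; congr 2; ring
  rw [e1, mul_assoc, h]
  congr 1
  refine integral_congr_ae (Eventually.of_forall fun a => ?_)
  have h2 : floorPoint (L / 2) a ∈
      (Γ.classSet n r).image (fun (k : Γ.Edge → ℕ) (e : Γ.Edge) => (k e : ℤ)) ↔
      (∀ e, 0 ≤ a e) ∧ Γ.Fits n (Γ.classPoint r fun e => ⌊L / 2 * a e⌋₊) := by
    rw [Finset.mem_image]
    constructor
    · rintro ⟨k, hk, hka⟩
      have h3 : k = fun e => ⌊L / 2 * a e⌋₊ := by
        ext e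
        have : (k e : ℤ) = ⌊L / 2 * a e⌋ := congrFun hka e
        rw [← Int.floor_toNat, ← this, Int.toNat_natCast]
      refine ⟨fun e => ?_, h3 ▸ Γ.mem_classSet.1 hk⟩
      have h4 : 0 ≤ ⌊L / 2 * a e⌋ := by
        have : (k e : ℤ) = ⌊L / 2 * a e⌋ := congrFun hka e
        omega
      have h5 := Int.floor_nonneg.1 h4
      exact nonneg_of_mul_nonneg_right h5 hL2
    · rintro ⟨h3, h4⟩
      refine ⟨_, Γ.mem_classSet.2 h4, ?_⟩
      ext e
      change (⌊L / 2 * a e⌋₊ : ℤ) = ⌊L / 2 * a e⌋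
      rw [← Int.floor_toNat, Int.toNat_of_nonneg]
      exact Int.floor_nonneg.2 (mul_nonneg hL2.le (h3 e))
  simp only [h2, floorPoint, Int.floor_toNat]

end RibbonGraph

namespace RibbonGraph

variable {s : ℕ} (Γ : RibbonGraph s)

/-! ### The polytope of edge lengths -/

section Region

theorem le_of_mem_region {t : Fin s → ℝ} {a : Γ.Edge → ℝ} (ha : a ∈ Γ.region t) (e : Γ.Edge) :
    a e ≤ t (Γ.side e false).1 := by
  have h1 : (1 : ℝ) ≤ Γ.mult (Γ.side e false).1 e := by
    have : 1 ≤ Γ.mult (Γ.side e false).1 e := by simp [mult]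
    exact_mod_cast this
  have h2 : (Γ.mult (Γ.side e false).1 e : ℝ) * a e ≤
      ∑ e', (Γ.mult (Γ.side e false).1 e' : ℝ) * a e' :=
    Finset.single_le_sum (f := fun e' => (Γ.mult (Γ.side e false).1 e' : ℝ) * a e')
      (fun e' _ => mul_nonneg (Nat.cast_nonneg _) (ha.1 e')) (Finset.mem_univ e)
  have h3 := ha.2 (Γ.side e false).1
  nlinarith [ha.1 e]

theorem isClosed_region (t : Fin s → ℝ) : IsClosed (Γ.region t) := by
  have h1 : Γ.region t = (⋂ e, {a | 0 ≤ a e}) ∩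
      ⋂ i, {a | ∑ e, (Γ.mult i e : ℝ) * a e ≤ t i} := by
    ext a; simp [region]
  rw [h1]
  refine (isClosed_iInter fun e => isClosed_le continuous_const (continuous_apply e)).inter
    (isClosed_iInter fun i => isClosed_le ?_ continuous_const)
  fun_prop

theorem measurableSet_region (t : Fin s → ℝ) : MeasurableSet (Γ.region t) :=
  (Γ.isClosed_region t).measurableSet

theorem region_subset (t : Fin s → ℝ) :
    Γ.region t ⊆ Set.univ.pi fun e => Set.Icc 0 (t (Γ.side e false).1) :=
  fun _ ha e _ => ⟨ha.1 e, Γ.le_of_mem_region ha e⟩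

theorem volume_region_lt_top (t : Fin s → ℝ) : volume (Γ.region t) < ⊤ := by
  refine (measure_mono (Γ.region_subset t)).trans_lt ?_
  exact (isCompact_univ_pi fun _ => isCompact_Icc).measure_lt_top

theorem mult_le_two (j : Fin s) (e : Γ.Edge) : Γ.mult j e ≤ 2 := by
  unfold mult; split_ifs <;> simp

theorem sum_mult_face_le (j : Fin s) : ∑ e, Γ.mult j e ≤ 2 * Γ.numEdges := by
  calc ∑ e, Γ.mult j e ≤ ∑ _e : Γ.Edge, 2 := Finset.sum_le_sum fun e _ => Γ.mult_le_two j e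
    _ = _ := by simp [mul_comm]

theorem volume_region_pos {t : Fin s → ℝ} (ht : ∀ i, 0 < t i) : 0 < volume (Γ.region t) := by
  obtain ⟨c, hc, hct⟩ : ∃ c : ℝ, 0 < c ∧ ∀ i, 2 * Γ.numEdges * c ≤ t i := by
    have h1 : ∀ i, ∀ᶠ c : ℝ in 𝓝[>] 0, 2 * (Γ.numEdges : ℝ) * c ≤ t i := by
      intro i
      have : Tendsto (fun c : ℝ => 2 * (Γ.numEdges : ℝ) * c) (𝓝[>] 0) (𝓝 0) := by
        have h : Continuous fun c : ℝ => 2 * (Γ.numEdges : ℝ) * c := by fun_prop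
        simpa using (h.tendsto 0).mono_left nhdsWithin_le_nhds
      exact (this.eventually (gt_mem_nhds (ht i))).mono fun _ h => h.le
    obtain ⟨c, hc, hc0⟩ := ((eventually_all.2 h1).and self_mem_nhdsWithin).exists
    exact ⟨c, hc0, hc⟩
  have hsub : (Set.univ.pi fun _ : Γ.Edge => Set.Ioo 0 c) ⊆ Γ.region t := by
    intro a ha
    refine ⟨fun e => (ha e trivial).1.le, fun i => le_trans ?_ (hct i)⟩
    calc ∑ e, (Γ.mult i e : ℝ) * a e ≤ ∑ e, (Γ.mult i e : ℝ) * c :=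
          Finset.sum_le_sum fun e _ =>
            mul_le_mul_of_nonneg_left (ha e trivial).2.le (Nat.cast_nonneg _)
      _ = ((∑ e, Γ.mult i e : ℕ) : ℝ) * c := by push_cast; rw [Finset.sum_mul]
      _ ≤ _ := by
          refine mul_le_mul_of_nonneg_right ?_ hc.le
          exact_mod_cast Γ.sum_mult_face_le i
  refine lt_of_lt_of_le ?_ (measure_mono hsub)
  refine (isOpen_set_pi Set.finite_univ fun _ _ => isOpen_Ioo).measure_pos _ ?_
  exact Set.univ_pi_nonempty_iff.2 fun _ => Set.nonempty_Ioo.2 hc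

theorem volume_real_region_pos {t : Fin s → ℝ} (ht : ∀ i, 0 < t i) :
    0 < volume.real (Γ.region t) :=
  ENNReal.toReal_pos (Γ.volume_region_pos ht).ne' (Γ.volume_region_lt_top t).ne

open scoped Pointwise in
theorem volume_real_region_mul {c : ℝ} (hc : 0 < c) (t : Fin s → ℝ) :
    volume.real (Γ.region fun i => c * t i) = c ^ Γ.numEdges * volume.real (Γ.region t) := by
  have h1 : Γ.region (fun i => c * t i) = c • Γ.region t := by
    ext a
    rw [Set.mem_smul_set_iff_inv_smul_mem₀ hc.ne']
    have hci : 0 < c⁻¹ := inv_pos.2 hc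
    simp only [region, Set.mem_ofPred_eq, Pi.smul_apply, smul_eq_mul]
    refine and_congr (forall_congr' fun e => ?_) (forall_congr' fun i => ?_)
    · rw [mul_nonneg_iff_of_pos_left hci]
    · have : ∑ e, (Γ.mult i e : ℝ) * (c⁻¹ * a e) = c⁻¹ * ∑ e, (Γ.mult i e : ℝ) * a e := by
        rw [Finset.mul_sum]; exact Finset.sum_congr rfl fun e _ => by ring
      rw [this, inv_mul_le_iff₀ hc]
  rw [h1, Measure.real, Measure.addHaar_smul, ENNReal.toReal_mul,
    ENNReal.toReal_ofReal (abs_nonneg _), abs_of_nonneg (by positivity)]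
  simp [Measure.real]

end Region

/-! ### The constant `C_Γ` -/

section Count

/-- The edge weights whose cell contains an admissible lattice point of a given class. -/
def cells (n : Fin s → ℕ) (r : Γ.Edge → ZMod 2) : Set (Γ.Edge → ℝ) :=
  {a | (∀ e, 0 ≤ a e) ∧ Γ.Fits n (Γ.classPoint r fun e => ⌊1 / 2 * a e⌋₊)}

theorem abs_classPoint_floor_sub_le {r : Γ.Edge → ZMod 2} {L : ℝ} {a : Γ.Edge → ℝ}
    (hL : 0 ≤ L) (e : Γ.Edge) (ha : 0 ≤ a e) :
    |(Γ.classPoint r (fun e => ⌊L / 2 * a e⌋₊) e : ℝ) - L * a e| ≤ 2 := by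
  have h1 : ((2 * ⌊L / 2 * a e⌋₊ + 1 : ℕ) : ℝ) ≤ Γ.classPoint r (fun e => ⌊L / 2 * a e⌋₊) e :=
    Nat.cast_le.2 (Γ.one_le_classPoint r (fun e => ⌊L / 2 * a e⌋₊) e)
  have h2 : (Γ.classPoint r (fun e => ⌊L / 2 * a e⌋₊) e : ℝ) ≤ (2 * ⌊L / 2 * a e⌋₊ + 2 : ℕ) :=
    Nat.cast_le.2 (Γ.classPoint_le r (fun e => ⌊L / 2 * a e⌋₊) e)
  have h3 := Nat.floor_le (show 0 ≤ L / 2 * a e by positivity)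
  have h4 := Nat.lt_floor_add_one (L / 2 * a e)
  push_cast at h1 h2
  rw [abs_le]
  constructor <;> linarith

theorem abs_sum_classPoint_sub_le {r : Γ.Edge → ZMod 2} {L : ℝ} {a : Γ.Edge → ℝ}
    (hL : 0 ≤ L) (ha : ∀ e, 0 ≤ a e) (j : Fin s) :
    |((∑ e, Γ.mult j e * Γ.classPoint r (fun e => ⌊L / 2 * a e⌋₊) e : ℕ) : ℝ) -
      L * ∑ e, (Γ.mult j e : ℝ) * a e| ≤ 4 * Γ.numEdges := by
  have h1 : ((∑ e, Γ.mult j e * Γ.classPoint r (fun e => ⌊L / 2 * a e⌋₊) e : ℕ) : ℝ) -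
      L * ∑ e, (Γ.mult j e : ℝ) * a e = ∑ e, (Γ.mult j e : ℝ) *
        ((Γ.classPoint r (fun e => ⌊L / 2 * a e⌋₊) e : ℝ) - L * a e) := by
    push_cast
    rw [Finset.mul_sum, ← Finset.sum_sub_distrib]
    exact Finset.sum_congr rfl fun e _ => by ring
  rw [h1]
  refine (Finset.abs_sum_le_sum_abs _ _).trans ?_
  calc ∑ e, |(Γ.mult j e : ℝ) *
        ((Γ.classPoint r (fun e => ⌊L / 2 * a e⌋₊) e : ℝ) - L * a e)|
      -- An edge appears at most twice in a face, and its weight moves by at most `2`.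
      ≤ ∑ _e : Γ.Edge, (4 : ℝ) := by
        refine Finset.sum_le_sum fun e _ => ?_
        rw [abs_mul, Nat.abs_cast]
        have h2 : (Γ.mult j e : ℝ) ≤ 2 := by exact_mod_cast Γ.mult_le_two j e
        have h3 := Γ.abs_classPoint_floor_sub_le (r := r) hL e (ha e)
        have h4 := abs_nonneg ((Γ.classPoint r (fun e => ⌊L / 2 * a e⌋₊) e : ℝ) - L * a e)
        nlinarith
    _ = _ := by simp [mul_comm]

theorem cells_subset {n : Fin s → ℕ} {r : Γ.Edge → ZMod 2} {ε : ℝ}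
    (hn : ∀ i, 4 * (Γ.numEdges : ℝ) ≤ ε * n i) :
    Γ.cells n r ⊆ Γ.region fun i => (1 + ε) * n i := by
  rintro a ⟨ha, hf⟩
  refine ⟨ha, fun i => ?_⟩
  have h1 := abs_le.1 (Γ.abs_sum_classPoint_sub_le (r := r) zero_le_one ha i)
  have h2 : ((∑ e, Γ.mult i e * Γ.classPoint r (fun e => ⌊1 / 2 * a e⌋₊) e : ℕ) : ℝ) ≤ n i :=
    Nat.cast_le.2 (hf i)
  linarith [hn i]

theorem subset_cells {n : Fin s → ℕ} {r : Γ.Edge → ZMod 2} {ε : ℝ}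
    (hn : ∀ i, 4 * (Γ.numEdges : ℝ) ≤ ε * n i) :
    (Γ.region fun i => (1 - ε) * n i) ⊆ Γ.cells n r := by
  rintro a ⟨ha, hf⟩
  refine ⟨ha, fun i => ?_⟩
  have h1 := abs_le.1 (Γ.abs_sum_classPoint_sub_le (r := r) zero_le_one ha i)
  rw [← Nat.cast_le (α := ℝ)]
  linarith [hn i, hf i]

theorem card_classSet_eq (n : Fin s → ℕ) (r : Γ.Edge → ZMod 2)
    (hm : MeasurableSet (Γ.cells n r)) :
    ((Γ.classSet n r).card : ℝ) = (2 ^ Γ.numEdges)⁻¹ * volume.real (Γ.cells n r) := by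
  classical
  have h := Γ.sum_classSet_eq_integral one_pos n r (fun _ => 1)
  simp only [one_pow, inv_one, one_mul, Finset.sum_const, nsmul_eq_mul, mul_one] at h
  rw [h]
  congr 1
  rw [← integral_indicator_one hm]
  refine integral_congr_ae (Eventually.of_forall fun a => ?_)
  simp only [Set.indicator_apply, cells, Set.mem_ofPred_eq, Pi.one_apply]

theorem measurableSet_cells (n : Fin s → ℕ) (r : Γ.Edge → ZMod 2) :
    MeasurableSet (Γ.cells n r) := by
  have h1 : Measurable fun (a : Γ.Edge → ℝ) (e : Γ.Edge) => ⌊1 / 2 * a e⌋₊ :=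
    measurable_pi_lambda _ fun e =>
      Nat.measurable_floor.comp (measurable_const.mul (measurable_pi_apply e))
  have h2 : MeasurableSet {k : Γ.Edge → ℕ | Γ.Fits n (Γ.classPoint r k)} := .of_discrete
  have h3 : MeasurableSet {a : Γ.Edge → ℝ | ∀ e, 0 ≤ a e} := by
    rw [Set.ofPred_forall]
    exact MeasurableSet.iInter fun e => measurableSet_le measurable_const (measurable_pi_apply e)
  exact h3.inter (h1 h2)

/-- Rounding to a lattice point changes each face sum by at most `4 |E| ≤ ε n i`, so the union of
cells of every class lies between the dilates of the polytope by `1 - ε` and `1 + ε`. Volumes scale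
by the power `|E|`, and the number of classes does not depend on `n`. -/
theorem countRatio_mem {Γ : RibbonGraph s} (hc : Γ.Connected) {n : Fin s → ℕ}
    (he : Even (∑ j, n j)) (hpos : ∀ i, 0 < n i) {ε : ℝ} (hε : 0 < ε) (hε1 : ε < 1)
    (hn : ∀ i, 4 * (Γ.numEdges : ℝ) ≤ ε * n i) :
    (1 - ε) ^ Γ.numEdges * Γ.parityConst ≤ Γ.countRatio n ∧
      Γ.countRatio n ≤ (1 + ε) ^ Γ.numEdges * Γ.parityConst := by
  have hv : 0 < volume.real (Γ.region fun j => (n j : ℝ)) :=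
    Γ.volume_real_region_pos fun i => Nat.cast_pos.2 (hpos i)
  have hcard : ((Γ.solutions n).card : ℝ) =
      ∑ r ∈ Γ.parityClasses n, ((Γ.classSet n r).card : ℝ) := by
    have := Γ.sum_solutions n fun _ => 1
    simpa using this
  have hlow : ∀ r, (1 - ε) ^ Γ.numEdges * volume.real (Γ.region fun j => (n j : ℝ)) ≤
      volume.real (Γ.cells n r) := fun r => by
    rw [← Γ.volume_real_region_mul (by linarith)]
    refine measureReal_mono (Γ.subset_cells hn) ?_
    exact ((measure_mono (Γ.cells_subset hn)).trans_lt (Γ.volume_region_lt_top _)).ne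
  have hup : ∀ r, volume.real (Γ.cells n r) ≤
      (1 + ε) ^ Γ.numEdges * volume.real (Γ.region fun j => (n j : ℝ)) := fun r => by
    rw [← Γ.volume_real_region_mul (by linarith)]
    exact measureReal_mono (Γ.cells_subset hn) (Γ.volume_region_lt_top _).ne
  unfold countRatio
  rw [le_div_iff₀ hv, div_le_iff₀ hv, hcard]
  simp_rw [Γ.card_classSet_eq n _ (Γ.measurableSet_cells n _)]
  unfold parityConst
  rw [← card_parityClasses hc he]
  constructor
  · calc (1 - ε) ^ Γ.numEdges * (((Γ.parityClasses n).card : ℝ) / 2 ^ Γ.numEdges) *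
          volume.real (Γ.region fun j => (n j : ℝ))
        = ∑ _r ∈ Γ.parityClasses n, (2 ^ Γ.numEdges)⁻¹ *
            ((1 - ε) ^ Γ.numEdges * volume.real (Γ.region fun j => (n j : ℝ))) := by
          rw [Finset.sum_const, nsmul_eq_mul]; ring
      _ ≤ _ := Finset.sum_le_sum fun r _ =>
          mul_le_mul_of_nonneg_left (hlow r) (by positivity)
  · calc ∑ r ∈ Γ.parityClasses n, (2 ^ Γ.numEdges)⁻¹ * volume.real (Γ.cells n r)
        ≤ ∑ _r ∈ Γ.parityClasses n, (2 ^ Γ.numEdges)⁻¹ *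
            ((1 + ε) ^ Γ.numEdges * volume.real (Γ.region fun j => (n j : ℝ))) :=
          Finset.sum_le_sum fun r _ => mul_le_mul_of_nonneg_left (hup r) (by positivity)
      _ = _ := by rw [Finset.sum_const, nsmul_eq_mul]; ring

theorem tendsto_countRatio {Γ : RibbonGraph s} (hc : Γ.Connected) :
    Tendsto Γ.countRatio (evenAtTop s) (𝓝 Γ.parityConst) := by
  have hev : ∀ ε : ℝ, 0 < ε → ε < 1 → ∀ᶠ n in evenAtTop s,
      (1 - ε) ^ Γ.numEdges * Γ.parityConst ≤ Γ.countRatio n ∧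
      Γ.countRatio n ≤ (1 + ε) ^ Γ.numEdges * Γ.parityConst := by
    intro ε hε hε1
    have h1 : ∀ᶠ n : Fin s → ℕ in atTop, ∀ i, ⌈4 * (Γ.numEdges : ℝ) / ε⌉₊ + 1 ≤ n i :=
      eventually_ge_atTop _
    have h2 : ∀ᶠ n : Fin s → ℕ in evenAtTop s, Even (∑ j, n j) :=
      mem_inf_of_right (mem_principal_self _)
    filter_upwards [h1.filter_mono inf_le_left, h2] with n hn he
    refine countRatio_mem hc he (fun i => by have := hn i; omega) hε hε1 fun i => ?_
    have h3 : ((⌈4 * (Γ.numEdges : ℝ) / ε⌉₊ + 1 : ℕ) : ℝ) ≤ n i := Nat.cast_le.2 (hn i)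
    have h4 := Nat.le_ceil (4 * (Γ.numEdges : ℝ) / ε)
    push_cast at h3
    rw [mul_comm ε, ← div_le_iff₀ hε]
    linarith
  have hpos : ∀ᶠ ε : ℝ in 𝓝[>] 0, 0 < ε ∧ ε < 1 :=
    Ioo_mem_nhdsGT one_pos
  rw [tendsto_order]
  constructor
  · intro b hb
    have h1 : Tendsto (fun ε : ℝ => (1 - ε) ^ Γ.numEdges * Γ.parityConst) (𝓝[>] 0)
        (𝓝 Γ.parityConst) := by
      have h : Continuous fun ε : ℝ => (1 - ε) ^ Γ.numEdges * Γ.parityConst := by fun_prop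
      simpa using (h.tendsto 0).mono_left nhdsWithin_le_nhds
    obtain ⟨ε, hε, hb'⟩ := (hpos.and (h1.eventually (lt_mem_nhds hb))).exists
    exact (hev ε hε.1 hε.2).mono fun n hn => hb'.trans_le hn.1
  · intro b hb
    have h1 : Tendsto (fun ε : ℝ => (1 + ε) ^ Γ.numEdges * Γ.parityConst) (𝓝[>] 0)
        (𝓝 Γ.parityConst) := by
      have h : Continuous fun ε : ℝ => (1 + ε) ^ Γ.numEdges * Γ.parityConst := by fun_prop
      simpa using (h.tendsto 0).mono_left nhdsWithin_le_nhds
    obtain ⟨ε, hε, hb'⟩ := (hpos.and (h1.eventually (gt_mem_nhds hb))).exists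
    exact (hev ε hε.1 hε.2).mono fun n hn => hn.2.trans_lt hb'

/-- Makes the limit defining `combConst` unique; doubling a large vector gives one of even sum. -/
instance neBot_evenAtTop (s : ℕ) : NeBot (evenAtTop s) := by
  refine inf_principal_neBot_iff.2 fun U hU => ?_
  obtain ⟨n, hn⟩ := mem_atTop_sets.1 hU
  refine ⟨fun j => 2 * n j, hn _ fun j => ?_, ?_⟩
  · change n j ≤ 2 * n j
    omega
  · change Even (∑ j, 2 * n j)
    rw [← Finset.mul_sum]
    exact even_two_mul _

theorem combConst_eq {Γ : RibbonGraph s} (hc : Γ.Connected) : Γ.combConst = Γ.parityConst :=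
  (tendsto_countRatio hc).limUnder_eq

end Count

/-! ### Riemann sums over the edge weights -/

section Riemann

/-- A translate of the kernel of a linear form, which is a proper subspace since the form takes the
value `t i ≠ 0`; or the empty set. Hence rounding near the boundary faces of the polytope does not
affect the limit. -/
theorem volume_boundary {t : Fin s → ℝ} {i : Fin s} (ht : t i ≠ 0) :
    volume {a : Γ.Edge → ℝ | ∑ e, (Γ.mult i e : ℝ) * a e = t i} = 0 := by
  let l : (Γ.Edge → ℝ) →ₗ[ℝ] ℝ := ∑ e, (Γ.mult i e : ℝ) • LinearMap.proj e
  have hl : ∀ a, l a = ∑ e, (Γ.mult i e : ℝ) * a e := fun a => by simp [l]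
  by_cases h : ∃ p, l p = t i
  · obtain ⟨p, hp⟩ := h
    have h1 : {a : Γ.Edge → ℝ | ∑ e, (Γ.mult i e : ℝ) * a e = t i} =
        (fun a => a + -p) ⁻¹' (LinearMap.ker l : Set (Γ.Edge → ℝ)) := by
      ext a
      simp only [Set.mem_ofPred_eq, Set.mem_preimage, SetLike.mem_coe, LinearMap.mem_ker, map_add,
        map_neg, hp, ← hl]
      constructor <;> intro h <;> linarith
    rw [h1, measure_preimage_add_right]
    refine Measure.addHaar_submodule _ _ fun htop => ht ?_
    rw [← hp, ← LinearMap.mem_ker, htop]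
    trivial
  · have h1 : {a : Γ.Edge → ℝ | ∑ e, (Γ.mult i e : ℝ) * a e = t i} = ∅ := by
      ext a
      simp only [Set.mem_ofPred_eq, Set.mem_empty_iff_false, iff_false, ← hl]
      exact fun h2 => h ⟨a, h2⟩
    rw [h1, measure_empty]

/-- The integrable majorant of the edge kernels. -/
def majorant (T x : ℝ) : ℝ := (Set.Ioc 0 T).indicator (fun x => (√(x / 2))⁻¹) x

theorem integrable_majorant (T : ℝ) : Integrable (majorant T) := by
  unfold majorant
  rw [integrable_indicator_iff measurableSet_Ioc]
  have h1 : IntervalIntegrable (fun x : ℝ => x ^ (-(1 / 2) : ℝ)) volume 0 (max T 0) :=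
    intervalIntegral.intervalIntegrable_rpow' (by norm_num)
  have h2 := (intervalIntegrable_iff_integrableOn_Ioc_of_le (le_max_right _ _)).1 h1
  have h3 : IntegrableOn (fun x : ℝ => √2 * x ^ (-(1 / 2) : ℝ)) (Set.Ioc 0 T) :=
    (h2.mono_set (Set.Ioc_subset_Ioc_right (le_max_left _ _))).const_mul _
  refine h3.congr_fun (fun x hx => ?_) measurableSet_Ioc
  simp only
  rw [Real.sqrt_div hx.1.le, inv_div, Real.rpow_neg hx.1.le, ← Real.sqrt_eq_rpow, div_eq_mul_inv]

/-- Dominated convergence for the step functions of each residue class. Off the null set of boundary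
hyperplanes a point is eventually admissible or eventually not, and the weights rounded from `a` are
a sequence to which `hlim` applies. The bound `hB` is singular at small weights but integrable. -/
theorem tendsto_sum_solutions {Γ : RibbonGraph s} (hc : Γ.Connected) {L : ℕ → ℝ}
    (hL : Tendsto L atTop atTop) {n : ℕ → Fin s → ℕ} {t : Fin s → ℝ} (ht : ∀ i, 0 < t i)
    (hn : ∀ i, Tendsto (fun M => (n M i : ℝ) / L M) atTop (𝓝 (t i)))
    (he : ∀ M, Even (∑ i, n M i)) {g : ℕ → (Γ.Edge → ℕ) → ℝ} {G : (Γ.Edge → ℝ) → ℝ} {B T : ℝ}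
    (hT : ∀ i, t i < T)
    (hB : ∀ᶠ M in atTop, ∀ w : Γ.Edge → ℕ, (∀ e, 1 ≤ w e) → (∀ e, (w e : ℝ) ≤ T * L M) →
      |g M w| ≤ B * ∏ e, (√((w e : ℝ) / L M))⁻¹)
    (hlim : ∀ a : Γ.Edge → ℝ, (∀ e, 0 < a e) → ∀ w : ℕ → Γ.Edge → ℕ, (∀ M e, 1 ≤ w M e) →
      (∀ e, Tendsto (fun M => (w M e : ℝ) / L M) atTop (𝓝 (a e))) →
      Tendsto (fun M => g M (w M)) atTop (𝓝 (G a))) :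
    IntegrableOn G (Γ.region t) ∧
      Tendsto (fun M => (L M ^ Γ.numEdges)⁻¹ * ∑ q ∈ Γ.solutions (n M), g M q.2) atTop
        (𝓝 (Γ.parityConst * ∫ a in Γ.region t, G a)) := by
  classical
  have hLpos : ∀ᶠ M in atTop, 0 < L M := hL.eventually_gt_atTop 0
  have hnT : ∀ᶠ M in atTop, ∀ i, (n M i : ℝ) ≤ T * L M := by
    refine eventually_all.2 fun i => ?_
    filter_upwards [(hn i).eventually (gt_mem_nhds (hT i)), hLpos] with M h1 h2
    exact ((div_lt_iff₀ h2).1 h1).le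
  let F : (Γ.Edge → ZMod 2) → ℕ → (Γ.Edge → ℝ) → ℝ := fun r M a =>
    if (∀ e, 0 ≤ a e) ∧ Γ.Fits (n M) (Γ.classPoint r fun e => ⌊L M / 2 * a e⌋₊) then
      g M (Γ.classPoint r fun e => ⌊L M / 2 * a e⌋₊) else 0
  have hFm : ∀ r M, AEStronglyMeasurable (F r M) volume := by
    intro r M
    have h1 : Measurable fun (a : Γ.Edge → ℝ) (e : Γ.Edge) => ⌊L M / 2 * a e⌋₊ :=
      measurable_pi_lambda _ fun e =>
        Nat.measurable_floor.comp (measurable_const.mul (measurable_pi_apply e))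
    have h2 : Measurable fun k : Γ.Edge → ℕ => if Γ.Fits (n M) (Γ.classPoint r k) then
      g M (Γ.classPoint r k) else 0 := measurable_of_countable _
    have h3 : MeasurableSet {a : Γ.Edge → ℝ | ∀ e, 0 ≤ a e} := by
      rw [Set.ofPred_forall]
      exact MeasurableSet.iInter fun e => measurableSet_le measurable_const (measurable_pi_apply e)
    convert ((h2.comp h1).indicator h3).aestronglyMeasurable using 1
    ext a
    simp only [F, Set.indicator_apply, Set.mem_ofPred_eq, Function.comp, ite_and]
  have hae0 : ∀ᵐ a : Γ.Edge → ℝ, ∀ e, a e ≠ 0 := by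
    refine ae_all_iff.2 fun e => ?_
    rw [ae_iff]
    simp only [not_not]
    exact Measure.pi_hyperplane (fun _ : Γ.Edge => (volume : Measure ℝ)) e 0
  have haet : ∀ᵐ a : Γ.Edge → ℝ, ∀ i, ∑ e, (Γ.mult i e : ℝ) * a e ≠ t i := by
    refine ae_all_iff.2 fun i => ?_
    rw [ae_iff]
    simp only [not_not]
    exact Γ.volume_boundary (ht i).ne'
  have hbound : ∀ r, ∀ᶠ M in atTop, ∀ᵐ a : Γ.Edge → ℝ,
      ‖F r M a‖ ≤ |B| * ∏ e, majorant (2 * T) (a e) := by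
    intro r
    filter_upwards [hLpos, hnT, hB] with M hLM hnM hBM
    filter_upwards [hae0] with a ha0
    have hmn : ∀ e, 0 ≤ majorant (2 * T) (a e) := fun e =>
      Set.indicator_nonneg (fun x _ => by positivity) _
    simp only [F]
    split_ifs with h
    · have hk : ∀ e, L M / 2 * a e ≤ Γ.classPoint r (fun e => ⌊L M / 2 * a e⌋₊) e := by
        intro e
        have h1 := Γ.one_le_classPoint r (fun e => ⌊L M / 2 * a e⌋₊) e
        have h2 := Nat.lt_floor_add_one (L M / 2 * a e)
        have h3 : ((⌊L M / 2 * a e⌋₊ + 1 : ℕ) : ℝ) ≤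
            Γ.classPoint r (fun e => ⌊L M / 2 * a e⌋₊) e := Nat.cast_le.2 (by omega)
        push_cast at h3
        linarith
      have hwT : ∀ e, (Γ.classPoint r (fun e => ⌊L M / 2 * a e⌋₊) e : ℝ) ≤ T * L M := fun e =>
        (Nat.cast_le.2 (h.2.le e)).trans (hnM _)
      have hapos : ∀ e, 0 < a e := fun e => lt_of_le_of_ne (h.1 e) (ha0 e).symm
      refine (hBM _ (fun e => ?_) hwT).trans ?_
      · have := Γ.one_le_classPoint r (fun e => ⌊L M / 2 * a e⌋₊) e
        omega
      refine mul_le_mul (le_abs_self B) ?_ (Finset.prod_nonneg fun e _ => by positivity)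
        (abs_nonneg B)
      refine Finset.prod_le_prod (fun e _ => by positivity) fun e _ => ?_
      have hmem : a e ∈ Set.Ioc 0 (2 * T) := by
        refine ⟨hapos e, ?_⟩
        have := (hk e).trans (hwT e)
        nlinarith
      rw [majorant, Set.indicator_of_mem hmem]
      refine inv_anti₀ (Real.sqrt_pos.2 (by have := hapos e; positivity))
        (Real.sqrt_le_sqrt ?_)
      rw [le_div_iff₀ hLM]
      linarith [hk e]
    · rw [norm_zero]
      exact mul_nonneg (abs_nonneg B) (Finset.prod_nonneg fun e _ => hmn e)
  have hint : Integrable (fun a : Γ.Edge → ℝ => |B| * ∏ e, majorant (2 * T) (a e)) :=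
    (Integrable.fintype_prod fun _ => integrable_majorant _).const_mul _
  have hptw : ∀ r, ∀ᵐ a : Γ.Edge → ℝ,
      Tendsto (fun M => F r M a) atTop (𝓝 ((Γ.region t).indicator G a)) := by
    intro r
    filter_upwards [hae0, haet] with a ha0 hat
    by_cases hneg : ∀ e, 0 ≤ a e
    swap
    · have h1 : a ∉ Γ.region t := fun h => hneg h.1
      rw [Set.indicator_of_notMem h1]
      refine tendsto_const_nhds.congr fun M => ?_
      simp only [F]
      rw [if_neg fun h => hneg h.1]
    have hapos : ∀ e, 0 < a e := fun e => lt_of_le_of_ne (hneg e) (ha0 e).symm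
    have hinv : Tendsto (fun M => (L M)⁻¹) atTop (𝓝 0) := tendsto_inv_atTop_zero.comp hL
    have hw : ∀ e, Tendsto (fun M =>
        (Γ.classPoint r (fun e => ⌊L M / 2 * a e⌋₊) e : ℝ) / L M) atTop (𝓝 (a e)) := by
      intro e
      rw [tendsto_iff_norm_sub_tendsto_zero]
      have h2 : Tendsto (fun M => 2 * (L M)⁻¹) atTop (𝓝 0) := by simpa using hinv.const_mul 2
      refine squeeze_zero' (Eventually.of_forall fun M => norm_nonneg _) ?_ h2
      filter_upwards [hLpos] with M hM
      have h1 := Γ.abs_classPoint_floor_sub_le (r := r) hM.le e (hneg e)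
      rw [Real.norm_eq_abs, div_sub' hM.ne', abs_div, abs_of_pos hM, ← div_eq_mul_inv]
      gcongr
    have hsum : ∀ i, Tendsto (fun M =>
        ((∑ e, Γ.mult i e * Γ.classPoint r (fun e => ⌊L M / 2 * a e⌋₊) e : ℕ) : ℝ) / L M) atTop
        (𝓝 (∑ e, (Γ.mult i e : ℝ) * a e)) := by
      intro i
      have h1 := tendsto_finsetSum Finset.univ fun e _ => (hw e).const_mul (Γ.mult i e : ℝ)
      refine h1.congr fun M => ?_
      push_cast
      rw [Finset.sum_div]
      exact Finset.sum_congr rfl fun e _ => by ring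
    by_cases hreg : a ∈ Γ.region t
    · rw [Set.indicator_of_mem hreg]
      have hl := hlim a hapos (fun M => Γ.classPoint r fun e => ⌊L M / 2 * a e⌋₊) (fun M e => by
        have := Γ.one_le_classPoint r (fun e => ⌊L M / 2 * a e⌋₊) e
        omega) hw
      refine hl.congr' ?_
      have hfit : ∀ᶠ M in atTop, ∀ i,
          ∑ e, Γ.mult i e * Γ.classPoint r (fun e => ⌊L M / 2 * a e⌋₊) e ≤ n M i := by
        refine eventually_all.2 fun i => ?_
        filter_upwards [(hsum i).eventually_lt (hn i) (lt_of_le_of_ne (hreg.2 i) (hat i)),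
          hLpos] with M h1 h2
        have h3 := (div_lt_div_iff_of_pos_right h2).1 h1
        exact_mod_cast h3.le
      filter_upwards [hfit] with M hM
      simp only [F]
      rw [if_pos ⟨hneg, hM⟩]
    · rw [Set.indicator_of_notMem hreg]
      have h1 : ∃ i, t i < ∑ e, (Γ.mult i e : ℝ) * a e := by
        by_contra! hcon
        exact hreg ⟨hneg, hcon⟩
      obtain ⟨i, hi⟩ := h1
      refine tendsto_const_nhds.congr' ?_
      filter_upwards [(hn i).eventually_lt (hsum i) hi, hLpos] with M h1 h2
      have h3 := (div_lt_div_iff_of_pos_right h2).1 h1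
      simp only [F]
      rw [if_neg]
      rintro ⟨-, hf⟩
      have h4 : ∑ e, Γ.mult i e * Γ.classPoint r (fun e => ⌊L M / 2 * a e⌋₊) e ≤ n M i := hf i
      have h5 := Nat.cast_le (α := ℝ).2 h4
      linarith
  have hlimint : ∀ r, Tendsto (fun M => ∫ a, F r M a) atTop (𝓝 (∫ a in Γ.region t, G a)) := by
    intro r
    rw [← integral_indicator (Γ.measurableSet_region t)]
    exact tendsto_integral_filter_of_dominated_convergence _
      (Eventually.of_forall (hFm r)) (hbound r) hint (hptw r)
  -- `G` is not assumed measurable; on the region it is an almost everywhere limit of the step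
  -- functions, and inherits their bound.
  have hGint : IntegrableOn G (Γ.region t) := by
    rw [← integrable_indicator_iff (Γ.measurableSet_region t)]
    have hm : AEStronglyMeasurable ((Γ.region t).indicator G) volume :=
      aestronglyMeasurable_of_tendsto_ae atTop (hFm 0) (hptw 0)
    refine hint.mono' hm ?_
    obtain ⟨M₀, hM₀⟩ := eventually_atTop.1 (hbound 0)
    have hall : ∀ᵐ a : Γ.Edge → ℝ, ∀ M, M₀ ≤ M →
        ‖F 0 M a‖ ≤ |B| * ∏ e, majorant (2 * T) (a e) :=
      ae_all_iff.2 fun M => by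
        by_cases h : M₀ ≤ M
        · exact (hM₀ M h).mono fun a ha _ => ha
        · exact Eventually.of_forall fun a h' => absurd h' h
    filter_upwards [hall, hptw 0] with a h1 h2
    exact le_of_tendsto h2.norm (eventually_atTop.2 ⟨M₀, h1⟩)
  refine ⟨hGint, ?_⟩
  -- The set of admissible residues varies with `M`, only its size is fixed; so the errors are
  -- controlled over all residues together.
  have hdiff : Tendsto (fun M => ∑ r, |(∫ a, F r M a) - ∫ a in Γ.region t, G a|) atTop (𝓝 0) := by
    have h1 : ∀ r, Tendsto (fun M => |(∫ a, F r M a) - ∫ a in Γ.region t, G a|) atTop (𝓝 0) := by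
      intro r
      have := ((hlimint r).sub_const (∫ a in Γ.region t, G a)).abs
      simpa using this
    simpa using tendsto_finsetSum Finset.univ fun r _ => h1 r
  rw [tendsto_iff_norm_sub_tendsto_zero]
  have hdiff2 : Tendsto (fun M => ((2 : ℝ) ^ Γ.numEdges)⁻¹ *
      ∑ r, |(∫ a, F r M a) - ∫ a in Γ.region t, G a|) atTop (𝓝 0) := by
    simpa using hdiff.const_mul ((2 : ℝ) ^ Γ.numEdges)⁻¹
  refine squeeze_zero' (Eventually.of_forall fun M => norm_nonneg _) ?_ hdiff2
  filter_upwards [hLpos] with M hM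
  rw [Γ.sum_solutions, Finset.mul_sum]
  simp_rw [Γ.sum_classSet_eq_integral hM]
  unfold parityConst
  rw [← card_parityClasses hc (he M)]
  have h1 : ∑ r ∈ Γ.parityClasses (n M), (2 ^ Γ.numEdges : ℝ)⁻¹ * (∫ a, F r M a) -
      ((Γ.parityClasses (n M)).card : ℝ) / 2 ^ Γ.numEdges * ∫ a in Γ.region t, G a =
      (2 ^ Γ.numEdges)⁻¹ *
        ∑ r ∈ Γ.parityClasses (n M), ((∫ a, F r M a) - ∫ a in Γ.region t, G a) := by
    rw [Finset.sum_sub_distrib, Finset.sum_const, nsmul_eq_mul, ← Finset.mul_sum]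
    ring
  change ‖∑ r ∈ Γ.parityClasses (n M), (2 ^ Γ.numEdges : ℝ)⁻¹ * (∫ a, F r M a) - _‖ ≤ _
  rw [h1, norm_mul, Real.norm_of_nonneg (by positivity : (0 : ℝ) ≤ (2 ^ Γ.numEdges)⁻¹)]
  refine mul_le_mul_of_nonneg_left ?_ (by positivity)
  refine (norm_sum_le _ _).trans ?_
  exact Finset.sum_le_sum_of_subset_of_nonneg (Finset.subset_univ _) fun r _ _ => abs_nonneg _

end Riemann

end RibbonGraph

/-! ### The walk between blocks -/

/-- The transition matrix of the walk between blocks. -/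
def blockWalk (d D : ℕ) (lam : ℝ) : Matrix (Fin d → ZMod D) (Fin d → ZMod D) ℝ :=
  Matrix.of fun x y => (if x = y then 1 - lam else 0) +
    (neighborCount x y : ℝ) * (lam / (2 * (d : ℝ)))

section Walk

variable {d D : ℕ} {lam : ℝ}

theorem wegnerProfile_apply (M : ℕ) (x y : (Fin d → ZMod D) × Fin M) :
    wegnerProfile d D M lam x y = blockWalk d D lam x.1 y.1 / M := by
  simp only [wegnerProfile, blockWalk, Matrix.of_apply]
  split_ifs
  · rw [add_div, mul_div_assoc, div_div]
  · rw [add_div, mul_div_assoc, div_div, zero_div]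

theorem blockWalk_nonneg (h : lam ∈ Set.Ico (0 : ℝ) 1) (x y : Fin d → ZMod D) :
    0 ≤ blockWalk d D lam x y := by
  have h0 := h.1
  have h1 : 0 ≤ 1 - lam := by linarith [h.2]
  simp only [blockWalk, Matrix.of_apply]
  split_ifs <;> positivity

theorem one_sub_le_blockWalk (h : lam ∈ Set.Ico (0 : ℝ) 1) (x : Fin d → ZMod D) :
    1 - lam ≤ blockWalk d D lam x x := by
  have h0 := h.1
  simp only [blockWalk, Matrix.of_apply, if_true]
  have : 0 ≤ (neighborCount x x : ℝ) * (lam / (2 * (d : ℝ))) := by positivity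
  linarith

variable [NeZero D]

/-- The matrix `J_M / M` is idempotent, so only the block coordinate evolves. At `w = 0` this fails,
but weights of solutions are at least `1`. -/
theorem wegnerProfile_pow_apply {M : ℕ} (hM : 1 ≤ M) {w : ℕ} (hw : 1 ≤ w)
    (x y : (Fin d → ZMod D) × Fin M) :
    (wegnerProfile d D M lam ^ w) x y = (blockWalk d D lam ^ w) x.1 y.1 / M := by
  obtain ⟨w, rfl⟩ := Nat.exists_eq_add_of_le' hw
  clear hw
  have hM0 : (M : ℝ) ≠ 0 := by positivity
  induction w generalizing y with
  | zero => simp [wegnerProfile_apply]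
  | succ w ih =>
    rw [pow_succ, Matrix.mul_apply, pow_succ _ (w + 1), Matrix.mul_apply, Fintype.sum_prod_type,
      Finset.sum_div]
    refine Finset.sum_congr rfl fun z _ => ?_
    simp only [ih, wegnerProfile_apply, Finset.sum_const, Finset.card_univ, Fintype.card_fin,
      nsmul_eq_mul]
    field_simp

theorem gbeProfile_pow_apply {M : ℕ} (hM : 1 ≤ M) {w : ℕ} (hw : 1 ≤ w) (x y : Fin M) :
    (gbeProfile M ^ w) x y = 1 / M := by
  obtain ⟨w, rfl⟩ := Nat.exists_eq_add_of_le' hw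
  clear hw
  have hM0 : (M : ℝ) ≠ 0 := by positivity
  induction w generalizing y with
  | zero => simp [gbeProfile]
  | succ w ih =>
    rw [pow_succ, Matrix.mul_apply]
    simp_rw [ih]
    simp only [gbeProfile, Matrix.of_apply, Finset.sum_const, Finset.card_univ,
      Fintype.card_fin, nsmul_eq_mul]
    field_simp

theorem sum_neighborCount (x : Fin d → ZMod D) : ∑ y, neighborCount x y = 2 * d := by
  unfold neighborCount
  simp_rw [Finset.card_filter]
  rw [Finset.sum_comm]
  simp [mul_comm]

theorem sum_blockWalk (hd : 1 ≤ d) (x : Fin d → ZMod D) : ∑ y, blockWalk d D lam x y = 1 := by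
  simp only [blockWalk, Matrix.of_apply]
  rw [Finset.sum_add_distrib, ← Finset.sum_mul, ← Nat.cast_sum, sum_neighborCount]
  have : (d : ℝ) ≠ 0 := by positivity
  simp only [Finset.sum_ite_eq, Finset.mem_univ, if_true]
  push_cast
  field_simp
  ring

theorem blockWalk_pow_nonneg (h : lam ∈ Set.Ico (0 : ℝ) 1) (w : ℕ) (x y : Fin d → ZMod D) :
    0 ≤ (blockWalk d D lam ^ w) x y := by
  induction w generalizing y with
  | zero => rw [pow_zero, Matrix.one_apply]; split_ifs <;> norm_num
  | succ w ih =>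
    rw [pow_succ, Matrix.mul_apply]
    exact Finset.sum_nonneg fun z _ => mul_nonneg (ih z) (blockWalk_nonneg h _ _)

theorem sum_blockWalk_pow (hd : 1 ≤ d) (w : ℕ) (x : Fin d → ZMod D) :
    ∑ y, (blockWalk d D lam ^ w) x y = 1 := by
  induction w with
  | zero => simp [Matrix.one_apply]
  | succ w ih =>
    simp_rw [pow_succ, Matrix.mul_apply]
    rw [Finset.sum_comm]
    simp_rw [← Finset.mul_sum, sum_blockWalk hd, mul_one]
    exact ih

theorem blockWalk_pow_le_one (hd : 1 ≤ d) (h : lam ∈ Set.Ico (0 : ℝ) 1) (w : ℕ)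
    (x y : Fin d → ZMod D) : (blockWalk d D lam ^ w) x y ≤ 1 := by
  rw [← sum_blockWalk_pow (lam := lam) hd w x]
  exact Finset.single_le_sum (f := fun y => (blockWalk d D lam ^ w) x y)
    (fun z _ => blockWalk_pow_nonneg h w x z) (Finset.mem_univ y)

/-- The contribution of the path which never moves. -/
theorem one_sub_pow_le_blockWalk_pow (h : lam ∈ Set.Ico (0 : ℝ) 1) (w : ℕ)
    (x : Fin d → ZMod D) : (1 - lam) ^ w ≤ (blockWalk d D lam ^ w) x x := by
  have h1 : 0 ≤ 1 - lam := by linarith [h.2]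
  induction w with
  | zero => simp
  | succ w ih =>
    rw [pow_succ, pow_succ, Matrix.mul_apply]
    calc (1 - lam) ^ w * (1 - lam) ≤ (blockWalk d D lam ^ w) x x * blockWalk d D lam x x :=
          mul_le_mul ih (one_sub_le_blockWalk h x) h1 (blockWalk_pow_nonneg h w x x)
      _ ≤ _ := Finset.single_le_sum
          (f := fun z => (blockWalk d D lam ^ w) x z * blockWalk d D lam z x)
          (fun z _ => mul_nonneg (blockWalk_pow_nonneg h w x z) (blockWalk_nonneg h _ _))
          (Finset.mem_univ x)

theorem one_sub_mul_le_blockWalk_pow (h : lam ∈ Set.Ico (0 : ℝ) 1) (w : ℕ)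
    (x : Fin d → ZMod D) : 1 - w * lam ≤ (blockWalk d D lam ^ w) x x := by
  refine le_trans ?_ (one_sub_pow_le_blockWalk_pow h w x)
  have := one_add_mul_le_pow (show (-2 : ℝ) ≤ -lam by linarith [h.2]) w
  rw [← sub_eq_add_neg] at this
  linarith

/-- By conservation of mass, what is elsewhere has left the starting point. -/
theorem blockWalk_pow_le_of_ne (hd : 1 ≤ d) (h : lam ∈ Set.Ico (0 : ℝ) 1) (w : ℕ)
    {x y : Fin d → ZMod D} (hxy : x ≠ y) : (blockWalk d D lam ^ w) x y ≤ w * lam := by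
  have h1 := sum_blockWalk_pow (lam := lam) hd w x
  have h2 : (blockWalk d D lam ^ w) x x + (blockWalk d D lam ^ w) x y ≤
      ∑ z, (blockWalk d D lam ^ w) x z := by
    rw [← Finset.sum_pair (f := fun z => (blockWalk d D lam ^ w) x z) hxy]
    exact Finset.sum_le_sum_of_subset_of_nonneg (Finset.subset_univ _) fun z _ _ =>
      blockWalk_pow_nonneg h w x z
  linarith [one_sub_mul_le_blockWalk_pow h w x]

end Walk

/-! ### Reduction to the block walk, and the frozen regime -/

namespace RibbonGraph

variable {s : ℕ} (Γ : RibbonGraph s)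

/-- The weight of a labelling of the vertices by blocks. -/
def blockWeight {d D : ℕ} [NeZero D] (lam : ℝ) (x : Γ.Vertex → Fin d → ZMod D)
    (w : Γ.Edge → ℕ) : ℝ :=
  ∏ e, (blockWalk d D lam ^ w e) (x (Γ.src e)) (x (Γ.tgt e))

/-- The weight does not depend on the positions inside the blocks: they contribute `M` choices per
vertex, against a factor `1 / M` per edge. -/
theorem wegnerF_eq {d D M : ℕ} [NeZero D] (hM : 1 ≤ M) (lam : ℝ) (n : Fin s → ℕ) :
    wegnerF Γ d D M lam n = (M : ℝ) ^ Fintype.card Γ.Vertex * ((M : ℝ) ^ Γ.numEdges)⁻¹ *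
      ∑ x : Γ.Vertex → Fin d → ZMod D, ∑ q ∈ Γ.solutions n, Γ.blockWeight lam x q.2 := by
  have h1 : wegnerF Γ d D M lam n = ∑ η : Γ.Vertex → (Fin d → ZMod D) × Fin M,
      ((M : ℝ) ^ Γ.numEdges)⁻¹ *
        ∑ q ∈ Γ.solutions n, Γ.blockWeight lam (fun v => (η v).1) q.2 := by
    unfold wegnerF diagramFunction
    refine Finset.sum_congr rfl fun η _ => ?_
    rw [Finset.mul_sum]
    refine Finset.sum_congr rfl fun q hq => ?_
    have hq1 := ((Γ.mem_solutions n q).1 hq).1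
    rw [Finset.prod_congr rfl fun e _ => wegnerProfile_pow_apply hM (hq1 e) _ _,
      Finset.prod_div_distrib, blockWeight]
    simp [div_eq_inv_mul]
  rw [h1, ← (Equiv.arrowProdEquivProdArrow Γ.Vertex _ _).symm.sum_comp, Fintype.sum_prod_type,
    Finset.mul_sum]
  refine Finset.sum_congr rfl fun x _ => ?_
  change ∑ _y : Γ.Vertex → Fin M, ((M : ℝ) ^ Γ.numEdges)⁻¹ *
    ∑ q ∈ Γ.solutions n, Γ.blockWeight lam x q.2 = _
  rw [Finset.sum_const, Finset.card_univ, Fintype.card_fun, Fintype.card_fin, nsmul_eq_mul,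
    mul_assoc]
  push_cast
  rfl

theorem gbeF_eq {M : ℕ} (hM : 1 ≤ M) (n : Fin s → ℕ) :
    gbeF Γ M n = (M : ℝ) ^ Fintype.card Γ.Vertex * ((M : ℝ) ^ Γ.numEdges)⁻¹ *
      (Γ.solutions n).card := by
  unfold gbeF diagramFunction
  rw [Finset.sum_congr rfl fun η _ => Finset.sum_congr rfl fun q hq =>
    Finset.prod_congr rfl fun e _ =>
      gbeProfile_pow_apply hM (((Γ.mem_solutions n q).1 hq).1 e) _ _]
  simp only [one_div, Finset.prod_const, Finset.card_univ, Fintype.card_fin, inv_pow,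
    Finset.sum_const, nsmul_eq_mul, Fintype.card_fun]
  push_cast
  ring

variable {Γ} in
-- For a constant labelling all walks may stay put for the whole time. For any other labelling,
-- connectedness provides an edge with different end labels, and the walk along this edge has to
-- move.
theorem abs_blockWeight_sub_le {d D : ℕ} [NeZero D] (hc : Γ.Connected) (hd : 1 ≤ d) {lam : ℝ}
    (h : lam ∈ Set.Ico (0 : ℝ) 1) (x : Γ.Vertex → Fin d → ZMod D) (w : Γ.Edge → ℕ)
    [Decidable (∃ c, x = fun _ => c)] :
    |Γ.blockWeight lam x w - if ∃ c, x = fun _ => c then 1 else 0| ≤ (∑ e, (w e : ℝ)) * lam := by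
  have hle : ∀ e, (w e : ℝ) ≤ ∑ e, (w e : ℝ) := fun e =>
    Finset.single_le_sum (f := fun e => (w e : ℝ)) (fun _ _ => Nat.cast_nonneg _)
      (Finset.mem_univ e)
  have hle1 : Γ.blockWeight lam x w ≤ 1 :=
    Finset.prod_le_one (fun e _ => blockWalk_pow_nonneg h _ _ _)
      fun e _ => blockWalk_pow_le_one hd h _ _ _
  have h0 : 0 ≤ Γ.blockWeight lam x w := Finset.prod_nonneg fun e _ => blockWalk_pow_nonneg h _ _ _
  split_ifs with hx
  · obtain ⟨c, rfl⟩ := hx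
    rw [abs_sub_comm, abs_of_nonneg (by linarith)]
    have h1 : (1 - lam) ^ (∑ e, w e) ≤ Γ.blockWeight lam (fun _ => c) w := by
      rw [← Finset.prod_pow_eq_pow_sum]
      exact Finset.prod_le_prod (fun e _ => pow_nonneg (by linarith [h.2]) _)
        fun e _ => one_sub_pow_le_blockWalk_pow h _ _
    have h2 := one_add_mul_le_pow (show (-2 : ℝ) ≤ -lam by linarith [h.2]) (∑ e, w e)
    rw [← sub_eq_add_neg] at h2
    push_cast at h2
    linarith
  · rw [sub_zero, abs_of_nonneg h0]
    have hex : ∃ e, x (Γ.src e) ≠ x (Γ.tgt e) := by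
      by_contra! hcon
      -- Without corners there are no vertices and every labelling is constant, so a base corner
      -- exists.
      exact hx ⟨x (Quot.mk _ (Classical.choice (by
        by_contra hne
        rw [not_nonempty_iff] at hne
        exact hx ⟨0, funext fun v => by
          obtain ⟨c, rfl⟩ := Quot.exists_rep v
          exact hne.elim c⟩))), funext fun v => hc.congr x hcon _ _⟩
    obtain ⟨e, he⟩ := hex
    calc Γ.blockWeight lam x w ≤ (blockWalk d D lam ^ w e) (x (Γ.src e)) (x (Γ.tgt e)) := by
          unfold blockWeight
          rw [← Finset.mul_prod_erase _ _ (Finset.mem_univ e)]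
          exact mul_le_of_le_one_right (blockWalk_pow_nonneg h _ _ _)
            (Finset.prod_le_one (fun e _ => blockWalk_pow_nonneg h _ _ _)
              fun e _ => blockWalk_pow_le_one hd h _ _ _)
      _ ≤ w e * lam := blockWalk_pow_le_of_ne hd h _ he
      _ ≤ _ := mul_le_mul_of_nonneg_right (hle e) h.1

theorem sum_constant {V T : Type*} [Fintype V] [DecidableEq V] [Fintype T] [Nonempty V]
    [DecidablePred fun x : V → T => ∃ c, x = fun _ => c] :
    ∑ x : V → T, (if ∃ c, x = fun _ => c then (1 : ℝ) else 0) = Fintype.card T := by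
  classical
  rw [Finset.sum_boole]
  have : (Finset.univ.filter fun x : V → T => ∃ c, x = fun _ => c) =
      Finset.univ.image fun c : T => fun _ : V => c := by
    ext x; simp [eq_comm]
  rw [this, Finset.card_image_of_injective _
    fun a b h => congrFun h (Classical.arbitrary V), Finset.card_univ]

theorem abs_sum_sub_le {X : Type*} [Fintype X] {f c : X → ℝ} {N b : ℝ}
    (h : ∀ x, |f x - N * c x| ≤ b) : |∑ x, f x - N * ∑ x, c x| ≤ Fintype.card X * b := by
  rw [Finset.mul_sum, ← Finset.sum_sub_distrib]
  refine (Finset.abs_sum_le_sum_abs _ _).trans ?_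
  refine (Finset.sum_le_sum fun x _ => h x).trans ?_
  simp

theorem abs_sum_blockWeight_sub_le {Γ : RibbonGraph s} (hs : 1 ≤ s) {d D : ℕ} [NeZero D]
    (hc : Γ.Connected) (hd : 1 ≤ d) {lam : ℝ} (h : lam ∈ Set.Ico (0 : ℝ) 1) (n : Fin s → ℕ) :
    |∑ x : Γ.Vertex → Fin d → ZMod D, ∑ q ∈ Γ.solutions n, Γ.blockWeight lam x q.2 -
      (Γ.solutions n).card * (D : ℝ) ^ d| ≤
      Fintype.card (Γ.Vertex → Fin d → ZMod D) *
        ((Γ.solutions n).card * (Γ.numEdges * ∑ i, (n i : ℝ) * lam)) := by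
  classical
  have : Nonempty Γ.Vertex := ⟨Γ.marked ⟨0, hs⟩⟩
  have hDd : (D : ℝ) ^ d = ∑ x : Γ.Vertex → Fin d → ZMod D,
      if ∃ c, x = fun _ => c then (1 : ℝ) else 0 := by
    rw [sum_constant, Fintype.card_pi_const, ZMod.card]; push_cast; rfl
  rw [hDd]
  refine abs_sum_sub_le fun x => ?_
  rw [← nsmul_eq_mul, ← Finset.sum_const, ← Finset.sum_sub_distrib]
  refine (Finset.abs_sum_le_sum_abs _ _).trans ?_
  rw [← nsmul_eq_mul _ (_ * _), ← Finset.sum_const]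
  refine Finset.sum_le_sum fun q hq => ?_
  refine (abs_blockWeight_sub_le hc hd h x q.2).trans ?_
  rw [← Finset.sum_mul, ← mul_assoc]
  refine mul_le_mul_of_nonneg_right ?_ h.1
  calc ∑ e, (q.2 e : ℝ) ≤ ∑ _e : Γ.Edge, ∑ i, (n i : ℝ) := by
        refine Finset.sum_le_sum fun e _ => ?_
        refine (Nat.cast_le.2 ((Γ.fits_of_mem_solutions hq).le e)).trans ?_
        exact Finset.single_le_sum (f := fun i => (n i : ℝ)) (fun _ _ => Nat.cast_nonneg _)
          (Finset.mem_univ _)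
    _ = _ := by simp

theorem wegnerF_zero {Γ : RibbonGraph s} (hs : 1 ≤ s) {d D M : ℕ} [NeZero D]
    (hc : Γ.Connected) (hd : 1 ≤ d) (hM : 1 ≤ M) (n : Fin s → ℕ) :
    wegnerF Γ d D M 0 n = (D : ℝ) ^ d * gbeF Γ M n := by
  have h := abs_sum_blockWeight_sub_le hs (D := D) hc hd
    (show (0 : ℝ) ∈ Set.Ico (0 : ℝ) 1 by simp) n
  simp only [mul_zero, Finset.sum_const_zero, abs_nonpos_iff, sub_eq_zero] at h
  rw [Γ.wegnerF_eq hM, Γ.gbeF_eq hM, h]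
  ring

/-- The error is proportional to the number of solutions, as is the main term. No asymptotics of
that number is needed, and the perimeters may have an odd sum, in which case both sides vanish. -/
theorem frozen_isEquivalent {Γ : RibbonGraph s} (hs : 1 ≤ s) (hc : Γ.Connected) {d D : ℕ}
    [NeZero D] (hd : 1 ≤ d) {lam : ℕ → ℝ} (hlam : ∀ M, lam M ∈ Set.Ico (0 : ℝ) 1)
    {n : ℕ → Fin s → ℕ} (hn : ∀ i, Tendsto (fun M => (n M i : ℝ) * lam M) atTop (𝓝 0)) :
    (fun M => 1 / (∏ i, (n M i : ℝ)) * wegnerF Γ d D M (lam M) (n M)) ~[atTop]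
      (fun M => 1 / (∏ i, (n M i : ℝ)) * ((D : ℝ) ^ d * gbeF Γ M (n M))) := by
  refine isLittleO_iff.2 fun c hc0 => ?_
  set K := (Fintype.card (Γ.Vertex → Fin d → ZMod D) : ℝ) with hK
  have h1 : Tendsto (fun M => (K * Γ.numEdges) * ∑ i, (n M i : ℝ) * lam M) atTop (𝓝 0) := by
    simpa using (tendsto_finsetSum Finset.univ fun i _ => hn i).const_mul (K * Γ.numEdges)
  filter_upwards [h1.eventually (gt_mem_nhds hc0), eventually_ge_atTop 1] with M hM1 hM
  have h2 : |_ - _ * _| ≤ K * _ := abs_sum_blockWeight_sub_le hs (D := D) hc hd (hlam M) (n M)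
  have hD1 : (1 : ℝ) ≤ (D : ℝ) ^ d := by
    refine one_le_pow₀ ?_
    exact_mod_cast NeZero.one_le
  rw [Pi.sub_apply, Γ.wegnerF_eq hM, Γ.gbeF_eq hM]
  set A := (M : ℝ) ^ Fintype.card Γ.Vertex * ((M : ℝ) ^ Γ.numEdges)⁻¹
  set N := ((Γ.solutions (n M)).card : ℝ)
  have hN : 0 ≤ N := Nat.cast_nonneg _
  set S := ∑ x : Γ.Vertex → Fin d → ZMod D, ∑ q ∈ Γ.solutions (n M),
    Γ.blockWeight (lam M) x q.2
  have e1 : 1 / (∏ i, (n M i : ℝ)) * (A * S) - 1 / (∏ i, (n M i : ℝ)) * ((D : ℝ) ^ d * (A * N)) =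
      1 / (∏ i, (n M i : ℝ)) * A * (S - N * (D : ℝ) ^ d) := by ring
  have e2 : 1 / (∏ i, (n M i : ℝ)) * ((D : ℝ) ^ d * (A * N)) =
      1 / (∏ i, (n M i : ℝ)) * A * ((D : ℝ) ^ d * N) := by ring
  rw [e1, e2, norm_mul, norm_mul _ ((D : ℝ) ^ d * N), mul_left_comm c]
  refine mul_le_mul_of_nonneg_left ?_ (norm_nonneg (1 / (∏ i, (n M i : ℝ)) * A))
  rw [Real.norm_eq_abs, Real.norm_of_nonneg (by positivity : 0 ≤ (D : ℝ) ^ d * N)]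
  refine h2.trans ?_
  calc K * (N * (Γ.numEdges * ∑ i, (n M i : ℝ) * lam M))
      = ((K * Γ.numEdges) * ∑ i, (n M i : ℝ) * lam M) * N := by ring
    _ ≤ c * ((D : ℝ) ^ d * N) := by
      refine mul_le_mul hM1.le ?_ hN hc0.le
      exact le_mul_of_one_le_left hN hD1

end RibbonGraph

/-! ### Fourier bounds for the lazy walk on the integers -/

/-- The `w`-step transition probabilities of the lazy simple random walk on `ℤ`. -/
def lazyWalk (lam : ℝ) : ℕ → ℤ → ℝ
  | 0, k => if k = 0 then 1 else 0
  | w + 1, k => (1 - lam) * lazyWalk lam w k +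
      lam / 2 * (lazyWalk lam w (k - 1) + lazyWalk lam w (k + 1))

/-- The characteristic function of a step of the lazy walk at the complex frequency `θ + iξ`. -/
def lazySymbol (lam θ ξ : ℝ) : ℂ := 1 - lam + lam * Complex.cosh (θ + ξ * Complex.I)

section LazyWalk

variable {lam : ℝ}

theorem lazyWalk_nonneg (h : lam ∈ Set.Ico (0 : ℝ) 1) (w : ℕ) (k : ℤ) : 0 ≤ lazyWalk lam w k := by
  have h0 := h.1
  have h1 : 0 ≤ 1 - lam := by linarith [h.2]
  induction w generalizing k with
  | zero => simp only [lazyWalk]; split_ifs <;> norm_num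
  | succ w ih =>
    have := ih k; have := ih (k - 1); have := ih (k + 1)
    simp only [lazyWalk]
    positivity

theorem lazyWalk_eq_zero {w : ℕ} {k : ℤ} (hk : (w : ℤ) < |k|) : lazyWalk lam w k = 0 := by
  induction w generalizing k with
  | zero =>
    have : k ≠ 0 := by rintro rfl; simp at hk
    simp [lazyWalk, this]
  | succ w ih =>
    push_cast at hk
    simp only [lazyWalk]
    rw [ih (by omega), ih (by grind), ih (by grind)]
    simp

theorem continuous_lazySymbol (lam θ : ℝ) : Continuous (lazySymbol lam θ) := by
  unfold lazySymbol
  have : Continuous Complex.cosh := Complex.continuous_cosh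
  fun_prop

theorem integral_exp_int (k : ℤ) :
    ∫ ξ in (-Real.pi)..Real.pi, Complex.exp (-(k * ξ * Complex.I)) =
      if k = 0 then 2 * Real.pi else 0 := by
  split_ifs with hk
  · subst hk
    simp
    ring
  · have hc : -(k * Complex.I : ℂ) ≠ 0 := by
      simp [hk, Complex.I_ne_zero]
    have h1 := integral_exp_mul_complex (a := -Real.pi) (b := Real.pi) hc
    have h2 : ∀ ξ : ℝ, Complex.exp (-(k * ξ * Complex.I)) =
        Complex.exp (-(k * Complex.I) * ξ) := fun ξ => by congr 1; ring
    simp_rw [h2]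
    rw [h1, Complex.ofReal_zero, div_eq_zero_iff]
    left
    rw [sub_eq_zero]
    refine Complex.exp_eq_exp_iff_exists_int.2 ⟨-k, ?_⟩
    push_cast
    ring

/-- Fourier inversion for the tilted walk: the factor `exp (θ k)` moves the contour to the complex
frequency `θ + iξ`. One step of the walk multiplies the transform by `lazySymbol`. -/
theorem lazyWalk_mul_exp (lam θ : ℝ) (w : ℕ) (k : ℤ) :
    (lazyWalk lam w k : ℂ) * Complex.exp (θ * k) = (2 * Real.pi : ℂ)⁻¹ *
      ∫ ξ in (-Real.pi)..Real.pi,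
        lazySymbol lam θ ξ ^ w * Complex.exp (-(k * ξ * Complex.I)) := by
  have hpi : (2 * Real.pi : ℂ) ≠ 0 := by
    have := Real.pi_ne_zero
    exact_mod_cast mul_ne_zero two_ne_zero this
  induction w generalizing k with
  | zero =>
    simp only [lazyWalk, pow_zero, one_mul, integral_exp_int]
    split_ifs with hk
    · subst hk
      push_cast
      rw [inv_mul_cancel₀ hpi]
      simp
    · simp
  | succ w ih =>
    have hcont : ∀ j : ℤ, Continuous fun ξ : ℝ =>
        lazySymbol lam θ ξ ^ w * Complex.exp (-(j * ξ * Complex.I)) := fun j => by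
      have := continuous_lazySymbol lam θ
      fun_prop
    have hint : ∀ j : ℤ, IntervalIntegrable (fun ξ : ℝ =>
        lazySymbol lam θ ξ ^ w * Complex.exp (-(j * ξ * Complex.I))) volume
        (-Real.pi) Real.pi := fun j => (hcont j).intervalIntegrable _ _
    have hstep : ∀ ξ : ℝ, lazySymbol lam θ ξ ^ (w + 1) * Complex.exp (-(k * ξ * Complex.I)) =
        (1 - lam) * (lazySymbol lam θ ξ ^ w * Complex.exp (-(k * ξ * Complex.I))) +
        (lam / 2 * Complex.exp θ *
          (lazySymbol lam θ ξ ^ w * Complex.exp (-((k - 1 : ℤ) * ξ * Complex.I))) +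
        lam / 2 * Complex.exp (-θ) *
          (lazySymbol lam θ ξ ^ w * Complex.exp (-((k + 1 : ℤ) * ξ * Complex.I)))) := by
      intro ξ
      have e1 : Complex.exp (-((k - 1 : ℤ) * ξ * Complex.I)) =
          Complex.exp (-(k * ξ * Complex.I)) * Complex.exp (ξ * Complex.I) := by
        rw [← Complex.exp_add]; congr 1; push_cast; ring
      have e2 : Complex.exp (-((k + 1 : ℤ) * ξ * Complex.I)) =
          Complex.exp (-(k * ξ * Complex.I)) * Complex.exp (-(ξ * Complex.I)) := by
        rw [← Complex.exp_add]; congr 1; push_cast; ring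
      have e3 : lazySymbol lam θ ξ = 1 - lam + lam * ((Complex.exp θ * Complex.exp (ξ * Complex.I) +
          Complex.exp (-θ) * Complex.exp (-(ξ * Complex.I))) / 2) := by
        rw [lazySymbol, Complex.cosh, neg_add, Complex.exp_add, Complex.exp_add]
      rw [e1, e2, pow_succ]
      generalize lazySymbol lam θ ξ ^ w = A
      rw [e3]
      ring
    simp_rw [hstep]
    rw [intervalIntegral.integral_add ((hint k).const_mul _)
      (((hint (k - 1)).const_mul _).add ((hint (k + 1)).const_mul _)),
      intervalIntegral.integral_add ((hint (k - 1)).const_mul _) ((hint (k + 1)).const_mul _),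
      intervalIntegral.integral_const_mul, intervalIntegral.integral_const_mul,
      intervalIntegral.integral_const_mul]
    have i0 := ih k
    have i1 := ih (k - 1)
    have i2 := ih (k + 1)
    have e1 : Complex.exp (θ * (k - 1 : ℤ)) * Complex.exp θ = Complex.exp (θ * k) := by
      rw [← Complex.exp_add]; congr 1; push_cast; ring
    have e2 : Complex.exp (θ * (k + 1 : ℤ)) * Complex.exp (-θ) = Complex.exp (θ * k) := by
      rw [← Complex.exp_add]; congr 1; push_cast; ring
    simp only [lazyWalk]
    push_cast
    have j1 : (lazyWalk lam w (k - 1) : ℂ) * Complex.exp (θ * k) = _ :=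
      (by rw [← e1, ← mul_assoc] : _ = (lazyWalk lam w (k - 1) : ℂ) *
        Complex.exp (θ * (k - 1 : ℤ)) * Complex.exp θ).trans (congrArg (· * Complex.exp (θ : ℂ)) i1)
    have j2 : (lazyWalk lam w (k + 1) : ℂ) * Complex.exp (θ * k) = _ :=
      (by rw [← e2, ← mul_assoc] : _ = (lazyWalk lam w (k + 1) : ℂ) *
        Complex.exp (θ * (k + 1 : ℤ)) * Complex.exp (-θ)).trans
          (congrArg (· * Complex.exp (-θ : ℂ)) i2)
    push_cast at i0 j1 j2
    linear_combination (1 - (lam : ℂ)) * i0 + (lam : ℂ) / 2 * j1 + (lam : ℂ) / 2 * j2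

/-- The square of the modulus is `sinh² θ + cos² ξ = 1 + (sinh² θ - sin² ξ)`, and `√(1 + x) ≤ 1 + x
/ 2`. -/
theorem norm_cosh_le (θ ξ : ℝ) :
    ‖Complex.cosh (θ + ξ * Complex.I)‖ ≤ 1 + (Real.sinh θ ^ 2 - Real.sin ξ ^ 2) / 2 := by
  have h1 : ‖Complex.cosh (θ + ξ * Complex.I)‖ ^ 2 = Real.sinh θ ^ 2 + Real.cos ξ ^ 2 := by
    rw [Complex.sq_norm, Complex.cosh_add, Complex.cosh_mul_I, Complex.sinh_mul_I,
      ← Complex.ofReal_cosh, ← Complex.ofReal_cos, ← Complex.ofReal_sinh, ← Complex.ofReal_sin]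
    have : (Real.cosh θ : ℂ) * Real.cos ξ + Real.sinh θ * (Real.sin ξ * Complex.I) =
        ((Real.cosh θ * Real.cos ξ : ℝ) : ℂ) +
          ((Real.sinh θ * Real.sin ξ : ℝ) : ℂ) * Complex.I := by push_cast; ring
    rw [this, Complex.normSq_add_mul_I]
    have h2 := Real.cosh_sq θ
    have h3 := Real.sin_sq_add_cos_sq ξ
    rw [mul_pow, mul_pow, h2]
    linear_combination Real.sinh θ ^ 2 * h3
  have h3 := Real.sin_sq_add_cos_sq ξ
  nlinarith [sq_nonneg (‖Complex.cosh (θ + ξ * Complex.I)‖ - 1)]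

theorem norm_lazySymbol_le (h : lam ∈ Set.Ico (0 : ℝ) 1) (θ ξ : ℝ) :
    ‖lazySymbol lam θ ξ‖ ≤ Real.exp (lam * (Real.sinh θ ^ 2 - Real.sin ξ ^ 2) / 2) := by
  have h1 : ‖lazySymbol lam θ ξ‖ ≤ (1 - lam) + lam * ‖Complex.cosh (θ + ξ * Complex.I)‖ := by
    unfold lazySymbol
    refine (norm_add_le _ _).trans ?_
    rw [norm_mul, Complex.norm_real, Real.norm_of_nonneg h.1]
    gcongr
    rw [← Complex.ofReal_one, ← Complex.ofReal_sub, Complex.norm_real,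
      Real.norm_of_nonneg (by linarith [h.2])]
  have h2 := mul_le_mul_of_nonneg_left (norm_cosh_le θ ξ) h.1
  have h3 := Real.add_one_le_exp (lam * (Real.sinh θ ^ 2 - Real.sin ξ ^ 2) / 2)
  linarith

/-- The bound on the symbol depends on `sin² ξ`, which is small near both `0` and `π`. Folding
brings both frequencies to an interval on which `|sin ξ| ≥ 2 |ξ| / π`. -/
theorem integral_fold {E : Type*} [NormedAddCommGroup E] [NormedSpace ℝ E] {f : ℝ → E}
    (hf : Continuous f) (hp : Function.Periodic f (2 * Real.pi)) :
    ∫ ξ in (-Real.pi)..Real.pi, f ξ =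
      ∫ ξ in (-(Real.pi / 2))..(Real.pi / 2), (f ξ + f (ξ + Real.pi)) := by
  have h1 := hp.intervalIntegral_add_eq (-Real.pi) (-(Real.pi / 2))
  have e1 : -Real.pi + 2 * Real.pi = Real.pi := by ring
  rw [e1] at h1
  have hc : Continuous fun ξ => f (ξ + Real.pi) := by fun_prop
  rw [h1, intervalIntegral.integral_add (hf.intervalIntegrable _ _) (hc.intervalIntegrable _ _),
    intervalIntegral.integral_comp_add_right,
    ← intervalIntegral.integral_add_adjacent_intervals (b := Real.pi / 2)
      (hf.intervalIntegrable _ _) (hf.intervalIntegrable _ _)]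
  congr 2 <;> ring

theorem sin_sq_ge {ξ : ℝ} (h : ξ ∈ Set.Icc (-(Real.pi / 2)) (Real.pi / 2)) :
    4 / Real.pi ^ 2 * ξ ^ 2 ≤ Real.sin ξ ^ 2 := by
  have h1 := Real.mul_abs_le_abs_sin (abs_le.2 h)
  have h2 := pow_le_pow_left₀ (by positivity) h1 2
  rw [mul_pow, sq_abs, sq_abs, div_pow] at h2
  norm_num at h2 ⊢
  exact h2

theorem integral_exp_sin_sq_le {c : ℝ} (hc : 0 < c) :
    ∫ ξ in (-Real.pi)..Real.pi, Real.exp (-(c * Real.sin ξ ^ 2 / 2)) ≤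
      4 * Real.pi * (√c)⁻¹ := by
  have hpi := Real.pi_pos
  have hcont : Continuous fun ξ : ℝ => Real.exp (-(c * Real.sin ξ ^ 2 / 2)) := by fun_prop
  rw [integral_fold hcont (fun ξ => by simp [Real.sin_add_two_pi])]
  simp only [Real.sin_add_pi, neg_sq]
  have hb : 0 < 2 * c / Real.pi ^ 2 := by positivity
  have hg := integrable_exp_neg_mul_sq hb
  calc ∫ ξ in (-(Real.pi / 2))..(Real.pi / 2), (Real.exp (-(c * Real.sin ξ ^ 2 / 2)) +
        Real.exp (-(c * Real.sin ξ ^ 2 / 2)))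
      ≤ ∫ ξ in (-(Real.pi / 2))..(Real.pi / 2),
          2 * Real.exp (-(2 * c / Real.pi ^ 2) * ξ ^ 2) := by
        refine intervalIntegral.integral_mono_on (by linarith)
          ((hcont.add hcont).intervalIntegrable _ _)
          (Continuous.intervalIntegrable (by fun_prop) _ _) fun ξ hξ => ?_
        rw [← two_mul]
        gcongr
        have h1 := mul_le_mul_of_nonneg_left (sin_sq_ge hξ) hc.le
        have h2 : -(2 * c / Real.pi ^ 2) * ξ ^ 2 = -(c * (4 / Real.pi ^ 2 * ξ ^ 2) / 2) := by ring
        rw [h2]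
        linarith
    _ ≤ ∫ ξ, 2 * Real.exp (-(2 * c / Real.pi ^ 2) * ξ ^ 2) := by
        rw [intervalIntegral.integral_of_le (by linarith)]
        exact setIntegral_le_integral (hg.const_mul 2)
          (Eventually.of_forall fun ξ => by positivity)
    _ = 2 * √(Real.pi / (2 * c / Real.pi ^ 2)) := by
        rw [integral_const_mul, integral_gaussian]
    _ ≤ _ := by
        have h1 : Real.pi / (2 * c / Real.pi ^ 2) ≤ (2 * Real.pi) ^ 2 * c⁻¹ := by
          rw [div_div_eq_mul_div, div_le_iff₀ (by positivity)]
          have : (2 * Real.pi) ^ 2 * c⁻¹ * (2 * c) = 8 * Real.pi ^ 2 := by field_simp; ring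
          rw [this]
          nlinarith [Real.pi_le_four, sq_nonneg Real.pi]
        calc 2 * √(Real.pi / (2 * c / Real.pi ^ 2)) ≤ 2 * √((2 * Real.pi) ^ 2 * c⁻¹) := by gcongr
          _ = _ := by
            rw [Real.sqrt_mul (by positivity), Real.sqrt_sq (by positivity), Real.sqrt_inv]
            ring

theorem lazyWalk_le_exp (h : lam ∈ Set.Ico (0 : ℝ) 1) (θ : ℝ) {w : ℕ} (hw : 0 < lam * w)
    (k : ℤ) : lazyWalk lam w k * Real.exp (θ * k) ≤
      2 * (√(lam * w))⁻¹ * Real.exp (lam * w * Real.sinh θ ^ 2 / 2) := by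
  have hpi := Real.pi_pos
  have h1 : lazyWalk lam w k * Real.exp (θ * k) =
      ‖(lazyWalk lam w k : ℂ) * Complex.exp (θ * k)‖ := by
    have : (lazyWalk lam w k : ℂ) * Complex.exp (θ * k) =
        ((lazyWalk lam w k * Real.exp (θ * k) : ℝ) : ℂ) := by push_cast; rfl
    rw [this, Complex.norm_real, Real.norm_of_nonneg]
    exact mul_nonneg (lazyWalk_nonneg h w k) (Real.exp_pos _).le
  rw [h1, lazyWalk_mul_exp, norm_mul]
  have h2 : ‖((2 * Real.pi : ℂ))⁻¹‖ = (2 * Real.pi)⁻¹ := by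
    rw [norm_inv, norm_mul, Complex.norm_real, Real.norm_of_nonneg hpi.le]; simp
  have h3 : ‖∫ ξ in (-Real.pi)..Real.pi,
      lazySymbol lam θ ξ ^ w * Complex.exp (-(k * ξ * Complex.I))‖ ≤
      ∫ ξ in (-Real.pi)..Real.pi, Real.exp (lam * w * Real.sinh θ ^ 2 / 2) *
        Real.exp (-(lam * w * Real.sin ξ ^ 2 / 2)) := by
    refine intervalIntegral.norm_integral_le_of_norm_le (by linarith)
      (Eventually.of_forall fun ξ _ => ?_) (Continuous.intervalIntegrable (by fun_prop) _ _)
    have h4 : ‖Complex.exp (-(k * ξ * Complex.I))‖ = 1 := by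
      rw [Complex.norm_exp]; simp
    rw [norm_mul, norm_pow, h4, mul_one, ← Real.exp_add]
    refine (pow_le_pow_left₀ (norm_nonneg _) (norm_lazySymbol_le h θ ξ) w).trans ?_
    rw [← Real.exp_nat_mul]
    refine le_of_eq (congrArg _ ?_)
    ring
  rw [intervalIntegral.integral_const_mul] at h3
  have h5 := integral_exp_sin_sq_le hw
  rw [h2]
  calc (2 * Real.pi)⁻¹ * ‖∫ ξ in (-Real.pi)..Real.pi,
        lazySymbol lam θ ξ ^ w * Complex.exp (-(k * ξ * Complex.I))‖
      ≤ (2 * Real.pi)⁻¹ * (Real.exp (lam * w * Real.sinh θ ^ 2 / 2) *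
          (4 * Real.pi * (√(lam * w))⁻¹)) := by
        gcongr
        exact h3.trans (mul_le_mul_of_nonneg_left h5 (Real.exp_pos _).le)
    _ = _ := by field_simp; ring

theorem sinh_le_two_mul {x : ℝ} (h0 : 0 ≤ x) (h1 : x ≤ 1) : Real.sinh x ≤ 2 * x := by
  have h2 := Real.exp_bound_div_one_sub_of_interval (x := x / 2) (by linarith) (by linarith)
  have h3 := Real.add_one_le_exp (-x)
  have h4 : Real.exp x ≤ 1 + 3 * x := by
    have h5 : Real.exp x = Real.exp (x / 2) ^ 2 := by rw [← Real.exp_nat_mul]; congr 1; ring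
    have h6 : 1 / (1 - x / 2) ≤ 1 + x := by
      rw [div_le_iff₀ (by linarith)]; nlinarith
    have h7 : Real.exp (x / 2) ≤ 1 + x := h2.trans h6
    rw [h5]
    nlinarith [Real.exp_pos (x / 2)]
  rw [Real.sinh_eq]
  linarith

/-- Tilting by `θ = ± 1 / ℓ`, with `ℓ = √(λ L)`, gains the decay `exp (-|k| / ℓ)` at the bounded
cost `exp (λ w sinh² θ / 2)`, since `λ w (2 / ℓ)² = 4 w / L ≤ 4 T`. The factor `(w / L) ^ (-1/2)` is
what `tendsto_sum_solutions` can integrate. -/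
theorem lazyWalk_le (h : lam ∈ Set.Ico (0 : ℝ) 1) {L T : ℝ} (hL : 0 < L)
    (hell : 1 ≤ √(lam * L)) {w : ℕ} (hw : 1 ≤ w) (hwT : (w : ℝ) ≤ T * L) (k : ℤ) :
    √(lam * L) * lazyWalk lam w k ≤
      2 * Real.exp (2 * T) * (√((w : ℝ) / L))⁻¹ * Real.exp (-(|(k : ℝ)| / √(lam * L))) := by
  set l := √(lam * L) with hl
  have hl0 : 0 < l := by linarith
  have hlsq : l ^ 2 = lam * L := Real.sq_sqrt (mul_nonneg h.1 hL.le)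
  have hlam : 0 < lam := by
    rcases h.1.eq_or_lt with h0 | h0
    · rw [← h0, zero_mul] at hlsq
      nlinarith
    · exact h0
  have hw0 : (0 : ℝ) < w := by exact_mod_cast hw
  have hsgn : ∃ θ : ℝ, θ * k = |(k : ℝ)| / l ∧ Real.sinh θ ^ 2 ≤ (2 / l) ^ 2 := by
    -- The condition `ℓ ≥ 1` enters here: the tilt is at most `1`, where `sinh` is at most twice its
    -- argument.
    have hs : Real.sinh l⁻¹ ≤ 2 / l := by
      have := sinh_le_two_mul (inv_nonneg.2 hl0.le) (inv_le_one_of_one_le₀ hell)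
      rwa [← div_eq_mul_inv] at this
    have hs0 : 0 ≤ Real.sinh l⁻¹ := Real.sinh_nonneg_iff.2 (inv_nonneg.2 hl0.le)
    rcases le_total 0 (k : ℝ) with hk | hk
    · exact ⟨l⁻¹, by rw [abs_of_nonneg hk]; ring, pow_le_pow_left₀ hs0 hs 2⟩
    · exact ⟨-l⁻¹, by rw [abs_of_nonpos hk]; ring, by
        rw [Real.sinh_neg, neg_sq]; exact pow_le_pow_left₀ hs0 hs 2⟩
  obtain ⟨θ, hθ, hsθ⟩ := hsgn
  have h1 := lazyWalk_le_exp h θ (mul_pos hlam hw0) k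
  rw [hθ] at h1
  have h2 : √(lam * w) = l * √((w : ℝ) / L) := by
    rw [hl, ← Real.sqrt_mul (mul_nonneg h.1 hL.le)]
    congr 1
    field_simp
  have h3 : lam * w * Real.sinh θ ^ 2 / 2 ≤ 2 * T := by
    have h4 : lam * w * Real.sinh θ ^ 2 ≤ lam * w * (2 / l) ^ 2 :=
      mul_le_mul_of_nonneg_left hsθ (by positivity)
    have h5 : lam * w * (2 / l) ^ 2 = 4 * (w / L) := by
      rw [div_pow, hlsq]
      field_simp
      norm_num
    have h6 : (w : ℝ) / L ≤ T := (div_le_iff₀ hL).2 hwT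
    linarith
  rw [Real.exp_neg, ← div_eq_mul_inv, le_div_iff₀ (Real.exp_pos _), mul_assoc]
  calc l * (lazyWalk lam w k * Real.exp (|(k : ℝ)| / l))
      ≤ l * (2 * (√(lam * w))⁻¹ * Real.exp (lam * w * Real.sinh θ ^ 2 / 2)) := by gcongr
    _ ≤ l * (2 * (√(lam * w))⁻¹ * Real.exp (2 * T)) := by gcongr
    _ = _ := by
      rw [h2, mul_inv]
      field_simp

end LazyWalk

/-! ### The Gaussian local limit theorem -/

section LocalLimit

theorem tendsto_one_sub_pow {x : ℕ → ℝ} {w : ℕ → ℕ} {c : ℝ}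
    (hx : Tendsto x atTop (𝓝 0)) (hwx : Tendsto (fun M => (w M : ℝ) * x M) atTop (𝓝 c)) :
    Tendsto (fun M => (1 - x M) ^ w M) atTop (𝓝 (Real.exp (-c))) := by
  have h1 : Tendsto (fun M => Real.exp (-((w M : ℝ) * x M / (1 - x M)))) atTop
      (𝓝 (Real.exp (-c))) := by
    have h2 : Tendsto (fun M => (w M : ℝ) * x M / (1 - x M)) atTop (𝓝 (c / (1 - 0))) :=
      hwx.div (hx.const_sub 1) (by norm_num)
    rw [sub_zero, div_one] at h2
    exact (Real.continuous_exp.tendsto _).comp h2.neg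
  have h2 : Tendsto (fun M => Real.exp (-((w M : ℝ) * x M))) atTop (𝓝 (Real.exp (-c))) :=
    (Real.continuous_exp.tendsto _).comp hwx.neg
  refine tendsto_of_tendsto_of_tendsto_of_le_of_le' h1 h2 ?_ ?_
  · filter_upwards [hx.eventually (gt_mem_nhds one_pos)] with M hM
    have hp : 0 < 1 - x M := by linarith
    have h3 : Real.exp (-(x M / (1 - x M))) ≤ 1 - x M := by
      rw [← Real.le_log_iff_exp_le hp]
      have h4 := Real.one_sub_inv_le_log_of_pos hp
      have h5 : 1 - (1 - x M)⁻¹ = -(x M / (1 - x M)) := by field_simp; ring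
      linarith
    calc Real.exp (-((w M : ℝ) * x M / (1 - x M)))
        = Real.exp (-(x M / (1 - x M))) ^ w M := by
          rw [← Real.exp_nat_mul]; congr 1; ring
      _ ≤ _ := pow_le_pow_left₀ (Real.exp_pos _).le h3 _
  · filter_upwards [hx.eventually (gt_mem_nhds one_pos)] with M hM
    have hp : 0 ≤ 1 - x M := by linarith
    calc (1 - x M) ^ w M ≤ Real.exp (-(x M)) ^ w M :=
          pow_le_pow_left₀ hp (by linarith [Real.add_one_le_exp (-(x M))]) _
      _ = _ := by rw [← Real.exp_nat_mul]; congr 1; ring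

theorem tendsto_sq_mul_one_sub_cos {l : ℕ → ℝ} (hl : Tendsto l atTop atTop) (u : ℝ) :
    Tendsto (fun M => l M ^ 2 * (1 - Real.cos (u / l M))) atTop (𝓝 (u ^ 2 / 2)) := by
  have h1 : Tendsto (fun M => |u| ^ 4 * (5 / 96) * (l M ^ 2)⁻¹) atTop (𝓝 0) := by
    simpa using (tendsto_inv_atTop_zero.comp ((tendsto_pow_atTop two_ne_zero).comp hl)).const_mul
      (|u| ^ 4 * (5 / 96))
  rw [tendsto_iff_norm_sub_tendsto_zero]
  refine squeeze_zero' (Eventually.of_forall fun M => norm_nonneg _) ?_ h1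
  filter_upwards [hl.eventually_gt_atTop 0, hl.eventually_ge_atTop |u|] with M h0 hu
  have h2 : |u / l M| ≤ 1 := by
    rw [abs_div, abs_of_pos h0]; exact div_le_one_of_le₀ hu h0.le
  have h3 := Real.cos_bound h2
  have h4 : l M ^ 2 * (1 - Real.cos (u / l M)) - u ^ 2 / 2 =
      -(l M ^ 2 * (Real.cos (u / l M) - (1 - (u / l M) ^ 2 / 2))) := by
    field_simp
    ring
  rw [h4, norm_neg, norm_mul, Real.norm_of_nonneg (by positivity), Real.norm_eq_abs]
  calc l M ^ 2 * |Real.cos (u / l M) - (1 - (u / l M) ^ 2 / 2)|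
      ≤ l M ^ 2 * (|u / l M| ^ 4 * (5 / 96)) := by gcongr
    _ = _ := by
      rw [abs_div, abs_of_pos h0]
      field_simp

theorem lazySymbol_zero_left (lam ξ : ℝ) :
    lazySymbol lam 0 ξ = ((1 - lam * (1 - Real.cos ξ) : ℝ) : ℂ) := by
  unfold lazySymbol
  rw [Complex.ofReal_zero, zero_add, Complex.cosh_mul_I]
  push_cast
  ring

theorem gaussDensity_eq {y a : ℝ} (ha : 0 < a) :
    gaussDensity y a = (√(2 * Real.pi * a))⁻¹ * Real.exp (-y ^ 2 / (2 * a)) := by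
  unfold gaussDensity ProbabilityTheory.gaussianPDFReal
  have h1 : a ^ (-(1 / 2 : ℝ)) = (√a)⁻¹ := by rw [Real.rpow_neg ha.le, Real.sqrt_eq_rpow]
  rw [h1, mul_comm (2 * Real.pi) a, Real.sqrt_mul ha.le, mul_inv, ← mul_assoc]
  simp only [NNReal.coe_one, mul_one, sub_zero]
  congr 2
  rw [mul_pow, inv_pow, Real.sq_sqrt ha.le]
  field_simp

theorem integral_gaussian_mul_exp {a : ℝ} (ha : 0 < a) (y : ℝ) :
    ((2 * Real.pi : ℂ))⁻¹ * ∫ u : ℝ, (Real.exp (-(a * u ^ 2 / 2)) : ℂ) *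
      Complex.exp (-(y * u * Complex.I)) = gaussDensity y a := by
  have hpi := Real.pi_pos
  have hb : 0 < ((a / 2 : ℂ)).re := by
    have : ((a / 2 : ℂ)) = ((a / 2 : ℝ) : ℂ) := by push_cast; rfl
    rw [this, Complex.ofReal_re]; positivity
  have h1 := fourierIntegral_gaussian hb (-y : ℂ)
  have h2 : ∀ u : ℝ, (Real.exp (-(a * u ^ 2 / 2)) : ℂ) * Complex.exp (-(y * u * Complex.I)) =
      Complex.exp (Complex.I * (-y : ℂ) * u) * Complex.exp (-(a / 2 : ℂ) * u ^ 2) := by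
    intro u
    rw [mul_comm]
    push_cast
    congr 2 <;> ring
  simp_rw [h2]
  rw [h1, gaussDensity_eq ha]
  have h3 : ((Real.pi : ℂ) / (a / 2 : ℂ)) ^ (1 / 2 : ℂ) = ((√(Real.pi / (a / 2)) : ℝ) : ℂ) := by
    rw [Real.sqrt_eq_rpow, Complex.ofReal_cpow (by positivity)]
    push_cast
    rfl
  have h4 : Complex.exp (-(-y : ℂ) ^ 2 / (4 * (a / 2 : ℂ))) =
      ((Real.exp (-y ^ 2 / (2 * a)) : ℝ) : ℂ) := by
    push_cast
    congr 1
    have : (a : ℂ) ≠ 0 := by exact_mod_cast ha.ne'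
    field_simp
    norm_num
  rw [h3, h4, ← mul_assoc]
  have h5 : (2 * Real.pi)⁻¹ * √(Real.pi / (a / 2)) = (√(2 * Real.pi * a))⁻¹ := by
    have e : Real.pi / (a / 2) = (2 * Real.pi) ^ 2 * (2 * Real.pi * a)⁻¹ := by field_simp
    rw [e, Real.sqrt_mul (by positivity), Real.sqrt_sq (by positivity), Real.sqrt_inv]
    field_simp
  rw [← h5]
  push_cast
  ring

/-- The symbol near frequency `π`, where `c` is the cosine of the distance to `π`. If it is positive
it is at most `1 - λ`; if negative its modulus is at most `1 - 2 (1 - λ)`, so near-periodicity of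
the walk as `λ → 1` is overcome only by `(1 - λ) w → ∞`. -/
theorem abs_le_exp_add_exp {lam c : ℝ} (h : lam ∈ Set.Ico (0 : ℝ) 1) (hc0 : 0 ≤ c) (hc1 : c ≤ 1)
    (w : ℕ) : |1 - lam * (1 + c)| ^ w ≤ Real.exp (-(2 * (1 - lam) * w)) + Real.exp (-(lam * w)) := by
  have h0 := h.1
  have h1 := h.2
  rcases le_total 0 (1 - lam * (1 + c)) with hp | hp
  · rw [abs_of_nonneg hp]
    calc (1 - lam * (1 + c)) ^ w ≤ Real.exp (-lam) ^ w :=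
          pow_le_pow_left₀ hp (by nlinarith [Real.add_one_le_exp (-lam)]) w
      _ = Real.exp (-(lam * w)) := by rw [← Real.exp_nat_mul]; congr 1; ring
      _ ≤ _ := le_add_of_nonneg_left (Real.exp_pos _).le
  · rw [abs_of_nonpos hp]
    calc (-(1 - lam * (1 + c))) ^ w ≤ Real.exp (-(2 * (1 - lam))) ^ w :=
          pow_le_pow_left₀ (by linarith)
            (by nlinarith [Real.add_one_le_exp (-(2 * (1 - lam)))]) w
      _ = Real.exp (-(2 * (1 - lam) * w)) := by rw [← Real.exp_nat_mul]; congr 1; ring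
      _ ≤ _ := le_add_of_nonneg_right (Real.exp_pos _).le

variable {lam L : ℕ → ℝ}

/-- The scaling assumptions under which the lazy walk run for times of order `L` has a Gaussian
local limit. -/
structure DiffusiveScale (lam L : ℕ → ℝ) : Prop where
  mem : ∀ M, lam M ∈ Set.Ico (0 : ℝ) 1
  tendsto_time : Tendsto L atTop atTop
  tendsto_length : Tendsto (fun M => √(lam M * L M)) atTop atTop
  tendsto_hold : Tendsto (fun M => L M * (1 - lam M)) atTop atTop

/-- In the folded Fourier integral put `ξ = u / ℓ`. The branch at frequency `0` tends to the
Gaussian transform because `w λ (1 - cos (u / ℓ)) → a u² / 2`, and the branch at `π` tends to `0`.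
The lower bound on `sin²` gives a Gaussian majorant for both. -/
theorem tendsto_lazyWalk (hs : DiffusiveScale lam L) {w : ℕ → ℕ} {k : ℕ → ℤ} {a y : ℝ}
    (ha : 0 < a) (hw : Tendsto (fun M => (w M : ℝ) / L M) atTop (𝓝 a))
    (hk : Tendsto (fun M => (k M : ℝ) / √(lam M * L M)) atTop (𝓝 y)) :
    Tendsto (fun M => √(lam M * L M) * lazyWalk (lam M) (w M) (k M)) atTop
      (𝓝 (gaussDensity y a)) := by
  have hpi := Real.pi_pos
  set l : ℕ → ℝ := fun M => √(lam M * L M) with hl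
  have hl0 : ∀ᶠ M in atTop, 0 < l M := hs.tendsto_length.eventually_gt_atTop 0
  have hL0 : ∀ᶠ M in atTop, 0 < L M := hs.tendsto_time.eventually_gt_atTop 0
  have hlsq : ∀ᶠ M in atTop, l M ^ 2 = lam M * L M := by
    filter_upwards [hL0] with M hM
    exact Real.sq_sqrt (mul_nonneg (hs.mem M).1 hM.le)
  have hlw : ∀ᶠ M in atTop, lam M * w M = l M ^ 2 * ((w M : ℝ) / L M) := by
    filter_upwards [hL0, hlsq] with M hM h
    rw [h]; field_simp
  -- the folded integrand
  let f : ℕ → ℝ → ℂ := fun M ξ =>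
    ((1 - lam M * (1 - Real.cos ξ) : ℝ) : ℂ) ^ w M * Complex.exp (-(k M * ξ * Complex.I))
  let F : ℕ → ℝ → ℂ := fun M u =>
    (Set.Ioc (-(l M * (Real.pi / 2))) (l M * (Real.pi / 2))).indicator
      (fun u => f M (u / l M) + f M (u / l M + Real.pi)) u
  have hf : ∀ M, Continuous (f M) := fun M => by
    have := Real.continuous_cos
    fun_prop
  have hfnorm : ∀ M ξ, ‖f M ξ‖ = |1 - lam M * (1 - Real.cos ξ)| ^ w M := by
    intro M ξ
    have : ‖Complex.exp (-(k M * ξ * Complex.I))‖ = 1 := by rw [Complex.norm_exp]; simp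
    rw [norm_mul, norm_pow, this, mul_one, Complex.norm_real, Real.norm_eq_abs]
  have hper : ∀ M, Function.Periodic (f M) (2 * Real.pi) := by
    intro M ξ
    simp only [f, Real.cos_add_two_pi]
    congr 1
    refine Complex.exp_eq_exp_iff_exists_int.2 ⟨-k M, ?_⟩
    push_cast
    ring
  have hrep : ∀ᶠ M in atTop, (((l M * lazyWalk (lam M) (w M) (k M) : ℝ)) : ℂ) =
      (2 * Real.pi : ℂ)⁻¹ * ∫ u, F M u := by
    filter_upwards [hl0] with M hM
    have h1 := lazyWalk_mul_exp (lam M) 0 (w M) (k M)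
    simp only [Complex.ofReal_zero, zero_mul, Complex.exp_zero, mul_one, lazySymbol_zero_left] at h1
    rw [Complex.ofReal_mul, h1]
    change _ * (_ * ∫ ξ in (-Real.pi)..Real.pi, f M ξ) = _
    rw [integral_fold (hf M) (hper M), mul_left_comm]
    congr 1
    have h2 : (l M : ℂ) * ∫ ξ in (-(Real.pi / 2))..(Real.pi / 2), (f M ξ + f M (ξ + Real.pi)) =
        ∫ u in (-(l M * (Real.pi / 2)))..(l M * (Real.pi / 2)),
          (f M (u / l M) + f M (u / l M + Real.pi)) := by
      rw [intervalIntegral.integral_comp_div (fun ξ => f M ξ + f M (ξ + Real.pi)) hM.ne',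
        Complex.real_smul]
      congr 2
      · field_simp
      · field_simp
    rw [h2, intervalIntegral.integral_of_le (by nlinarith [mul_pos hM hpi]),
      ← integral_indicator measurableSet_Ioc]
  have hbound : ∀ᶠ M in atTop, ∀ᵐ u : ℝ, ‖F M u‖ ≤
      2 * Real.exp (-(a / Real.pi ^ 2) * u ^ 2) := by
    -- The constant `a / π²` below is `(4 / π²) (a / 2) / 2`: eventually `w / L ≥ a / 2`, `sin² ξ ≥
    -- 4 ξ² / π²`, and the symbol bound has a factor `1 / 2`.
    filter_upwards [hl0, hlw, hw.eventually (lt_mem_nhds (half_lt_self ha))] with M hM hlwM hwM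
    refine Eventually.of_forall fun u => ?_
    simp only [F, Set.indicator_apply]
    split_ifs with hu
    swap
    · rw [norm_zero]; positivity
    have hmem : u / l M ∈ Set.Icc (-(Real.pi / 2)) (Real.pi / 2) := by
      constructor
      · rw [le_div_iff₀ hM]; nlinarith [hu.1]
      · rw [div_le_iff₀ hM]; nlinarith [hu.2]
    have hone : ∀ ξ : ℝ, Real.sin ξ ^ 2 = Real.sin (u / l M) ^ 2 →
        ‖f M ξ‖ ≤ Real.exp (-(a / Real.pi ^ 2) * u ^ 2) := by
      intro ξ hξ
      have h1 := norm_lazySymbol_le (hs.mem M) 0 ξ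
      rw [lazySymbol_zero_left, Complex.norm_real, Real.norm_eq_abs, Real.sinh_zero, hξ] at h1
      rw [hfnorm]
      refine (pow_le_pow_left₀ (abs_nonneg _) h1 _).trans ?_
      rw [← Real.exp_nat_mul, Real.exp_le_exp]
      have h2 := sin_sq_ge hmem
      have h3 : (a / 2) * u ^ 2 ≤ (w M : ℝ) / L M * u ^ 2 :=
        mul_le_mul_of_nonneg_right hwM.le (sq_nonneg u)
      have h4 : lam M * w M * (4 / Real.pi ^ 2 * (u / l M) ^ 2) =
          4 / Real.pi ^ 2 * ((w M : ℝ) / L M * u ^ 2) := by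
        rw [hlwM, div_pow]; field_simp
      have h5 : 0 ≤ lam M * w M := mul_nonneg (hs.mem M).1 (Nat.cast_nonneg _)
      have h6 := mul_le_mul_of_nonneg_left h2 h5
      have h7 : 4 / Real.pi ^ 2 * ((a / 2) * u ^ 2) ≤
          4 / Real.pi ^ 2 * ((w M : ℝ) / L M * u ^ 2) :=
        mul_le_mul_of_nonneg_left h3 (by positivity)
      have h8 : (a / Real.pi ^ 2) * u ^ 2 = 4 / Real.pi ^ 2 * ((a / 2) * u ^ 2) / 2 := by ring
      rw [neg_mul, h8]
      linarith
    refine (norm_add_le _ _).trans ?_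
    rw [two_mul]
    exact add_le_add (hone _ rfl) (hone _ (by rw [Real.sin_add_pi, neg_sq]))
  have hptw : ∀ᵐ u : ℝ, Tendsto (fun M => F M u) atTop
      (𝓝 ((Real.exp (-(a * u ^ 2 / 2)) : ℂ) * Complex.exp (-(y * u * Complex.I)))) := by
    refine Eventually.of_forall fun u => ?_
    have hu0 : Tendsto (fun M => u / l M) atTop (𝓝 0) := hs.tendsto_length.const_div_atTop u
    have hcos : Tendsto (fun M => Real.cos (u / l M)) atTop (𝓝 1) := by
      have := (Real.continuous_cos.tendsto 0).comp hu0
      rwa [Real.cos_zero] at this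
    have h1 : Tendsto (fun M => f M (u / l M)) atTop
        (𝓝 ((Real.exp (-(a * u ^ 2 / 2)) : ℂ) * Complex.exp (-(y * u * Complex.I)))) := by
      have hx0 : ∀ M, 0 ≤ lam M * (1 - Real.cos (u / l M)) := fun M =>
        mul_nonneg (hs.mem M).1 (by linarith [Real.cos_le_one (u / l M)])
      have hx : Tendsto (fun M => lam M * (1 - Real.cos (u / l M))) atTop (𝓝 0) := by
        refine squeeze_zero hx0 (g := fun M => 1 - Real.cos (u / l M)) (fun M => ?_) ?_
        · exact mul_le_of_le_one_left (by linarith [Real.cos_le_one (u / l M)]) (hs.mem M).2.le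
        · simpa using hcos.const_sub 1
      have hwx : Tendsto (fun M => (w M : ℝ) * (lam M * (1 - Real.cos (u / l M)))) atTop
          (𝓝 (a * (u ^ 2 / 2))) := by
        refine (hw.mul (tendsto_sq_mul_one_sub_cos hs.tendsto_length u)).congr' ?_
        filter_upwards [hlw] with M hM
        linear_combination -(1 - Real.cos (u / l M)) * hM
      have h2 := tendsto_one_sub_pow hx hwx
      have h3 : Tendsto (fun M => (((1 - lam M * (1 - Real.cos (u / l M))) ^ w M : ℝ) : ℂ)) atTop
          (𝓝 ((Real.exp (-(a * (u ^ 2 / 2))) : ℝ) : ℂ)) :=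
        (Complex.continuous_ofReal.tendsto _).comp h2
      have h4 : Tendsto (fun M => Complex.exp (-((k M : ℂ) * (u / l M : ℝ) * Complex.I))) atTop
          (𝓝 (Complex.exp (-(y * u * Complex.I)))) := by
        have h5 : Tendsto (fun M => (((k M : ℝ) / l M : ℝ) : ℂ)) atTop (𝓝 (y : ℂ)) :=
          (Complex.continuous_ofReal.tendsto _).comp hk
        have hc : Continuous fun z : ℂ => Complex.exp (-(z * u * Complex.I)) := by fun_prop
        refine ((hc.tendsto _).comp h5).congr fun M => ?_
        simp only [Function.comp]
        congr 1
        push_cast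
        ring
      have h6 := h3.mul h4
      rw [← mul_div_assoc] at h6
      refine h6.congr fun M => ?_
      simp only [f]
      push_cast
      rfl
    -- Decay at frequency `π` needs both `λ w → ∞` and `(1 - λ) w → ∞`.
    have h2 : Tendsto (fun M => f M (u / l M + Real.pi)) atTop (𝓝 0) := by
      have hA : Tendsto (fun M => 2 * (1 - lam M) * w M) atTop atTop := by
        have h3 := (hs.tendsto_hold.atTop_mul_pos ha hw).const_mul_atTop two_pos
        refine h3.congr' ?_
        filter_upwards [hL0] with M hM
        field_simp
      have hB : Tendsto (fun M => lam M * w M) atTop atTop := by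
        have h3 := ((tendsto_pow_atTop two_ne_zero).comp hs.tendsto_length).atTop_mul_pos ha hw
        refine h3.congr' ?_
        filter_upwards [hlw] with M hM
        rw [hM]
        rfl
      have h3 : Tendsto (fun M => Real.exp (-(2 * (1 - lam M) * w M)) +
          Real.exp (-(lam M * w M))) atTop (𝓝 0) := by
        simpa using (Real.tendsto_exp_neg_atTop_nhds_zero.comp hA).add
          (Real.tendsto_exp_neg_atTop_nhds_zero.comp hB)
      rw [tendsto_zero_iff_norm_tendsto_zero]
      refine squeeze_zero' (Eventually.of_forall fun M => norm_nonneg _) ?_ h3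
      filter_upwards [hcos.eventually (lt_mem_nhds one_pos)] with M hM
      rw [hfnorm, Real.cos_add_pi, sub_neg_eq_add]
      exact abs_le_exp_add_exp (hs.mem M) hM.le (Real.cos_le_one _) _
    have h3 := h1.add h2
    rw [add_zero] at h3
    refine h3.congr' ?_
    have h4 : Tendsto (fun M => l M * (Real.pi / 2)) atTop atTop :=
      hs.tendsto_length.atTop_mul_const (by positivity)
    filter_upwards [h4.eventually_gt_atTop |u|] with M hM
    simp only [F]
    rw [Set.indicator_of_mem]
    have := abs_lt.1 hM
    exact ⟨this.1, this.2.le⟩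
  have hint : Integrable fun u : ℝ => 2 * Real.exp (-(a / Real.pi ^ 2) * u ^ 2) :=
    (integrable_exp_neg_mul_sq (by positivity)).const_mul 2
  have hmeas : ∀ M, AEStronglyMeasurable (F M) volume := fun M => by
    have hc : Continuous fun u => f M (u / l M) + f M (u / l M + Real.pi) := by
      have := hf M
      fun_prop
    exact hc.aestronglyMeasurable.indicator measurableSet_Ioc
  have hmain := tendsto_integral_filter_of_dominated_convergence _
    (Eventually.of_forall hmeas) hbound hint hptw
  have h1 := hmain.const_mul ((2 * Real.pi : ℂ))⁻¹
  rw [integral_gaussian_mul_exp ha] at h1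
  have h2 : Tendsto (fun M => ((l M * lazyWalk (lam M) (w M) (k M) : ℝ) : ℂ)) atTop
      (𝓝 ((gaussDensity y a : ℝ) : ℂ)) :=
    h1.congr' (hrep.mono fun M hM => hM.symm)
  have h3 := (Complex.continuous_re.tendsto _).comp h2
  rw [Complex.ofReal_re] at h3
  exact h3

end LocalLimit

/-! ### The walk on a cycle -/

/-- The `w`-step transition probabilities of the lazy walk on `ℤ / D`, lifted to `ℤ`. -/
def torusWalk (lam : ℝ) (D w : ℕ) (z : ℤ) : ℝ := ∑' m : ℤ, lazyWalk lam w (z + m * D)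

section TorusWalk

variable {lam : ℝ} {D : ℕ}

theorem hasFiniteSupport_lazyWalk (hD : D ≠ 0) (w : ℕ) (z : ℤ) :
    (Function.support fun m : ℤ => lazyWalk lam w (z + m * D)).Finite := by
  refine (Set.finite_Icc (-(w + |z|) : ℤ) (w + |z|)).subset fun m hm => ?_
  by_contra hcon
  refine hm (lazyWalk_eq_zero ?_)
  have h1 : (w : ℤ) + |z| < |m| := by
    rw [Set.mem_Icc, ← abs_le] at hcon
    exact not_le.1 hcon
  have h2 : |m| ≤ |m * D| := by
    rw [abs_mul]
    have : (1 : ℤ) ≤ |(D : ℤ)| := by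
      rw [Nat.abs_cast]; exact_mod_cast Nat.one_le_iff_ne_zero.2 hD
    exact le_mul_of_one_le_right (abs_nonneg m) this
  have h3 := abs_sub_abs_le_abs_sub (m * D : ℤ) (-z)
  rw [abs_neg, sub_neg_eq_add, add_comm _ z] at h3
  linarith

theorem summable_lazyWalk (hD : D ≠ 0) (w : ℕ) (z : ℤ) :
    Summable fun m : ℤ => lazyWalk lam w (z + m * D) :=
  summable_of_hasFiniteSupport (hasFiniteSupport_lazyWalk hD w z)

theorem torusWalk_zero (hD : D ≠ 0) (z : ℤ) :
    torusWalk lam D 0 z = if (z : ZMod D) = 0 then 1 else 0 := by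
  unfold torusWalk
  simp only [lazyWalk]
  split_ifs with h
  · obtain ⟨j, rfl⟩ := (ZMod.intCast_zmod_eq_zero_iff_dvd z D).1 h
    rw [tsum_eq_single (-j)]
    · rw [if_pos (by ring)]
    · intro m hm
      rw [if_neg]
      intro h0
      have hD' : (D : ℤ) ≠ 0 := by exact_mod_cast hD
      refine hm ?_
      have : (D : ℤ) * (j + m) = 0 := by linear_combination h0
      rcases mul_eq_zero.1 this with h1 | h1
      · exact absurd h1 hD'
      · linarith
  · refine (tsum_congr fun m => ?_).trans tsum_zero
    rw [if_neg]
    intro h0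
    refine h ?_
    rw [ZMod.intCast_zmod_eq_zero_iff_dvd]
    exact ⟨-m, by linear_combination h0⟩

theorem torusWalk_succ (hD : D ≠ 0) (w : ℕ) (z : ℤ) :
    torusWalk lam D (w + 1) z = (1 - lam) * torusWalk lam D w z +
      lam / 2 * (torusWalk lam D w (z - 1) + torusWalk lam D w (z + 1)) := by
  unfold torusWalk
  rw [← tsum_mul_left, ← (summable_lazyWalk hD w (z - 1)).tsum_add (summable_lazyWalk hD w (z + 1)),
    ← tsum_mul_left, ← ((summable_lazyWalk hD w z).mul_left _).tsum_add
      (((summable_lazyWalk hD w (z - 1)).add (summable_lazyWalk hD w (z + 1))).mul_left _)]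
  refine tsum_congr fun m => ?_
  rw [lazyWalk]
  congr 3
  · congr 1; ring
  · congr 1; ring

/-- Periodisation of the walk on the integers. Any representative `z` of the difference is allowed:
a difference of floors serves for limits, the representative of least absolute value for bounds. For
`D = 2` both steps `± 1` are counted on either side. -/
theorem blockWalk_one_pow_apply [NeZero D] (w : ℕ) {x y : Fin 1 → ZMod D} {z : ℤ}
    (hz : (z : ZMod D) = x 0 - y 0) : (blockWalk 1 D lam ^ w) x y = torusWalk lam D w z := by
  have hD : D ≠ 0 := NeZero.ne D
  have hone : ∀ u v : Fin 1 → ZMod D, u = v ↔ u 0 = v 0 := fun u v => by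
    rw [funext_iff, Fin.forall_fin_one]
  induction w generalizing y z with
  | zero =>
    rw [pow_zero, Matrix.one_apply, torusWalk_zero hD]
    simp only [hone x y, hz, sub_eq_zero]
  | succ w ih =>
    have hstep : ∀ u : Fin 1 → ZMod D, blockWalk 1 D lam u y =
        (if u = y then 1 - lam else 0) + ((if u = y - 1 then lam / 2 else 0) +
          (if u = y + 1 then lam / 2 else 0)) := by
      intro u
      have h1 : (neighborCount u y : ℝ) = (if u = y - 1 then 1 else 0) +
          (if u = y + 1 then 1 else 0) := by
        unfold neighborCount
        rw [Finset.card_filter, Fintype.sum_prod_type]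
        simp only [Fintype.sum_bool, Finset.univ_unique, Finset.sum_singleton,
          Bool.false_eq_true, ↓reduceIte]
        have e1 : (y = u + Pi.single default (1 : ZMod D)) ↔
            u = y - 1 := by
          rw [hone, hone]
          simp only [Pi.add_apply, Pi.sub_apply, Pi.one_apply, Fin.default_eq_zero,
            Pi.single_eq_same, eq_sub_iff_add_eq]
          exact eq_comm
        have e2 : (y = u + Pi.single default (-1 : ZMod D)) ↔
            u = y + 1 := by
          rw [hone, hone]
          simp only [Pi.add_apply, Pi.one_apply, Fin.default_eq_zero, Pi.single_eq_same, ← sub_eq_add_neg]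
          rw [eq_sub_iff_add_eq]
          exact eq_comm
        rw [if_congr e1 rfl rfl, if_congr e2 rfl rfl]
        push_cast
        rfl
      simp only [blockWalk, Matrix.of_apply, h1, Nat.cast_one, mul_one]
      split_ifs <;> ring
    rw [pow_succ, Matrix.mul_apply, torusWalk_succ hD]
    simp_rw [hstep, mul_add, mul_ite, mul_zero]
    rw [Finset.sum_add_distrib, Finset.sum_add_distrib]
    simp only [Finset.sum_ite_eq', Finset.mem_univ, if_true]
    rw [ih hz, ih (y := y - 1) (z := z + 1) (by
      simp only [Int.cast_add, hz, Int.cast_one, Pi.sub_apply, Pi.one_apply]; ring),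
      ih (y := y + 1) (z := z - 1) (by
      simp only [Int.cast_sub, hz, Int.cast_one, Pi.add_apply, Pi.one_apply]; ring)]
    ring

/-- Natural subtraction makes the exponent vanish at `m = 0` as well as at `m = ± 1`; the sum is `1
+ 2 / (1 - r)` with `r = exp (-δ)`. -/
theorem tsum_exp_le {δ : ℝ} (hδ : 0 < δ) :
    Summable (fun m : ℤ => Real.exp (-(((m.natAbs - 1 : ℕ) : ℝ) * δ))) ∧
      ∑' m : ℤ, Real.exp (-(((m.natAbs - 1 : ℕ) : ℝ) * δ)) ≤ 3 + 2 / δ := by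
  set r := Real.exp (-δ) with hr
  have hr0 : 0 ≤ r := (Real.exp_pos _).le
  have hr1 : r < 1 := by rw [hr, Real.exp_lt_one_iff]; linarith
  have hpow : ∀ n : ℕ, Real.exp (-((n : ℝ) * δ)) = r ^ n := fun n => by
    rw [hr, ← Real.exp_nat_mul]; congr 1; ring
  simp_rw [hpow]
  have hg := hasSum_geometric_of_lt_one hr0 hr1
  have h1 : HasSum (fun n : ℕ => r ^ ((n : ℤ).natAbs - 1)) (1 + (1 - r)⁻¹) := by
    simp only [Int.natAbs_natCast]
    rw [← hasSum_nat_add_iff' 1]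
    simpa using hg
  have h2 : HasSum (fun n : ℕ => r ^ ((-((n : ℤ) + 1)).natAbs - 1)) (1 - r)⁻¹ := by
    convert hg using 3
    omega
  have h3 := HasSum.of_nat_of_neg_add_one (f := fun m : ℤ => r ^ (m.natAbs - 1)) h1 h2
  refine ⟨h3.summable, ?_⟩
  rw [h3.tsum_eq]
  have h4 : (1 - r)⁻¹ ≤ 1 + 1 / δ := by
    have h5 : r * (1 + δ) ≤ 1 := by
      have := Real.add_one_le_exp δ
      calc r * (1 + δ) ≤ r * Real.exp δ := by gcongr; linarith
        _ = 1 := by rw [hr, ← Real.exp_add]; simp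
    rw [inv_le_iff_one_le_mul₀ (by linarith)]
    have h6 : (1 + 1 / δ) * (1 - r) = 1 + (1 - r * (1 + δ)) / δ := by field_simp; ring
    rw [h6]
    have : 0 ≤ (1 - r * (1 + δ)) / δ := div_nonneg (by linarith) hδ.le
    linarith
  have : 2 / δ = 2 * (1 / δ) := by ring
  linarith

/-- As `|z| ≤ D / 2`, the images satisfy `|z + m D| ≥ |z| + (|m| - 1) D` for `m ≠ 0`. Thus the decay
in `|z|` survives the sum over images, which costs only the factor `3 + 2 ℓ / D`. -/
theorem torusWalk_le (h : lam ∈ Set.Ico (0 : ℝ) 1) (hD : D ≠ 0) {L T : ℝ} (hL : 0 < L)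
    (hell : 1 ≤ √(lam * L)) {w : ℕ} (hw : 1 ≤ w) (hwT : (w : ℝ) ≤ T * L) {z : ℤ}
    (hz : |z| * 2 ≤ D) :
    √(lam * L) * torusWalk lam D w z ≤
      2 * Real.exp (2 * T) * (√((w : ℝ) / L))⁻¹ * Real.exp (-(|(z : ℝ)| / √(lam * L))) *
        (3 + 2 * (√(lam * L) / D)) := by
  set l := √(lam * L) with hl
  have hl0 : 0 < l := by linarith
  have hD0 : (0 : ℝ) < D := by exact_mod_cast Nat.pos_of_ne_zero hD
  have hδ : 0 < (D : ℝ) / l := by positivity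
  obtain ⟨hs, hle⟩ := tsum_exp_le hδ
  have hzr : |(z : ℝ)| * 2 ≤ D := by exact_mod_cast hz
  have hterm : ∀ m : ℤ, l * lazyWalk lam w (z + m * D) ≤
      2 * Real.exp (2 * T) * (√((w : ℝ) / L))⁻¹ * Real.exp (-(|(z : ℝ)| / l)) *
        Real.exp (-(((m.natAbs - 1 : ℕ) : ℝ) * (D / l))) := by
    intro m
    refine (lazyWalk_le h hL hell hw hwT (z + m * D)).trans ?_
    rw [mul_assoc _ (Real.exp (-(|(z : ℝ)| / l))), ← Real.exp_add]
    refine mul_le_mul_of_nonneg_left (Real.exp_le_exp.2 ?_) (by positivity)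
    have h1 : |(z : ℝ)| + ((m.natAbs - 1 : ℕ) : ℝ) * D ≤ |((z + m * D : ℤ) : ℝ)| := by
      rcases eq_or_ne m 0 with rfl | hm
      · simp
      · have h2 : 1 ≤ m.natAbs := Int.natAbs_pos.2 hm
        rw [Nat.cast_sub h2, Nat.cast_natAbs]
        push_cast
        have h3 := abs_sub_abs_le_abs_sub ((m : ℝ) * D) (-z)
        rw [abs_neg, sub_neg_eq_add, add_comm _ (z : ℝ), abs_mul, abs_of_pos hD0] at h3
        linarith
    have h2 : (|(z : ℝ)| + ((m.natAbs - 1 : ℕ) : ℝ) * D) / l ≤ |((z + m * D : ℤ) : ℝ)| / l := by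
      gcongr
    rw [add_div, mul_div_assoc] at h2
    linarith
  unfold torusWalk
  rw [← tsum_mul_left]
  calc ∑' m : ℤ, l * lazyWalk lam w (z + m * D)
      ≤ ∑' m : ℤ, 2 * Real.exp (2 * T) * (√((w : ℝ) / L))⁻¹ * Real.exp (-(|(z : ℝ)| / l)) *
        Real.exp (-(((m.natAbs - 1 : ℕ) : ℝ) * (D / l))) :=
        ((summable_lazyWalk hD w z).mul_left l).tsum_le_tsum hterm (hs.mul_left _)
    _ ≤ _ := by
      rw [tsum_mul_left]
      refine mul_le_mul_of_nonneg_left (hle.trans_eq ?_) (by positivity)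
      field_simp

end TorusWalk

/-! ### Limits of the kernel on the cycle -/

section TorusLimit

variable {lam L : ℕ → ℝ}

theorem lazyWalk_eventually_le (hs : DiffusiveScale lam L) {w : ℕ → ℕ} {a : ℝ}
    (ha : 0 < a) (hw1 : ∀ M, 1 ≤ w M) (hw : Tendsto (fun M => (w M : ℝ) / L M) atTop (𝓝 a)) :
    ∃ C : ℝ, 0 ≤ C ∧ ∀ᶠ M in atTop, ∀ k : ℤ, √(lam M * L M) * lazyWalk (lam M) (w M) k ≤
      C * Real.exp (-(|(k : ℝ)| / √(lam M * L M))) := by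
  refine ⟨2 * Real.exp (2 * (a + 1)) * (√(a / 2))⁻¹, by positivity, ?_⟩
  filter_upwards [hs.tendsto_time.eventually_gt_atTop 0, hs.tendsto_length.eventually_ge_atTop 1,
    hw.eventually (lt_mem_nhds (half_lt_self ha)), hw.eventually (gt_mem_nhds (lt_add_one a))]
    with M hL hl h1 h2 k
  refine (lazyWalk_le (hs.mem M) hL hl (hw1 M) ((div_le_iff₀ hL).1 h2.le) k).trans ?_
  have : 0 < √(a / 2) := Real.sqrt_pos.2 (by positivity)
  gcongr

theorem summable_exp_neg_abs_int {c : ℝ} (hc : 0 < c) :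
    Summable fun m : ℤ => Real.exp (-(c * |(m : ℝ)|)) := by
  refine Summable.of_nonneg_of_le (fun m => (Real.exp_pos _).le) (fun m => ?_)
    (tsum_exp_le hc).1
  rw [Real.exp_le_exp, neg_le_neg_iff, mul_comm]
  gcongr
  rw [← Int.cast_abs, Int.abs_eq_natAbs, Int.cast_natCast]
  exact Nat.cast_le.2 (Nat.sub_le _ _)

/-- Dominated convergence in the sum over images: `D / ℓ ≥ c` keeps the images apart, so their
contributions decay geometrically, uniformly in `M`. -/
theorem tendsto_torusWalk (hs : DiffusiveScale lam L) {D w : ℕ → ℕ}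
    {z : ℕ → ℤ} {a y c : ℝ} (ha : 0 < a) (hc : 0 < c) (hw1 : ∀ M, 1 ≤ w M)
    (hw : Tendsto (fun M => (w M : ℝ) / L M) atTop (𝓝 a))
    (hz : Tendsto (fun M => (z M : ℝ) / √(lam M * L M)) atTop (𝓝 y))
    (hDc : ∀ᶠ M in atTop, c ≤ (D M : ℝ) / √(lam M * L M)) {G : ℤ → ℝ}
    (hG : ∀ m : ℤ, Tendsto (fun M => √(lam M * L M) *
      lazyWalk (lam M) (w M) (z M + m * D M)) atTop (𝓝 (G m))) :
    Tendsto (fun M => √(lam M * L M) * torusWalk (lam M) (D M) (w M) (z M)) atTop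
      (𝓝 (∑' m, G m)) := by
  obtain ⟨C, hC0, hC⟩ := lazyWalk_eventually_le hs ha hw1 hw
  unfold torusWalk
  simp_rw [← tsum_mul_left]
  refine tendsto_tsum_of_dominated_convergence
    (bound := fun m : ℤ => C * Real.exp (|y| + 1) * Real.exp (-(c * |(m : ℝ)|)))
    ((summable_exp_neg_abs_int hc).mul_left _) hG ?_
  filter_upwards [hC, hDc, hs.tendsto_length.eventually_gt_atTop 0,
    hz.abs.eventually (gt_mem_nhds (lt_add_one |y|))] with M h1 h2 hl h3 m
  have hn : 0 ≤ √(lam M * L M) * lazyWalk (lam M) (w M) (z M + m * D M) :=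
    mul_nonneg hl.le (lazyWalk_nonneg (hs.mem M) _ _)
  rw [Real.norm_of_nonneg hn]
  refine (h1 _).trans ?_
  rw [mul_assoc, ← Real.exp_add]
  refine mul_le_mul_of_nonneg_left (Real.exp_le_exp.2 ?_) hC0
  have h4 : |(m : ℝ) * D M| / √(lam M * L M) - |(z M : ℝ)| / √(lam M * L M) ≤
      |((z M + m * D M : ℤ) : ℝ)| / √(lam M * L M) := by
    rw [← sub_div]
    gcongr
    have := abs_sub_abs_le_abs_sub ((m : ℝ) * D M) (-(z M))
    rw [abs_neg, sub_neg_eq_add, add_comm _ (z M : ℝ)] at this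
    push_cast
    exact this
  rw [abs_div, abs_of_pos hl] at h3
  have h5 : c * |(m : ℝ)| ≤ |(m : ℝ) * D M| / √(lam M * L M) := by
    rw [abs_mul, Nat.abs_cast, mul_div_assoc, mul_comm]
    gcongr
  linarith

theorem tendsto_torusWalk_critical (hs : DiffusiveScale lam L) {D w : ℕ → ℕ}
    {z : ℕ → ℤ} {a y c : ℝ} (ha : 0 < a) (hc : 0 < c) (hw1 : ∀ M, 1 ≤ w M)
    (hw : Tendsto (fun M => (w M : ℝ) / L M) atTop (𝓝 a))
    (hz : Tendsto (fun M => (z M : ℝ) / √(lam M * L M)) atTop (𝓝 y))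
    (hDc : Tendsto (fun M => (D M : ℝ) / √(lam M * L M)) atTop (𝓝 c)) :
    Tendsto (fun M => √(lam M * L M) * torusWalk (lam M) (D M) (w M) (z M)) atTop
      (𝓝 (∑' m : ℤ, gaussDensity (y + m * c) a)) := by
  refine tendsto_torusWalk hs ha (half_pos hc) hw1 hw hz
    ((hDc.eventually (lt_mem_nhds (half_lt_self hc))).mono fun M h => h.le) fun m => ?_
  refine tendsto_lazyWalk hs ha hw ((hz.add (hDc.const_mul (m : ℝ))).congr fun M => ?_)
  push_cast
  ring

/-- All images except `m = 0` escape to infinity on the scale `ℓ`. -/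
theorem tendsto_torusWalk_subcritical (hs : DiffusiveScale lam L) {D w : ℕ → ℕ}
    {z : ℕ → ℤ} {a y : ℝ} (ha : 0 < a) (hw1 : ∀ M, 1 ≤ w M)
    (hw : Tendsto (fun M => (w M : ℝ) / L M) atTop (𝓝 a))
    (hz : Tendsto (fun M => (z M : ℝ) / √(lam M * L M)) atTop (𝓝 y))
    (hDc : Tendsto (fun M => (D M : ℝ) / √(lam M * L M)) atTop atTop) :
    Tendsto (fun M => √(lam M * L M) * torusWalk (lam M) (D M) (w M) (z M)) atTop
      (𝓝 (gaussDensity y a)) := by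
  have h := tendsto_torusWalk hs (G := fun m => if m = 0 then gaussDensity y a else 0)
    ha one_pos hw1 hw hz (hDc.eventually_ge_atTop 1) fun m => ?_
  · simpa using h
  split_ifs with hm
  · subst hm
    simpa using tendsto_lazyWalk hs ha hw hz
  · obtain ⟨C, hC0, hC⟩ := lazyWalk_eventually_le hs ha hw1 hw
    have h1 : Tendsto (fun M => |((z M + m * D M : ℤ) : ℝ)| / √(lam M * L M)) atTop atTop := by
      have h2 : Tendsto (fun M => |(m : ℝ)| * ((D M : ℝ) / √(lam M * L M)) +
          -|(z M : ℝ) / √(lam M * L M)|) atTop atTop :=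
        (hDc.const_mul_atTop (abs_pos.2 (Int.cast_ne_zero.2 hm))).atTop_add hz.abs.neg
      refine tendsto_atTop_mono' _ ?_ h2
      filter_upwards [hs.tendsto_length.eventually_gt_atTop 0] with M hl
      have := abs_sub_abs_le_abs_sub ((m : ℝ) * D M) (-(z M))
      rw [abs_neg, sub_neg_eq_add, add_comm _ (z M : ℝ), abs_mul, Nat.abs_cast] at this
      rw [abs_div, abs_of_pos hl, ← sub_eq_add_neg, ← mul_div_assoc, ← sub_div]
      push_cast
      gcongr
    have h3 : Tendsto (fun M => C * Real.exp (-(|((z M + m * D M : ℤ) : ℝ)| / √(lam M * L M))))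
        atTop (𝓝 0) := by
      simpa using (Real.tendsto_exp_neg_atTop_nhds_zero.comp h1).const_mul C
    refine squeeze_zero' (Eventually.of_forall fun M => ?_) (hC.mono fun M h => h _) h3
    exact mul_nonneg (Real.sqrt_nonneg _) (lazyWalk_nonneg (hs.mem M) _ _)

theorem integrable_exp_neg_mul_abs {c : ℝ} (hc : 0 < c) :
    Integrable fun x : ℝ => Real.exp (-(c * |x|)) := by
  have h1 : Integrable fun x : ℝ => Real.exp (-|x|) := by
    refine (integrable_inv_one_add_sq.const_mul 2).mono' (by fun_prop)
      (Eventually.of_forall fun x => ?_)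
    rw [Real.norm_of_nonneg (Real.exp_pos _).le, Real.exp_neg, ← div_eq_mul_inv,
      le_div_iff₀ (by positivity), inv_mul_le_iff₀ (Real.exp_pos _)]
    have := Real.quadratic_le_exp_of_nonneg (abs_nonneg x)
    have h2 := sq_abs x
    nlinarith [abs_nonneg x]
  have h2 := h1.comp_mul_left' hc.ne'
  refine h2.congr (Eventually.of_forall fun x => ?_)
  simp [abs_mul, abs_of_pos hc]

theorem integral_gaussDensity {a : ℝ} (ha : 0 < a) : ∫ y, gaussDensity y a = 1 := by
  have h1 : ∀ y, gaussDensity y a = ProbabilityTheory.gaussianPDFReal 0 ⟨a, ha.le⟩ y := by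
    intro y
    rw [gaussDensity_eq ha]
    simp only [ProbabilityTheory.gaussianPDFReal, sub_zero]
    rfl
  simp_rw [h1]
  refine ProbabilityTheory.integral_gaussianPDFReal_eq_one 0 ?_
  exact fun h => ha.ne' (congrArg NNReal.toReal h)

/-- The images have spacing `D / ℓ → 0` on the scale `ℓ`, so `D` times the sum over them is a
Riemann sum for the total mass of the Gaussian density. -/
theorem tendsto_torusWalk_supercritical (hs : DiffusiveScale lam L) {D w : ℕ → ℕ}
    (hD : ∀ M, D M ≠ 0) {z : ℕ → ℤ} {a : ℝ} (ha : 0 < a) (hw1 : ∀ M, 1 ≤ w M)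
    (hw : Tendsto (fun M => (w M : ℝ) / L M) atTop (𝓝 a))
    (hz : Tendsto (fun M => (z M : ℝ) / √(lam M * L M)) atTop (𝓝 0))
    (hDc : Tendsto (fun M => √(lam M * L M) / (D M : ℝ)) atTop atTop) :
    Tendsto (fun M => (D M : ℝ) * torusWalk (lam M) (D M) (w M) (z M)) atTop (𝓝 1) := by
  obtain ⟨C, hC0, hC⟩ := lazyWalk_eventually_le hs ha hw1 hw
  let ρ : ℕ → ℝ := fun M => √(lam M * L M) / (D M : ℝ)
  let k : ℕ → (Unit → ℝ) → ℤ := fun M y => z M + floorPoint (ρ M) y () * D M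
  let F : ℕ → (Unit → ℝ) → ℝ := fun M y =>
    √(lam M * L M) * lazyWalk (lam M) (w M) (k M y)
  have hl0 : ∀ᶠ M in atTop, 0 < √(lam M * L M) := hs.tendsto_length.eventually_gt_atTop 0
  have hk : ∀ y, ∀ᶠ M in atTop, (k M y : ℝ) / √(lam M * L M) =
      (z M : ℝ) / √(lam M * L M) + (floorPoint (ρ M) y () : ℝ) / ρ M := by
    intro y
    filter_upwards [hl0] with M hl
    have : (D M : ℝ) ≠ 0 := Nat.cast_ne_zero.2 (hD M)
    simp only [k, ρ]
    push_cast
    field_simp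
  have hrep : ∀ᶠ M in atTop, (D M : ℝ) * torusWalk (lam M) (D M) (w M) (z M) = ∫ y, F M y := by
    classical
    filter_upwards [hl0] with M hl
    have hD0 : (0 : ℝ) < D M := Nat.cast_pos.2 (Nat.pos_of_ne_zero (hD M))
    have hρ : 0 < ρ M := div_pos hl hD0
    set J := (hasFiniteSupport_lazyWalk (lam := lam M) (hD M) (w M) (z M)).toFinset
    have hJ : ∀ m : ℤ, m ∉ J → lazyWalk (lam M) (w M) (z M + m * D M) = 0 := by
      intro m hm
      by_contra h0
      exact hm ((hasFiniteSupport_lazyWalk (hD M) (w M) (z M)).mem_toFinset.2 h0)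
    have h1 := sum_eq_integral_floorPoint hρ (J.image fun m (_ : Unit) => m)
      (fun m => √(lam M * L M) * lazyWalk (lam M) (w M) (z M + m () * D M))
    rw [Finset.sum_image (by intro m _ m' _ h; exact congrFun h ())] at h1
    have h2 : torusWalk (lam M) (D M) (w M) (z M) =
        ∑ m ∈ J, lazyWalk (lam M) (w M) (z M + m * D M) := tsum_eq_sum fun m hm => hJ m hm
    rw [h2]
    simp only [Fintype.card_unit, pow_one, ← Finset.mul_sum] at h1
    have h3 : (D M : ℝ) = (ρ M)⁻¹ * √(lam M * L M) := by simp only [ρ]; field_simp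
    rw [h3, mul_assoc, h1]
    refine integral_congr_ae (Eventually.of_forall fun y => ?_)
    simp only [F, k]
    split_ifs with hy
    · rfl
    · rw [hJ, mul_zero]
      intro hm
      exact hy (Finset.mem_image.2 ⟨_, hm, by ext u; rfl⟩)
  have hbound : ∀ᶠ M in atTop, ∀ᵐ y : Unit → ℝ, ‖F M y‖ ≤
      C * Real.exp 2 * ∏ i, Real.exp (-(1 * |y i|)) := by
    filter_upwards [hC, hl0, hDc.eventually_ge_atTop 1,
      hz.abs.eventually (gt_mem_nhds (show |(0 : ℝ)| < 1 by simp))] with M h1 hl hρ hz1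
    refine Eventually.of_forall fun y => ?_
    have hn : 0 ≤ F M y := mul_nonneg hl.le (lazyWalk_nonneg (hs.mem M) _ _)
    rw [Real.norm_of_nonneg hn]
    refine (h1 _).trans ?_
    simp only [Finset.univ_unique, Finset.prod_singleton, one_mul]
    rw [mul_assoc, ← Real.exp_add]
    refine mul_le_mul_of_nonneg_left (Real.exp_le_exp.2 ?_) hC0
    have hρ0 : 0 < ρ M := lt_of_lt_of_le one_pos hρ
    have hD0 : (0 : ℝ) < D M := Nat.cast_pos.2 (Nat.pos_of_ne_zero (hD M))
    have hky : |(k M y : ℝ)| / √(lam M * L M) =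
        |(z M : ℝ) / √(lam M * L M) + (floorPoint (ρ M) y () : ℝ) / ρ M| := by
      rw [← abs_of_pos hl, ← abs_div, abs_of_pos hl]
      congr 1
      simp only [k, ρ]
      push_cast
      field_simp
    have h2 : |(floorPoint (ρ M) y () : ℝ) / ρ M - y ()| ≤ 1 := by
      rw [div_sub' hρ0.ne', abs_div, abs_of_pos hρ0]
      refine div_le_one_of_le₀ ((?_ : _ ≤ (1 : ℝ)).trans hρ) hρ0.le
      have e1 := Int.floor_le (ρ M * y ())
      have e2 := Int.lt_floor_add_one (ρ M * y ())
      rw [floorPoint, abs_le]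
      constructor <;> linarith
    have h3 : |y ()| ≤ |(z M : ℝ) / √(lam M * L M) + (floorPoint (ρ M) y () : ℝ) / ρ M| +
        (|(z M : ℝ) / √(lam M * L M)| + |(floorPoint (ρ M) y () : ℝ) / ρ M - y ()|) := by
      have e : y () = ((z M : ℝ) / √(lam M * L M) + (floorPoint (ρ M) y () : ℝ) / ρ M) -
        ((z M : ℝ) / √(lam M * L M) + ((floorPoint (ρ M) y () : ℝ) / ρ M - y ())) := by ring
      calc |y ()| = _ := congrArg abs e
        _ ≤ _ := (abs_sub _ _).trans (add_le_add le_rfl (abs_add_le _ _))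
    rw [hky]
    change _ ≤ 2 + -|y ()|
    linarith
  have hint : Integrable fun y : Unit → ℝ => C * Real.exp 2 * ∏ i, Real.exp (-(1 * |y i|)) :=
    (Integrable.fintype_prod fun _ : Unit => integrable_exp_neg_mul_abs one_pos).const_mul _
  have hptw : ∀ᵐ y : Unit → ℝ, Tendsto (fun M => F M y) atTop (𝓝 (gaussDensity (y ()) a)) := by
    refine Eventually.of_forall fun y => tendsto_lazyWalk hs ha hw ?_
    have h1 := hz.add (tendsto_floorPoint_div hDc y ())
    rw [zero_add] at h1
    exact h1.congr' ((hk y).mono fun M h => h.symm)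
  have hmeas : ∀ M, AEStronglyMeasurable (F M) volume := fun M => by
    have h1 : Measurable fun m : Unit → ℤ =>
        √(lam M * L M) * lazyWalk (lam M) (w M) (z M + m () * D M) := measurable_of_countable _
    exact (h1.comp (measurable_floorPoint (ρ M))).aestronglyMeasurable
  have hmain := tendsto_integral_filter_of_dominated_convergence _
    (Eventually.of_forall hmeas) hbound hint hptw
  have h1 : ∫ y : Unit → ℝ, gaussDensity (y ()) a = 1 := by
    rw [← integral_gaussDensity ha]
    exact (volume_preserving_funUnique Unit ℝ).integral_comp' (fun y => gaussDensity y a)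
  rw [h1] at hmain
  exact hmain.congr' (hrep.mono fun M h => h.symm)

end TorusLimit

/-! ### Bessel functions and exponentials in a Banach algebra -/

section Bessel

theorem summable_besselI (ν : ℕ) (x : ℝ) :
    Summable fun k : ℕ => (x / 2) ^ (2 * k + ν) / ((k.factorial : ℝ) * ((k + ν).factorial : ℝ)) := by
  refine Summable.of_norm_bounded
    (g := fun k : ℕ => |x / 2| ^ ν * ((|x / 2| ^ 2) ^ k / (k.factorial : ℝ)))
    ((Real.summable_pow_div_factorial _).mul_left _) fun k => ?_
  rw [Real.norm_eq_abs, abs_div, abs_pow, pow_add, pow_mul, abs_mul, Nat.abs_cast, Nat.abs_cast,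
    mul_comm, ← mul_div_assoc]
  have h1 : (1 : ℝ) ≤ (k + ν).factorial := by exact_mod_cast Nat.factorial_pos _
  have h2 : (0 : ℝ) < k.factorial := by exact_mod_cast Nat.factorial_pos _
  gcongr
  exact le_mul_of_one_le_right h2.le h1

theorem besselI_nonneg (ν : ℕ) {x : ℝ} (hx : 0 ≤ x) : 0 ≤ besselI ν x :=
  tsum_nonneg fun k => by positivity

theorem besselI_zero_pos {x : ℝ} (hx : 0 ≤ x) : 0 < besselI 0 x := by
  refine (summable_besselI 0 x).tsum_pos (fun k => by positivity) 0 ?_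
  simp

end Bessel

section BanachAlgebra

variable {𝔸 : Type*} [NormedRing 𝔸] [NormedAlgebra ℝ 𝔸] [CompleteSpace 𝔸]

theorem tendsto_choose_mul_pow {lam : ℕ → ℝ} {w : ℕ → ℕ} {a : ℝ} (hlam : Tendsto lam atTop (𝓝 0))
    (hw : Tendsto (fun M => (w M : ℝ) * lam M) atTop (𝓝 a)) (hlam0 : ∀ M, 0 ≤ lam M) (k : ℕ) :
    Tendsto (fun M => ((w M).choose k : ℝ) * lam M ^ k) atTop (𝓝 ((k.factorial : ℝ)⁻¹ * a ^ k)) := by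
  have h1 : ∀ i : ℕ, Tendsto (fun M => ((w M - i : ℕ) : ℝ) * lam M) atTop (𝓝 a) := by
    intro i
    have h2 : Tendsto (fun M => (w M : ℝ) * lam M - i * lam M) atTop (𝓝 a) := by
      simpa using hw.sub (hlam.const_mul (i : ℝ))
    refine tendsto_of_tendsto_of_tendsto_of_le_of_le h2 hw (fun M => ?_) fun M => ?_
    · change (w M : ℝ) * lam M - i * lam M ≤ _
      rw [← sub_mul]
      refine mul_le_mul_of_nonneg_right ?_ (hlam0 M)
      rw [sub_le_iff_le_add]
      exact_mod_cast (by omega : w M ≤ w M - i + i)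
    · exact mul_le_mul_of_nonneg_right (Nat.cast_le.2 (Nat.sub_le _ _)) (hlam0 M)
  have h2 := (tendsto_finsetProd (Finset.range k) fun i _ => h1 i).const_mul (k.factorial : ℝ)⁻¹
  simp only [Finset.prod_const, Finset.card_range] at h2
  refine h2.congr fun M => ?_
  rw [Finset.prod_mul_distrib, Finset.prod_const, Finset.card_range, ← Nat.cast_prod,
    ← Nat.descFactorial_eq_prod_range, Nat.descFactorial_eq_factorial_mul_choose]
  push_cast
  have : (k.factorial : ℝ) ≠ 0 := by exact_mod_cast Nat.factorial_ne_zero k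
  field_simp

/-- The binomial series converges term by term to the exponential series, and `choose w k * λ ^ k ≤
(w λ) ^ k / k!` dominates it. -/
theorem tendsto_one_add_smul_pow (A : 𝔸) {lam : ℕ → ℝ} {w : ℕ → ℕ} {a : ℝ}
    (hlam : Tendsto lam atTop (𝓝 0)) (hw : Tendsto (fun M => (w M : ℝ) * lam M) atTop (𝓝 a))
    (hlam0 : ∀ M, 0 ≤ lam M) :
    Tendsto (fun M => (1 + lam M • A) ^ w M) atTop (𝓝 (NormedSpace.exp (a • A))) := by
  have h1 : ∀ M, (1 + lam M • A) ^ w M = ∑' k : ℕ, (((w M).choose k : ℝ) * lam M ^ k) • A ^ k := by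
    intro M
    rw [add_comm, (Commute.one_right (lam M • A)).add_pow, tsum_eq_sum (s := Finset.range (w M + 1))]
    · refine Finset.sum_congr rfl fun k _ => ?_
      rw [one_pow, mul_one, smul_pow, smul_mul_assoc, ← Nat.cast_comm, ← nsmul_eq_mul,
        ← Nat.cast_smul_eq_nsmul ℝ, smul_smul, mul_comm]
    · intro k hk
      rw [Nat.choose_eq_zero_of_lt (by simpa using hk)]
      simp
  have h2 : NormedSpace.exp (a • A) = ∑' k : ℕ, ((k.factorial : ℝ)⁻¹ * a ^ k) • A ^ k := by
    rw [NormedSpace.exp_eq_tsum ℝ]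
    simp only [smul_pow, smul_smul]
  simp_rw [h1, h2]
  refine tendsto_tsum_of_dominated_convergence
    -- The first summand covers `k = 0`, as the unit of the algebra may have norm other than `1`.
    (bound := fun k : ℕ => ‖(1 : 𝔸)‖ * ((|a| + 1) * ‖A‖) ^ k / (k.factorial : ℝ) +
      ((|a| + 1) * ‖A‖) ^ k / (k.factorial : ℝ)) ?_
    (fun k => (tendsto_choose_mul_pow hlam hw hlam0 k).smul_const _) ?_
  · have := Real.summable_pow_div_factorial ((|a| + 1) * ‖A‖)
    refine Summable.add ?_ this
    simpa only [mul_div_assoc] using this.mul_left ‖(1 : 𝔸)‖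
  · filter_upwards [hw.eventually (gt_mem_nhds (lt_of_le_of_lt (le_abs_self a)
      (lt_add_one |a|)))] with M hM k
    have hfac : (0 : ℝ) < k.factorial := by exact_mod_cast Nat.factorial_pos _
    have h3 : ((w M).choose k : ℝ) * lam M ^ k ≤ (|a| + 1) ^ k / (k.factorial : ℝ) := by
      have h4 := Nat.choose_le_pow_div (α := ℝ) k (w M)
      calc ((w M).choose k : ℝ) * lam M ^ k ≤ (w M : ℝ) ^ k / (k.factorial : ℝ) * lam M ^ k :=
            mul_le_mul_of_nonneg_right h4 (pow_nonneg (hlam0 M) k)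
        _ = ((w M : ℝ) * lam M) ^ k / (k.factorial : ℝ) := by rw [mul_pow]; ring
        _ ≤ _ := by
          have := mul_nonneg (Nat.cast_nonneg (α := ℝ) (w M)) (hlam0 M)
          gcongr
    have h5 : 0 ≤ ((w M).choose k : ℝ) * lam M ^ k :=
      mul_nonneg (Nat.cast_nonneg _) (pow_nonneg (hlam0 M) k)
    have h6 : ‖A ^ k‖ ≤ ‖(1 : 𝔸)‖ * ‖A‖ ^ k + ‖A‖ ^ k := by
      rcases Nat.eq_zero_or_pos k with rfl | hk
      · simp
      · exact (norm_pow_le' A hk).trans (le_add_of_nonneg_left (by positivity))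
    rw [norm_smul, Real.norm_of_nonneg h5]
    calc ((w M).choose k : ℝ) * lam M ^ k * ‖A ^ k‖
        ≤ (|a| + 1) ^ k / (k.factorial : ℝ) * (‖(1 : 𝔸)‖ * ‖A‖ ^ k + ‖A‖ ^ k) :=
          mul_le_mul h3 h6 (norm_nonneg _) (by positivity)
      _ = _ := by rw [mul_pow]; ring

/-- Pairs of natural numbers in terms of their difference and their minimum. -/
def diffMinEquiv : ℤ × ℕ ≃ ℕ × ℕ where
  toFun p := (p.2 + p.1.toNat, p.2 + (-p.1).toNat)
  invFun q := ((q.1 : ℤ) - q.2, min q.1 q.2)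
  left_inv p := by
    ext
    · simp only; omega
    · simp only; omega
  right_inv q := by
    ext
    · simp only; omega
    · simp only; omega

theorem units_pow_mul_inv_pow {𝔸 : Type*} [Ring 𝔸] (u : 𝔸ˣ) (m n : ℕ) :
    (u : 𝔸) ^ m * ((u⁻¹ : 𝔸ˣ) : 𝔸) ^ n = ((u ^ ((m : ℤ) - n) : 𝔸ˣ) : 𝔸) := by
  rw [zpow_sub, zpow_natCast, zpow_natCast, Units.val_mul, Units.val_pow_eq_pow_val,
    ← inv_pow, Units.val_pow_eq_pow_val]

theorem exp_term_mul {𝔸 : Type*} [Ring 𝔸] [Algebra ℝ 𝔸] (u : 𝔸ˣ) (a : ℝ) (k : ℤ) (j : ℕ) :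
    (((j + k.toNat).factorial : ℝ)⁻¹ • (a • (u : 𝔸)) ^ (j + k.toNat)) *
      (((j + (-k).toNat).factorial : ℝ)⁻¹ • (a • ((u⁻¹ : 𝔸ˣ) : 𝔸)) ^ (j + (-k).toNat)) =
    ((2 * a / 2) ^ (2 * j + k.natAbs) /
        ((j.factorial : ℝ) * ((j + k.natAbs).factorial : ℝ))) • ((u ^ k : 𝔸ˣ) : 𝔸) := by
  have e0 : (((j + k.toNat : ℕ) : ℤ) - (j + (-k).toNat : ℕ)) = k := by omega
  rw [smul_pow, smul_pow, smul_smul, smul_smul, smul_mul_smul_comm, units_pow_mul_inv_pow, e0,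
    mul_div_cancel_left₀ _ (two_ne_zero' ℝ)]
  congr 1
  rcases le_total 0 k with hk | hk
  · have e1 : k.toNat = k.natAbs := by omega
    have e2 : (-k).toNat = 0 := by omega
    rw [e1, e2, add_zero, two_mul, pow_add, pow_add, pow_add]
    field_simp
  · have e1 : k.toNat = 0 := by omega
    have e2 : (-k).toNat = k.natAbs := by omega
    rw [e1, e2, add_zero, two_mul, pow_add, pow_add, pow_add]
    field_simp

theorem exp_smul_add_inv (u : 𝔸ˣ) (a : ℝ) :
    NormedSpace.exp (a • ((u : 𝔸) + ((u⁻¹ : 𝔸ˣ) : 𝔸))) =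
      NormedSpace.exp (a • (u : 𝔸)) * NormedSpace.exp (a • ((u⁻¹ : 𝔸ˣ) : 𝔸)) := by
  let _ : NormedAlgebra ℚ 𝔸 := NormedAlgebra.restrictScalars ℚ ℝ 𝔸
  have hcomm : Commute (a • (u : 𝔸)) (a • ((u⁻¹ : 𝔸ˣ) : 𝔸)) := by
    refine Commute.smul_left (Commute.smul_right ?_ a) a
    simp [Commute, SemiconjBy]
  rw [smul_add, NormedSpace.exp_add_of_commute hcomm]

omit [NormedAlgebra ℝ 𝔸] in
theorem hasSum_mul_of_summable_norm {ι κ : Type*} {f : ι → 𝔸} {g : κ → 𝔸} {a b : 𝔸}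
    (hf : HasSum f a) (hg : HasSum g b)
    (hf' : Summable fun k => ‖f k‖) (hg' : Summable fun k => ‖g k‖) :
    HasSum (fun q : ι × κ => f q.1 * g q.2) (a * b) := by
  rw [← hf.tsum_eq, ← hg.tsum_eq, tsum_mul_tsum_of_summable_norm hf' hg']
  exact (summable_mul_of_summable_norm hf' hg').hasSum

theorem hasSum_exp_mul_exp (A B : 𝔸) :
    HasSum (fun q : ℕ × ℕ => ((q.1.factorial : ℝ)⁻¹ • A ^ q.1) * ((q.2.factorial : ℝ)⁻¹ • B ^ q.2))
      (NormedSpace.exp A * NormedSpace.exp B) :=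
  hasSum_mul_of_summable_norm (f := fun n : ℕ => (n.factorial : ℝ)⁻¹ • A ^ n)
    (g := fun n : ℕ => (n.factorial : ℝ)⁻¹ • B ^ n)
    (NormedSpace.exp_series_hasSum_exp' (𝕂 := ℝ) A) (NormedSpace.exp_series_hasSum_exp' (𝕂 := ℝ) B)
    (NormedSpace.norm_expSeries_summable' (𝕂 := ℝ) A)
    (NormedSpace.norm_expSeries_summable' (𝕂 := ℝ) B)

/-- The generating function of the Bessel functions: in the double series of `exp (a u) exp (a
u⁻¹)`, the terms with difference of exponents `k` and minimum `j` are `u ^ k` times the `j`-th term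
of `I_|k|(2a)`. -/
theorem hasSum_exp_smul_add_inv (u : 𝔸ˣ) (a : ℝ) :
    HasSum (fun k : ℤ => besselI k.natAbs (2 * a) • ((u ^ k : 𝔸ˣ) : 𝔸))
      (NormedSpace.exp (a • ((u : 𝔸) + ((u⁻¹ : 𝔸ˣ) : 𝔸)))) := by
  rw [exp_smul_add_inv]
  have h1 := diffMinEquiv.hasSum_iff.2
    (hasSum_exp_mul_exp (a • (u : 𝔸)) (a • ((u⁻¹ : 𝔸ˣ) : 𝔸)))
  have h2 : HasSum (fun p : ℤ × ℕ => ((2 * a / 2) ^ (2 * p.2 + p.1.natAbs) /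
      ((p.2.factorial : ℝ) * ((p.2 + p.1.natAbs).factorial : ℝ))) • ((u ^ p.1 : 𝔸ˣ) : 𝔸))
      (NormedSpace.exp (a • (u : 𝔸)) * NormedSpace.exp (a • ((u⁻¹ : 𝔸ˣ) : 𝔸))) :=
    h1.congr_fun fun p => (exp_term_mul u a p.1 p.2).symm
  exact h2.prod_fiberwise fun k => ((summable_besselI k.natAbs (2 * a)).hasSum).smul_const _

theorem exp_add_eq_mul {A B : 𝔸} (h : Commute A B) :
    NormedSpace.exp (A + B) = NormedSpace.exp A * NormedSpace.exp B := by
  let _ : NormedAlgebra ℚ 𝔸 := NormedAlgebra.restrictScalars ℚ ℝ 𝔸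
  exact NormedSpace.exp_add_of_commute h

/-- Translations in different directions commute, so the exponential factorises, and the series
multiply by absolute convergence. Writing the group law through `φ` collects the product of powers
into one translation. -/
theorem hasSum_exp_sum_units [FiniteDimensional ℝ 𝔸] {G : Type*} [AddCommGroup G]
    (φ : Multiplicative G →* 𝔸ˣ) (a : ℝ) : ∀ (d : ℕ) (z : Fin d → G),
    HasSum (fun k : Fin d → ℤ => (∏ j, besselI (k j).natAbs (2 * a)) •
        ((φ (Multiplicative.ofAdd (∑ j, k j • z j)) : 𝔸ˣ) : 𝔸))
      (NormedSpace.exp (a • ∑ j, ((φ (Multiplicative.ofAdd (z j)) : 𝔸) +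
        (((φ (Multiplicative.ofAdd (z j)))⁻¹ : 𝔸ˣ) : 𝔸)))) := by
  intro d
  induction d with
  | zero =>
    intro z
    simp
  | succ d ih =>
    intro z
    rw [Fin.sum_univ_succ, smul_add, exp_add_eq_mul]
    · have h1 := hasSum_exp_smul_add_inv (φ (Multiplicative.ofAdd (z 0))) a
      have h2 := ih fun j => z j.succ
      have h3 := hasSum_mul_of_summable_norm h1 h2 (summable_norm_iff.2 h1.summable)
        (summable_norm_iff.2 h2.summable)
      rw [← (Fin.consEquiv fun _ : Fin (d + 1) => ℤ).hasSum_iff]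
      refine h3.congr_fun fun q => ?_
      simp only [Function.comp_apply, Fin.consEquiv_apply, Fin.prod_univ_succ, Fin.cons_zero,
        Fin.cons_succ, Fin.sum_univ_succ]
      rw [smul_mul_smul_comm, ← Units.val_mul, ofAdd_add, map_mul, ofAdd_zsmul, map_zpow]
    · have hc : ∀ x y : Multiplicative G, Commute ((φ x : 𝔸ˣ) : 𝔸) ((φ y : 𝔸ˣ) : 𝔸) := by
        intro x y
        rw [Commute, SemiconjBy, ← Units.val_mul, ← Units.val_mul, ← map_mul, ← map_mul, mul_comm]
      simp only [← map_inv]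
      refine Commute.smul_left (Commute.smul_right ?_ a) a
      refine Commute.sum_right _ _ _ fun j _ => ?_
      exact ((hc _ _).add_right (hc _ _)).add_left ((hc _ _).add_right (hc _ _))

end BanachAlgebra

section Shift

variable {T : Type*} [Fintype T] [DecidableEq T] [AddCommGroup T]

/-- The translation matrices of a finite abelian group. -/
def shiftHom : Multiplicative T →* Matrix T T ℝ where
  toFun z := Matrix.of fun x y => if y = x + z.toAdd then 1 else 0
  map_one' := by
    ext x y
    simp [Matrix.one_apply, eq_comm]
  map_mul' z z' := by
    ext x y
    rw [Matrix.mul_apply]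
    simp only [Matrix.of_apply, toAdd_mul, ite_mul, one_mul, zero_mul, Finset.sum_ite_eq',
      Finset.mem_univ, if_true, add_assoc]

/-- The translations of a finite abelian group as invertible matrices. -/
def shiftUnits : Multiplicative T →* (Matrix T T ℝ)ˣ :=
  (Units.map shiftHom).comp toUnits.toMonoidHom

theorem shiftUnits_apply (z : Multiplicative T) (x y : T) :
    ((shiftUnits z : (Matrix T T ℝ)ˣ) : Matrix T T ℝ) x y = if y = x + z.toAdd then 1 else 0 :=
  rfl

end Shift

/-! ### The Skellam kernel as the kernel of the continuous-time block walk -/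

section SkellamLimit

variable {d D : ℕ} [NeZero D]

/-- The generator of the block walk, without the holding term. -/
def blockStep (d D : ℕ) [NeZero D] : Matrix (Fin d → ZMod D) (Fin d → ZMod D) ℝ :=
  (1 / (2 * d) : ℝ) • ∑ j : Fin d,
    (((shiftUnits (Multiplicative.ofAdd (Pi.single j (1 : ZMod D) : Fin d → ZMod D))) :
        Matrix (Fin d → ZMod D) (Fin d → ZMod D) ℝ) +
      (((shiftUnits (Multiplicative.ofAdd (Pi.single j (1 : ZMod D) : Fin d → ZMod D)))⁻¹ :
        (Matrix (Fin d → ZMod D) (Fin d → ZMod D) ℝ)ˣ) :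
          Matrix (Fin d → ZMod D) (Fin d → ZMod D) ℝ))

theorem blockWalk_eq_blockStep (lam : ℝ) :
    blockWalk d D lam = (1 - lam) • (1 : Matrix (Fin d → ZMod D) (Fin d → ZMod D) ℝ) +
      lam • blockStep d D := by
  ext x y
  simp only [blockWalk, blockStep, Matrix.of_apply, Matrix.add_apply, Matrix.smul_apply,
    Matrix.one_apply, smul_eq_mul, mul_ite, mul_one, mul_zero]
  congr 1
  rw [Matrix.sum_apply, neighborCount, Finset.card_filter, Fintype.sum_prod_type]
  simp only [Matrix.add_apply, ← map_inv, ← ofAdd_neg, shiftUnits_apply, toAdd_ofAdd,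
    Fintype.sum_bool, if_true, Bool.false_eq_true, if_false, ← Pi.single_neg]
  push_cast
  ring

open scoped Matrix.Norms.Operator in
-- Each of the `2d` directions has rate `1 / (2d)`, so the Bessel argument is `2 a / (2d) = a / d`,
-- which is `2 τ / d` at `τ = a / 2`. The indicator selects the displacements that lead from `x` to
-- `y` on the torus.
theorem hasSum_exp_blockStep (a : ℝ) (x y : Fin d → ZMod D) :
    HasSum (fun k : Fin d → ℤ => (∏ j, besselI (k j).natAbs (2 * (a * (1 / (2 * d))))) *
        if (fun j => (k j : ZMod D)) = y - x then 1 else 0)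
      (NormedSpace.exp (a • blockStep d D) x y) := by
  have h := hasSum_exp_sum_units (𝔸 := Matrix (Fin d → ZMod D) (Fin d → ZMod D) ℝ)
    shiftUnits (a * (1 / (2 * d))) d (fun j => (Pi.single j (1 : ZMod D) : Fin d → ZMod D))
  rw [blockStep, smul_smul]
  refine (Pi.hasSum.1 (Pi.hasSum.1 h x) y).congr_fun fun k => ?_
  have e : ∑ j, k j • (Pi.single j (1 : ZMod D) : Fin d → ZMod D) = fun j => (k j : ZMod D) := by
    ext i
    simp [Finset.sum_apply, Pi.single_apply]
  rw [e, Matrix.smul_apply, shiftUnits_apply, smul_eq_mul, toAdd_ofAdd]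
  simp only [eq_sub_iff_add_eq', eq_comm]

/-- The displacements congruent to `y - x` are exactly the `-(x - y + m D)`; the sign is harmless
since the Bessel index is an absolute value. Summability is inherited from the exponential series.
-/
theorem hasSum_skellamKernel (a : ℝ) (x y : Fin d → ZMod D) :
    HasSum (fun k : Fin d → ℤ =>
        (∏ j, (Real.exp (-(2 * (a / 2) / d)) * besselI (k j).natAbs (2 * (a / 2) / d))) *
        if (fun j => (k j : ZMod D)) = y - x then 1 else 0)
      (skellamKernel x y (a / 2)) := by
  have e1 : 2 * (a * (1 / (2 * d))) = 2 * (a / 2) / (d : ℝ) := by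
    rcases eq_or_ne (d : ℝ) 0 with h | h
    · simp [h]
    · field_simp
  have h := (hasSum_exp_blockStep a x y).mul_left (Real.exp (-(2 * (a / 2) / d)) ^ d)
  have h2 : Summable fun k : Fin d → ℤ =>
        (∏ j, (Real.exp (-(2 * (a / 2) / d)) * besselI (k j).natAbs (2 * (a / 2) / d))) *
        if (fun j => (k j : ZMod D)) = y - x then 1 else 0 := by
    refine h.summable.congr fun k => ?_
    rw [e1, Finset.prod_mul_distrib, Finset.prod_const, Finset.card_univ, Fintype.card_fin,
      mul_assoc]
  convert h2.hasSum using 1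
  rw [skellamKernel, skellam]
  have hD : (D : ℤ) ≠ 0 := by exact_mod_cast NeZero.ne D
  have hval : ∀ j, (((x j - y j).val : ℤ) : ZMod D) = x j - y j := fun j => by simp
  have hinj : Function.Injective fun (m : Fin d → ℤ) j => -(((x j - y j).val : ℤ) + m j * D) := by
    intro m m' h
    ext j
    have := congrFun h j
    simp only [neg_inj, add_right_inj] at this
    exact mul_right_cancel₀ hD this
  rw [← hinj.tsum_eq (f := fun k : Fin d → ℤ =>
    (∏ j, (Real.exp (-(2 * (a / 2) / d)) * besselI (k j).natAbs (2 * (a / 2) / d))) *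
      if (fun j => (k j : ZMod D)) = y - x then 1 else 0)]
  · refine tsum_congr fun m => ?_
    rw [if_pos, mul_one]
    · simp only [Int.natAbs_neg]
    · ext j
      simp only [Int.cast_neg, Int.cast_add, hval, Int.cast_mul, Int.cast_natCast,
        ZMod.natCast_self, mul_zero, add_zero, Pi.sub_apply, neg_sub]
  · intro k hk
    have hk2 : (fun j => (k j : ZMod D)) = y - x := by
      by_contra h
      exact hk (by simp only [if_neg h, mul_zero])
    have h3 : ∀ j, ∃ m : ℤ, -k j - ((x j - y j).val : ℤ) = D * m := by
      intro j
      rw [← dvd_def, ← ZMod.intCast_zmod_eq_zero_iff_dvd, Int.cast_sub, hval, Int.cast_neg,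
        congrFun hk2 j]
      simp
    choose m hm using h3
    refine ⟨m, funext fun j => ?_⟩
    have := hm j
    simp only
    linarith [mul_comm (D : ℤ) (m j)]

omit [NeZero D] in
theorem skellamKernel_nonneg (x y : Fin d → ZMod D) {a : ℝ} (ha : 0 ≤ a) :
    0 ≤ skellamKernel x y (a / 2) :=
  tsum_nonneg fun m => Finset.prod_nonneg fun j _ =>
    mul_nonneg (Real.exp_nonneg _) (besselI_nonneg _ (by positivity))

theorem skellamKernel_self_pos (x : Fin d → ZMod D) {a : ℝ} (ha : 0 ≤ a) :
    0 < skellamKernel x x (a / 2) := by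
  have h := hasSum_skellamKernel a x x
  rw [← h.tsum_eq]
  refine h.summable.tsum_pos (fun k => ?_) 0 ?_
  · refine mul_nonneg (Finset.prod_nonneg fun j _ =>
      mul_nonneg (Real.exp_nonneg _) (besselI_nonneg _ (by positivity))) ?_
    split_ifs <;> simp
  · rw [if_pos (by ext j; simp), mul_one]
    exact Finset.prod_pos fun j _ => mul_pos (Real.exp_pos _) (besselI_zero_pos (by positivity))

open scoped Matrix.Norms.Operator in
theorem exp_blockStep_eq (hd : 1 ≤ d) (a : ℝ) (x y : Fin d → ZMod D) :
    Real.exp (-a) * NormedSpace.exp (a • blockStep d D) x y = skellamKernel x y (a / 2) := by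
  have hd' : (d : ℝ) ≠ 0 := by positivity
  have e1 : 2 * (a * (1 / (2 * d))) = 2 * (a / 2) / (d : ℝ) := by field_simp
  refine HasSum.unique ((hasSum_exp_blockStep a x y).mul_left (Real.exp (-a)))
    ((hasSum_skellamKernel a x y).congr_fun fun k => ?_)
  rw [e1, Finset.prod_mul_distrib, Finset.prod_const, Finset.card_univ, Fintype.card_fin,
    ← Real.exp_nat_mul, mul_assoc]
  congr 2
  field_simp

open scoped Matrix.Norms.Operator in
/-- Convergence of the slow block walk to the continuous-time walk. -/
theorem tendsto_blockWalk_pow (hd : 1 ≤ d) {lam : ℕ → ℝ} (h : ∀ M, lam M ∈ Set.Ico (0 : ℝ) 1)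
    {w : ℕ → ℕ} {a : ℝ} (hlam : Tendsto lam atTop (𝓝 0))
    (hw : Tendsto (fun M => (w M : ℝ) * lam M) atTop (𝓝 a)) (x y : Fin d → ZMod D) :
    Tendsto (fun M => (blockWalk d D (lam M) ^ w M) x y) atTop (𝓝 (skellamKernel x y (a / 2))) := by
  have h1 : ∀ M, 0 < 1 - lam M := fun M => sub_pos.2 (h M).2
  have h2 : Tendsto (fun M => (1 - lam M)⁻¹) atTop (𝓝 1) := by
    simpa using (hlam.const_sub 1).inv₀ (by norm_num)
  have h3 : Tendsto (fun M => lam M * (1 - lam M)⁻¹) atTop (𝓝 0) := by simpa using hlam.mul h2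
  have h4 : Tendsto (fun M => (w M : ℝ) * (lam M * (1 - lam M)⁻¹)) atTop (𝓝 a) := by
    simpa [mul_assoc] using hw.mul h2
  have h5 := tendsto_one_add_smul_pow (blockStep d D) h3 h4
    fun M => mul_nonneg (h M).1 (inv_nonneg.2 (h1 M).le)
  have h6 := (tendsto_pi_nhds.1 (tendsto_pi_nhds.1 h5 x) y)
  have h7 := (tendsto_one_sub_pow hlam hw).mul h6
  have h8 : skellamKernel x y (a / 2) =
      Real.exp (-a) * NormedSpace.exp (a • blockStep d D) x y :=
    (exp_blockStep_eq hd a x y).symm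
  rw [h8]
  refine h7.congr fun M => ?_
  -- The holding probability is factored out: its power gives `exp (-a)`, and the remaining step `λ
  -- / (1 - λ)` has the same limit in time as `λ`.
  have e : blockWalk d D (lam M) =
      (1 - lam M) • (1 + (lam M * (1 - lam M)⁻¹) • blockStep d D) := by
    rw [blockWalk_eq_blockStep, smul_add, smul_smul, mul_left_comm, mul_inv_cancel₀ (h1 M).ne',
      mul_one]
  rw [e, smul_pow, Matrix.smul_apply, smul_eq_mul]

end SkellamLimit

/-! ### The Skellam regime -/

namespace RibbonGraph

variable {s : ℕ} (Γ : RibbonGraph s)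

theorem ae_ne_zero (ι : Type*) [Fintype ι] : ∀ᵐ a : ι → ℝ, ∀ e, a e ≠ 0 := by
  rw [ae_all_iff]
  intro e
  exact (Measure.ae_eval_ne (μ := fun _ : ι => (volume : Measure ℝ)) e 0)

/-- Positive limits are needed throughout, because asymptotic equivalence to a constant is the same
as convergence only when the constant is nonzero. -/
theorem setIntegral_region_pos {t : Fin s → ℝ} (ht : ∀ i, 0 < t i) {G : (Γ.Edge → ℝ) → ℝ}
    (hG : IntegrableOn G (Γ.region t)) (h0 : ∀ a, (∀ e, 0 ≤ a e) → 0 ≤ G a)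
    (hpos : ∀ a, (∀ e, 0 < a e) → 0 < G a) : 0 < ∫ a in Γ.region t, G a := by
  have h1 : 0 ≤ᵐ[volume.restrict (Γ.region t)] G :=
    (ae_restrict_mem (Γ.measurableSet_region t)).mono fun a ha => h0 a ha.1
  rw [setIntegral_pos_iff_support_of_nonneg_ae h1 hG]
  refine (Γ.volume_region_pos ht).trans_le (measure_mono_ae ?_)
  filter_upwards [ae_ne_zero Γ.Edge] with a ha hat
  exact ⟨(hpos a fun e => (hat.1 e).lt_of_ne (ha e).symm).ne', hat⟩

variable {Γ}

theorem abs_prod_le {f g : Γ.Edge → ℝ} {b : ℝ} (h0 : ∀ e, 0 ≤ f e) (h : ∀ e, f e ≤ b * g e) :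
    |∏ e, f e| ≤ b ^ Γ.numEdges * ∏ e, g e := by
  rw [abs_of_nonneg (Finset.prod_nonneg fun e _ => h0 e)]
  calc ∏ e, f e ≤ ∏ e, b * g e := Finset.prod_le_prod (fun e _ => h0 e) fun e _ => h e
    _ = _ := by rw [Finset.prod_mul_distrib, Finset.prod_const, Finset.card_univ, Fintype.card_fin]

theorem tendsto_blockWeight_sum (hc : Γ.Connected) {d D : ℕ} [NeZero D] (hd : 1 ≤ d)
    {lam : ℕ → ℝ} (hlam : ∀ M, lam M ∈ Set.Ico (0 : ℝ) 1) (hlam0 : Tendsto lam atTop (𝓝[>] 0))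
    {n : ℕ → Fin s → ℕ} {t : Fin s → ℝ} (he : ∀ M, Even (∑ i, n M i)) (ht : ∀ i, 0 < t i)
    (hn : ∀ i, Tendsto (fun M => (n M i : ℝ) * lam M) atTop (𝓝 (t i)))
    (x : Γ.Vertex → Fin d → ZMod D) :
    IntegrableOn (fun a => ∏ e, skellamKernel (x (Γ.src e)) (x (Γ.tgt e)) (a e / 2))
        (Γ.region t) ∧
      Tendsto (fun M => lam M ^ Γ.numEdges * ∑ q ∈ Γ.solutions (n M), Γ.blockWeight (lam M) x q.2)
        atTop (𝓝 (Γ.parityConst *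
          ∫ a in Γ.region t, ∏ e, skellamKernel (x (Γ.src e)) (x (Γ.tgt e)) (a e / 2))) := by
  have hL : Tendsto (fun M => (lam M)⁻¹) atTop atTop := tendsto_inv_nhdsGT_zero.comp hlam0
  have hpos : ∀ᶠ M in atTop, 0 < lam M := hlam0.eventually self_mem_nhdsWithin
  obtain ⟨T, hT0, hT⟩ : ∃ T, 0 < T ∧ ∀ i, t i < T :=
    ⟨∑ i, t i + 1, by have := Finset.sum_nonneg fun i (_ : i ∈ Finset.univ) => (ht i).le; linarith,
      fun i => (Finset.single_le_sum (f := t) (fun j _ => (ht j).le)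
        (Finset.mem_univ i)).trans_lt (lt_add_one _)⟩
  have key := tendsto_sum_solutions hc hL (n := n) (t := t) ht
    (fun i => by simpa using hn i) he (g := fun M w => Γ.blockWeight (lam M) x w)
    (G := fun a => ∏ e, skellamKernel (x (Γ.src e)) (x (Γ.tgt e)) (a e / 2))
    -- The kernels are at most `1`, and `w / L ≤ T` gives `1 ≤ √T (w / L) ^ (-1/2)` on each edge.
    (B := √T ^ Γ.numEdges) (T := T) hT ?_ ?_
  · simpa using key
  · filter_upwards [hpos] with M hM w hw hwT
    refine abs_prod_le (fun e => blockWalk_pow_nonneg (hlam M) _ _ _) fun e =>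
      (blockWalk_pow_le_one hd (hlam M) _ _ _).trans ?_
    have h1 : (0 : ℝ) < w e := by exact_mod_cast hw e
    rw [← div_eq_mul_inv, one_le_div (Real.sqrt_pos.2 (by positivity))]
    exact Real.sqrt_le_sqrt ((div_le_iff₀ (by positivity)).2 (hwT e))
  · intro a _ w _ hw
    refine tendsto_finsetProd _ fun e _ => tendsto_blockWalk_pow hd hlam
      (tendsto_nhds_of_tendsto_nhdsWithin hlam0) ?_ _ _
    simpa using hw e

theorem sum_setIntegral_pos {X : Type*} [Fintype X] {K : X → X → ℝ → ℝ} {t : Fin s → ℝ}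
    [Fintype (Γ.Vertex → X)] (ht : ∀ i, 0 < t i) (x₀ : X)
    (hK : ∀ x y a, 0 ≤ a → 0 ≤ K x y a) (hK0 : ∀ a, 0 ≤ a → 0 < K x₀ x₀ a)
    (h : ∀ x : Γ.Vertex → X,
      IntegrableOn (fun a => ∏ e, K (x (Γ.src e)) (x (Γ.tgt e)) (a e)) (Γ.region t)) :
    0 < ∑ x : Γ.Vertex → X, ∫ a in Γ.region t, ∏ e, K (x (Γ.src e)) (x (Γ.tgt e)) (a e) := by
  have h0 : ∀ (x : Γ.Vertex → X) (a : Γ.Edge → ℝ), (∀ e, 0 ≤ a e) →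
      0 ≤ ∏ e, K (x (Γ.src e)) (x (Γ.tgt e)) (a e) :=
    fun x a ha => Finset.prod_nonneg fun e _ => hK _ _ _ (ha e)
  have h1 : 0 < ∫ a in Γ.region t, ∏ e, K x₀ x₀ (a e) :=
    Γ.setIntegral_region_pos ht (h fun _ => x₀) (h0 fun _ => x₀) fun a ha =>
      Finset.prod_pos fun e _ => hK0 _ (ha e).le
  refine Finset.sum_pos' (fun x _ => ?_) ⟨fun _ => x₀, Finset.mem_univ _, h1⟩
  exact setIntegral_nonneg (Γ.measurableSet_region t) fun a ha => h0 x a ha.1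

theorem skellam_isEquivalent (hΓ : Γ.IsTypical) (hE : 1 ≤ Γ.numEdges) {d D : ℕ}
    [NeZero D] (hd : 1 ≤ d) {lam : ℕ → ℝ} (hlam : ∀ M, lam M ∈ Set.Ico (0 : ℝ) 1) {μ : ℝ}
    (hμ : 0 < μ) (hlim : Tendsto (fun M : ℕ => (M : ℝ) ^ (1 / 3 : ℝ) * lam M) atTop (𝓝 μ))
    {n : ℕ → Fin s → ℕ} {t : Fin s → ℝ} (he : ∀ M, Even (∑ i, n M i)) (ht : ∀ i, 0 < t i)
    (hn : ∀ i, Tendsto (fun M => (n M i : ℝ) * lam M) atTop (𝓝 (t i))) :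
    (fun M => 1 / (∏ i, (n M i : ℝ)) * wegnerF Γ d D M (lam M) (n M)) ~[atTop]
      (fun _ => Γ.parityConst / (∏ i, t i) * μ ^ (-(Γ.numEdges : ℤ) + (s : ℤ)) *
        Γ.skellamIntegral d D t) := by
  have hc := hΓ.connected
  have hcube : Tendsto (fun M : ℕ => (M : ℝ) ^ (1 / 3 : ℝ)) atTop atTop :=
    (tendsto_rpow_atTop (by norm_num)).comp tendsto_natCast_atTop_atTop
  have hpos : ∀ᶠ M in atTop, 0 < lam M := by
    filter_upwards [hlim.eventually (lt_mem_nhds hμ)] with M hM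
    exact (hlam M).1.lt_of_ne fun h => by simp [← h] at hM
  have hlam0 : Tendsto lam atTop (𝓝[>] 0) := by
    refine tendsto_nhdsWithin_iff.2 ⟨?_, hpos⟩
    refine (hlim.div_atTop hcube).congr' ?_
    filter_upwards [hcube.eventually_gt_atTop 0] with M hM
    rw [mul_div_cancel_left₀ _ hM.ne']
  have hx := fun x => tendsto_blockWeight_sum (D := D) hc hd hlam hlam0 he ht hn x
  have hprod : 0 < ∏ i, t i := Finset.prod_pos fun i _ => ht i
  have hI : 0 < Γ.skellamIntegral d D t := sum_setIntegral_pos ht 0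
    (fun x y a ha => skellamKernel_nonneg x y ha) (fun a ha => skellamKernel_self_pos 0 ha)
    fun x => (hx x).1
  refine (isEquivalent_const_iff_tendsto ?_).2 ?_
  · have := Γ.parityConst_pos
    positivity
  have h1 := tendsto_finsetSum Finset.univ fun x _ => (hx x).2
  rw [← Finset.mul_sum] at h1
  have h2 : Tendsto (fun M : ℕ => ((M : ℝ) ^ (1 / 3 : ℝ) * lam M) ^ (-(Γ.numEdges : ℤ) + (s : ℤ)))
      atTop (𝓝 (μ ^ (-(Γ.numEdges : ℤ) + (s : ℤ)))) := hlim.zpow₀ _ (Or.inl hμ.ne')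
  have h3 : Tendsto (fun M => ∏ i, ((n M i : ℝ) * lam M)) atTop (𝓝 (∏ i, t i)) :=
    tendsto_finsetProd _ fun i _ => hn i
  have h4 := ((h3.inv₀ hprod.ne').mul h2).mul h1
  have e1 : (∏ i, t i)⁻¹ * μ ^ (-(Γ.numEdges : ℤ) + (s : ℤ)) *
      (Γ.parityConst * ∑ x : Γ.Vertex → Fin d → ZMod D, ∫ a in Γ.region t,
        ∏ e, skellamKernel (x (Γ.src e)) (x (Γ.tgt e)) (a e / 2)) =
      Γ.parityConst / (∏ i, t i) * μ ^ (-(Γ.numEdges : ℤ) + (s : ℤ)) *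
        Γ.skellamIntegral d D t := by
    rw [skellamIntegral]; ring
  rw [e1] at h4
  refine h4.congr' ?_
  filter_upwards [hpos, eventually_ge_atTop 1] with M hM hM1
  have hM0 : (0 : ℝ) < M := by exact_mod_cast hM1
  rw [Γ.wegnerF_eq hM1, ← Finset.mul_sum, Finset.prod_mul_distrib, Finset.prod_const,
    Finset.card_univ, Fintype.card_fin]
  set r := (M : ℝ) ^ (1 / 3 : ℝ) with hr
  have hr0 : 0 < r := Real.rpow_pos_of_pos hM0 _
  have hr3 : (M : ℝ) = r ^ 3 := by
    rw [hr, ← Real.rpow_natCast, ← Real.rpow_mul hM0.le]; norm_num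
  have hz : (r * lam M) ^ (-(Γ.numEdges : ℤ) + (s : ℤ)) =
      ((r * lam M) ^ Γ.numEdges)⁻¹ * (r * lam M) ^ s := by
    rw [zpow_add₀ (by positivity), zpow_neg, zpow_natCast, zpow_natCast]
  -- With `M = r ^ 3` the relation `3 |V| = 2 |E| + s` turns `M ^ (|V| - |E|)` into `r ^ (s - |E|)`,
  -- and the powers of `λ` supply the rest of `(r λ) ^ (s - |E|)`.
  rw [hz, hr3, ← pow_mul, ← pow_mul, hΓ.three_mul_card hE, pow_add, mul_pow, mul_pow]
  -- If some perimeter vanishes both sides are `0`, by the convention `1 / 0 = 0`.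
  rcases eq_or_ne (∏ i, (n M i : ℝ)) 0 with h0 | h0
  · simp [h0]
  · field_simp
    ring

end RibbonGraph

/-! ### Joint Riemann sums over labels and edge lengths -/

theorem integrable_and_tendsto_of_dominated {X : Type*} [MeasurableSpace X] {ν : Measure X}
    {F : ℕ → X → ℝ} {f bound : X → ℝ} (hm : ∀ᶠ M in atTop, AEStronglyMeasurable (F M) ν)
    (hb : Integrable bound ν) (hF : ∀ᶠ M in atTop, ∀ᵐ x ∂ν, ‖F M x‖ ≤ bound x)
    (hlim : ∀ᵐ x ∂ν, Tendsto (fun M => F M x) atTop (𝓝 (f x))) :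
    Integrable f ν ∧ Tendsto (fun M => ∫ x, F M x ∂ν) atTop (𝓝 (∫ x, f x ∂ν)) := by
  refine ⟨?_, tendsto_integral_filter_of_dominated_convergence bound hm hF hb hlim⟩
  obtain ⟨M₀, hM₀⟩ := eventually_atTop.1 (hm.and hF)
  have hlim' : ∀ᵐ x ∂ν, Tendsto (fun M => F (M + M₀) x) atTop (𝓝 (f x)) :=
    hlim.mono fun x hx => hx.comp (tendsto_add_atTop_nat M₀)
  -- The limit function is measurable as an almost everywhere limit; the shift by `M₀` discards the
  -- terms for which nothing is known.
  have hmeas : AEStronglyMeasurable f ν :=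
    aestronglyMeasurable_of_tendsto_ae atTop (fun M => (hM₀ (M + M₀) (by omega)).1) hlim'
  refine hb.mono' hmeas ?_
  have hall := ae_all_iff.2 fun M => (hM₀ (M + M₀) (by omega)).2
  filter_upwards [hlim', hall] with x hx hx2
  exact le_of_tendsto hx.norm (Eventually.of_forall hx2)

namespace RibbonGraph

variable {s : ℕ} {Γ : RibbonGraph s}

section Outer

variable {ι : Type*} [Fintype ι]

open Classical in
/-- Riemann sums over vertex labels and edge lengths at the same time. -/
theorem tendsto_sum_labels (hc : Γ.Connected) {L ρ : ℕ → ℝ} (hL : Tendsto L atTop atTop)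
    (hρ : ∀ᶠ M in atTop, 0 < ρ M) {n : ℕ → Fin s → ℕ} {t : Fin s → ℝ} (ht : ∀ i, 0 < t i)
    (hn : ∀ i, Tendsto (fun M => (n M i : ℝ) / L M) atTop (𝓝 (t i)))
    (he : ∀ M, Even (∑ i, n M i)) {T : ℝ} (hT0 : 0 ≤ T) (hT : ∀ i, t i < T)
    {J : ℕ → Finset (ι → ℤ)} {U : Set (ι → ℝ)} (hU : MeasurableSet U)
    (hJ : ∀ y ∈ U, ∀ᶠ M in atTop, floorPoint (ρ M) y ∈ J M)
    (hJ' : ∀ y ∉ U, ∀ᶠ M in atTop, floorPoint (ρ M) y ∉ J M)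
    {g : ℕ → (ι → ℤ) → (Γ.Edge → ℕ) → ℝ} {b : (ι → ℝ) → ℝ} (hb0 : ∀ y, 0 ≤ b y)
    (hb : Integrable b)
    (hB : ∀ᶠ M in atTop, ∀ y, floorPoint (ρ M) y ∈ J M → ∀ w : Γ.Edge → ℕ, (∀ e, 1 ≤ w e) →
      (∀ e, (w e : ℝ) ≤ T * L M) →
        |g M (floorPoint (ρ M) y) w| ≤ b y * ∏ e, (√((w e : ℝ) / L M))⁻¹)
    {G : (ι → ℝ) → (Γ.Edge → ℝ) → ℝ}
    (hlim : ∀ y ∈ U, ∀ a : Γ.Edge → ℝ, (∀ e, 0 < a e) → ∀ w : ℕ → Γ.Edge → ℕ,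
      (∀ M e, 1 ≤ w M e) → (∀ e, Tendsto (fun M => (w M e : ℝ) / L M) atTop (𝓝 (a e))) →
        Tendsto (fun M => g M (floorPoint (ρ M) y) (w M)) atTop (𝓝 (G y a))) :
    ((∀ y ∈ U, IntegrableOn (G y) (Γ.region t)) ∧
      IntegrableOn (fun y => ∫ a in Γ.region t, G y a) U) ∧
      Tendsto (fun M => (L M ^ Γ.numEdges)⁻¹ * ((ρ M ^ Fintype.card ι)⁻¹ *
          ∑ z ∈ J M, ∑ q ∈ Γ.solutions (n M), g M z q.2)) atTop
        (𝓝 (Γ.parityConst * ∫ y in U, ∫ a in Γ.region t, G y a)) := by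
  have hLpos : ∀ᶠ M in atTop, 0 < L M := hL.eventually_gt_atTop 0
  have hnT : ∀ᶠ M in atTop, ∀ i, (n M i : ℝ) ≤ T * L M := by
    filter_upwards [eventually_all.2 fun i => (hn i).eventually (gt_mem_nhds (hT i)), hLpos]
      with M hM hM0 i
    exact ((div_lt_iff₀ hM0).1 (hM i)).le
  -- For a fixed position `y` only the edge weights vary, so the single-labelling limit applies with
  -- `B = b y`. The outer integrals are then dominated by `b y * (2 √T) ^ |E|`.
  have hinner : ∀ y ∈ U, IntegrableOn (G y) (Γ.region t) ∧
      Tendsto (fun M => (L M ^ Γ.numEdges)⁻¹ *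
        ∑ q ∈ Γ.solutions (n M), g M (floorPoint (ρ M) y) q.2) atTop
        (𝓝 (Γ.parityConst * ∫ a in Γ.region t, G y a)) := fun y hy =>
    tendsto_sum_solutions hc hL ht hn he (g := fun M w => g M (floorPoint (ρ M) y) w) (B := b y) hT
      (by filter_upwards [hB, hJ y hy] with M hM hM2 w hw hwT using hM y hM2 w hw hwT)
      (hlim y hy)
  let H : ℕ → (ι → ℤ) → ℝ := fun M z =>
    (L M ^ Γ.numEdges)⁻¹ * ∑ q ∈ Γ.solutions (n M), g M z q.2
  have key := integrable_and_tendsto_of_dominated (ν := (volume : Measure (ι → ℝ)))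
    (F := fun M y => if floorPoint (ρ M) y ∈ J M then H M (floorPoint (ρ M) y) else 0)
    (f := U.indicator fun y => Γ.parityConst * ∫ a in Γ.region t, G y a)
    (bound := fun y => b y * (2 * √T) ^ Γ.numEdges)
    (Eventually.of_forall fun M => aestronglyMeasurable_comp_floorPoint _ _ _)
    (hb.mul_const _) ?_ ?_
  · refine ⟨⟨fun y hy => (hinner y hy).1, ?_⟩, ?_⟩
    · have h1 := (integrable_indicator_iff hU).1 key.1
      have h2 := h1.const_mul (Γ.parityConst)⁻¹
      refine h2.congr (Eventually.of_forall fun y => ?_)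
      simp only
      rw [inv_mul_cancel_left₀ Γ.parityConst_pos.ne']
    · have h1 := key.2
      rw [integral_indicator hU, integral_const_mul] at h1
      refine h1.congr' ?_
      filter_upwards [hρ] with M hM
      rw [← sum_eq_integral_floorPoint hM]
      simp only [H, Finset.mul_sum]
      refine Finset.sum_congr rfl fun z _ => Finset.sum_congr rfl fun q _ => by ring
  · filter_upwards [hB, hnT, hLpos] with M hM hM2 hM0
    refine Eventually.of_forall fun y => ?_
    split_ifs with hy
    · exact abs_sum_solutions_le Γ hM0 hT0 hM2 (hb0 y) (hM y hy)
    · rw [norm_zero]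
      exact mul_nonneg (hb0 y) (by positivity)
  · refine Eventually.of_forall fun y => ?_
    by_cases hy : y ∈ U
    · rw [Set.indicator_of_mem hy]
      refine (hinner y hy).2.congr' ?_
      filter_upwards [hJ y hy] with M hM
      rw [if_pos hM]
    · rw [Set.indicator_of_notMem hy]
      refine tendsto_const_nhds.congr' ?_
      filter_upwards [hJ' y hy] with M hM
      rw [if_neg hM]

theorem setIntegral_setIntegral_region_pos {t : Fin s → ℝ} (ht : ∀ i, 0 < t i) {U : Set (ι → ℝ)}
    (hU : MeasurableSet U) (hU0 : 0 < volume U) {G : (ι → ℝ) → (Γ.Edge → ℝ) → ℝ}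
    (hG : ∀ y ∈ U, IntegrableOn (G y) (Γ.region t))
    (hG' : IntegrableOn (fun y => ∫ a in Γ.region t, G y a) U)
    (h0 : ∀ y a, (∀ e, 0 ≤ a e) → 0 ≤ G y a) (hpos : ∀ y a, (∀ e, 0 < a e) → 0 < G y a) :
    0 < ∫ y in U, ∫ a in Γ.region t, G y a := by
  have h1 : ∀ y ∈ U, 0 < ∫ a in Γ.region t, G y a := fun y hy =>
    Γ.setIntegral_region_pos ht (hG y hy) (h0 y) (hpos y)
  rw [setIntegral_pos_iff_support_of_nonneg_ae
    ((ae_restrict_mem hU).mono fun y hy => (h1 y hy).le) hG']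
  exact hU0.trans_le (measure_mono fun y hy => ⟨(h1 y hy).ne', hy⟩)

end Outer

/-! ### Cycles that are not long on the diffusive scale -/

section Circle

variable {L lam : ℕ → ℝ}

theorem mul_blockWalk_one_pow_le {lam L T : ℝ} (h : lam ∈ Set.Ico (0 : ℝ) 1) {D : ℕ} [NeZero D]
    (hL : 0 < L) (hell : 1 ≤ √(lam * L)) {w : ℕ} (hw : 1 ≤ w) (hwT : (w : ℝ) ≤ T * L)
    (x y : Fin 1 → ZMod D) :
    √(lam * L) * (blockWalk 1 D lam ^ w) x y ≤
      2 * Real.exp (2 * T) * (3 + 2 * (√(lam * L) / D)) *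
        Real.exp (-(|((x 0 - y 0).valMinAbs : ℝ)| / √(lam * L))) * (√((w : ℝ) / L))⁻¹ := by
  rw [blockWalk_one_pow_apply w (z := (x 0 - y 0).valMinAbs) (ZMod.coe_valMinAbs _)]
  have hz : |(x 0 - y 0).valMinAbs| * 2 ≤ D := by
    have := ZMod.valMinAbs_mem_Ioc (x 0 - y 0)
    rcases this with ⟨h1, h2⟩
    rcases abs_cases (x 0 - y 0).valMinAbs with h | h <;> omega
  refine (torusWalk_le h (NeZero.ne D) hL hell hw hwT hz).trans_eq (by ring)

open Classical in
-- Labels represented in `{0, …, D - 1}` and rescaled by `D` fill the unit cube exactly, so no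
-- boundary terms arise.
theorem floorPoint_mem_box {ι : Type*} [Fintype ι] {D : ℕ} [NeZero D] (y : ι → ℝ) :
    floorPoint (D : ℝ) y ∈ (Finset.univ.image fun (x : ι → Fin 1 → ZMod D) v =>
      ((x v 0).val : ℤ)) ↔ y ∈ Set.univ.pi fun _ : ι => Set.Ico (0 : ℝ) 1 := by
  have hD : (0 : ℝ) < D := by exact_mod_cast NeZero.pos D
  simp only [Finset.mem_image, Finset.mem_univ, true_and, Set.mem_pi, Set.mem_univ,
    forall_true_left, Set.mem_Ico]
  constructor
  · rintro ⟨x, hx⟩ v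
    have h1 : ((x v 0).val : ℤ) = ⌊(D : ℝ) * y v⌋ := congrFun hx v
    have h2 : ((x v 0).val : ℤ) < D := by exact_mod_cast ZMod.val_lt (x v 0)
    have h3 : (0 : ℤ) ≤ ⌊(D : ℝ) * y v⌋ := h1 ▸ Int.natCast_nonneg _
    have h4 : ⌊(D : ℝ) * y v⌋ < (D : ℤ) := h1 ▸ h2
    refine ⟨?_, ?_⟩
    · exact nonneg_of_mul_nonneg_right (Int.floor_nonneg.1 h3) hD
    · have := Int.floor_lt.1 h4
      push_cast at this
      exact lt_of_mul_lt_mul_left (by linarith) hD.le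
  · intro h
    refine ⟨fun v _ => (⌊(D : ℝ) * y v⌋ : ZMod D), funext fun v => ?_⟩
    have h0 : 0 ≤ ⌊(D : ℝ) * y v⌋ := Int.floor_nonneg.2 (mul_nonneg hD.le (h v).1)
    have h1 : ⌊(D : ℝ) * y v⌋ < (D : ℤ) := by
      rw [Int.floor_lt]
      push_cast
      nlinarith [(h v).2]
    simp only [floorPoint]
    obtain ⟨k, hk⟩ := Int.eq_ofNat_of_zero_le h0
    rw [hk] at h1 ⊢
    rw [Int.cast_natCast, ZMod.val_natCast, Nat.mod_eq_of_lt]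
    exact_mod_cast h1

open Classical in
/-- The diagram sums on a cycle which is not long on the diffusive scale. -/
theorem tendsto_sum_circle (hc : Γ.Connected) (hs : DiffusiveScale lam L) {D : ℕ → ℕ}
    [∀ M, NeZero (D M)] {n : ℕ → Fin s → ℕ} {t : Fin s → ℝ} (ht : ∀ i, 0 < t i)
    (hn : ∀ i, Tendsto (fun M => (n M i : ℝ) / L M) atTop (𝓝 (t i)))
    (he : ∀ M, Even (∑ i, n M i)) {K₀ : ℝ}
    (hD : ∀ᶠ M in atTop, (D M : ℝ) / √(lam M * L M) ≤ K₀) {K : ℝ → ℝ → ℝ}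
    (hK0 : ∀ y a, 0 ≤ a → 0 ≤ K y a) (hKpos : ∀ y a, 0 < a → 0 < K y a)
    (hK : ∀ y y' : ℝ, y ∈ Set.Ico (0 : ℝ) 1 → y' ∈ Set.Ico (0 : ℝ) 1 → ∀ a, 0 < a →
      ∀ w : ℕ → ℕ, (∀ M, 1 ≤ w M) → Tendsto (fun M => (w M : ℝ) / L M) atTop (𝓝 a) →
        Tendsto (fun M => (D M : ℝ) * torusWalk (lam M) (D M) (w M)
          (⌊(D M : ℝ) * y⌋ - ⌊(D M : ℝ) * y'⌋)) atTop (𝓝 (K (y - y') a))) :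
    0 < ∫ x in Set.univ.pi (fun _ : Γ.Vertex => Set.Ico (0 : ℝ) 1), ∫ a in Γ.region t,
        ∏ e, K (x (Γ.src e) - x (Γ.tgt e)) (a e) ∧
      Tendsto (fun M => (L M ^ Γ.numEdges)⁻¹ * (((D M : ℝ) ^ Fintype.card Γ.Vertex)⁻¹ *
          ∑ x : Γ.Vertex → Fin 1 → ZMod (D M), ∑ q ∈ Γ.solutions (n M),
            (D M : ℝ) ^ Γ.numEdges * Γ.blockWeight (lam M) x q.2)) atTop
        (𝓝 (Γ.parityConst * ∫ x in Set.univ.pi (fun _ : Γ.Vertex => Set.Ico (0 : ℝ) 1),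
          ∫ a in Γ.region t, ∏ e, K (x (Γ.src e) - x (Γ.tgt e)) (a e))) := by
  obtain ⟨T, hT0, hT⟩ : ∃ T, 0 < T ∧ ∀ i, t i < T :=
    ⟨∑ i, t i + 1, by have := Finset.sum_nonneg fun i (_ : i ∈ Finset.univ) => (ht i).le; linarith,
      fun i => (Finset.single_le_sum (f := t) (fun j _ => (ht j).le)
        (Finset.mem_univ i)).trans_lt (lt_add_one _)⟩
  have hUm : MeasurableSet (Set.univ.pi fun _ : Γ.Vertex => Set.Ico (0 : ℝ) 1) :=
    MeasurableSet.univ_pi fun _ => measurableSet_Ico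
  have hUv : volume (Set.univ.pi fun _ : Γ.Vertex => Set.Ico (0 : ℝ) 1) = 1 := by
    rw [volume_pi_pi]; simp
  -- From `D p = (D / ℓ) (ℓ p)`: the factor `3 + 2 ℓ / D` of `torusWalk_le` becomes `3 D / ℓ + 2`.
  set C := 2 * Real.exp (2 * T) * (3 * K₀ + 2) with hC
  have hbound : ∀ᶠ M in atTop, ∀ (w : ℕ), 1 ≤ w → (w : ℝ) ≤ T * L M →
      ∀ x y : Fin 1 → ZMod (D M),
        (D M : ℝ) * (blockWalk 1 (D M) (lam M) ^ w) x y ≤ C * (√((w : ℝ) / L M))⁻¹ := by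
    filter_upwards [hs.tendsto_time.eventually_gt_atTop 0, hs.tendsto_length.eventually_ge_atTop 1,
      hD] with M hL hl hD w hw hwT x y
    have h1 := mul_blockWalk_one_pow_le (hs.mem M) (D := D M) hL hl hw hwT x y
    have hl0 : 0 < √(lam M * L M) := by linarith
    have hD0 : (0 : ℝ) < D M := by exact_mod_cast NeZero.pos (D M)
    have h2 : Real.exp (-(|((x 0 - y 0).valMinAbs : ℝ)| / √(lam M * L M))) ≤ 1 :=
      Real.exp_le_one_iff.2 (neg_nonpos.2 (by positivity))
    set l := √(lam M * L M)
    calc (D M : ℝ) * (blockWalk 1 (D M) (lam M) ^ w) x y =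
          (D M / l) * (l * (blockWalk 1 (D M) (lam M) ^ w) x y) := by field_simp
      _ ≤ (D M / l) * (2 * Real.exp (2 * T) * (3 + 2 * (l / D M)) * 1 * (√((w : ℝ) / L M))⁻¹) := by
          refine mul_le_mul_of_nonneg_left (h1.trans ?_) (by positivity)
          gcongr
      _ = 2 * Real.exp (2 * T) * (3 * (D M / l) + 2) * (√((w : ℝ) / L M))⁻¹ := by
          field_simp
      _ ≤ C * (√((w : ℝ) / L M))⁻¹ := by
          rw [hC]
          gcongr
  have hK₀ : 0 ≤ K₀ := by
    obtain ⟨M, hM⟩ := hD.exists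
    exact le_trans (by positivity) hM
  have hC0 : 0 ≤ C := by positivity
  have key := tendsto_sum_labels (ι := Γ.Vertex) hc hs.tendsto_time (ρ := fun M => (D M : ℝ))
    (Eventually.of_forall fun M => by exact_mod_cast NeZero.pos (D M)) ht hn he hT0.le hT
    (J := fun M => Finset.univ.image fun (x : Γ.Vertex → Fin 1 → ZMod (D M)) v =>
      ((x v 0).val : ℤ)) hUm
    (fun y hy => Eventually.of_forall fun M => (floorPoint_mem_box y).2 hy)
    (fun y hy => Eventually.of_forall fun M h => hy ((floorPoint_mem_box y).1 h))
    (g := fun M z w => (D M : ℝ) ^ Γ.numEdges *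
      Γ.blockWeight (d := 1) (D := D M) (lam M) (fun v _ => (z v : ZMod (D M))) w)
    (b := (Set.univ.pi fun _ : Γ.Vertex => Set.Ico (0 : ℝ) 1).indicator
      fun _ => C ^ Γ.numEdges)
    (fun y => Set.indicator_nonneg (fun _ _ => pow_nonneg hC0 _) y)
    ((integrable_indicator_iff hUm).2 (integrableOn_const (by rw [hUv]; exact ENNReal.one_ne_top)))
    (G := fun y a => ∏ e, K (y (Γ.src e) - y (Γ.tgt e)) (a e)) ?_ ?_
  · refine ⟨setIntegral_setIntegral_region_pos ht hUm (by rw [hUv]; exact one_pos) key.1.1 key.1.2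
      (fun y a ha => Finset.prod_nonneg fun e _ => hK0 _ _ (ha e))
      fun y a ha => Finset.prod_pos fun e _ => hKpos _ _ (ha e), ?_⟩
    refine key.2.congr fun M => ?_
    rw [Finset.sum_image]
    · congr 2
      refine Finset.sum_congr rfl fun x _ => ?_
      have : (fun v (_ : Fin 1) => (((x v 0).val : ℤ) : ZMod (D M))) = x := by
        ext v i
        rw [Subsingleton.elim i 0]
        simp
      rw [this]
    · intro x _ x' _ hxx
      ext v i
      rw [Subsingleton.elim i 0]
      have := congrFun hxx v
      simp only [Nat.cast_inj] at this
      exact ZMod.val_injective _ this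
  · filter_upwards [hbound] with M hM y hy w hw hwT
    rw [Set.indicator_of_mem ((floorPoint_mem_box y).1 hy), blockWeight]
    have e1 : ∀ f : Γ.Edge → ℝ, (D M : ℝ) ^ Γ.numEdges * ∏ e, f e = ∏ e, (D M : ℝ) * f e := by
      intro f
      rw [Finset.prod_mul_distrib, Finset.prod_const, Finset.card_univ, Fintype.card_fin]
    rw [e1]
    exact abs_prod_le (fun e => mul_nonneg (Nat.cast_nonneg _)
      (blockWalk_pow_nonneg (hs.mem M) _ _ _)) fun e => hM _ (hw e) (hwT e) _ _
  · intro y hy a ha w hw1 hw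
    have e1 : ∀ M, (D M : ℝ) ^ Γ.numEdges * Γ.blockWeight (d := 1) (D := D M) (lam M)
        (fun v _ => (floorPoint (D M : ℝ) y v : ZMod (D M))) (w M) = ∏ e, (D M : ℝ) *
          torusWalk (lam M) (D M) (w M e)
            (⌊(D M : ℝ) * y (Γ.src e)⌋ - ⌊(D M : ℝ) * y (Γ.tgt e)⌋) := by
      intro M
      rw [Finset.prod_mul_distrib, Finset.prod_const, Finset.card_univ, Fintype.card_fin,
        blockWeight]
      congr 1
      refine Finset.prod_congr rfl fun e _ => ?_
      refine blockWalk_one_pow_apply _ ?_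
      simp only [floorPoint, Int.cast_sub]
    simp_rw [e1]
    exact tendsto_finsetProd _ fun e _ => hK _ _ (hy _ trivial) (hy _ trivial) _ (ha e) _
      (fun M => hw1 M e) (hw e)

end Circle

end RibbonGraph

/-! ### Positivity and scaling of the limit kernels -/

section Kernels

theorem gaussDensity_nonneg (y : ℝ) {a : ℝ} (ha : 0 ≤ a) : 0 ≤ gaussDensity y a :=
  mul_nonneg (Real.rpow_nonneg ha _) (ProbabilityTheory.gaussianPDFReal_nonneg _ _ _)

theorem gaussDensity_pos (y : ℝ) {a : ℝ} (ha : 0 < a) : 0 < gaussDensity y a := by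
  rw [gaussDensity_eq ha]
  positivity

theorem gaussDensity_scale {a c : ℝ} (ha : 0 < a) (hc : 0 < c) (y : ℝ) :
    c⁻¹ * gaussDensity (y * c⁻¹) a = gaussDensity y (a * c ^ 2) := by
  rw [gaussDensity_eq ha, gaussDensity_eq (by positivity), ← mul_assoc, ← mul_inv]
  have e1 : 2 * Real.pi * (a * c ^ 2) = c ^ 2 * (2 * Real.pi * a) := by ring
  rw [e1, Real.sqrt_mul (sq_nonneg c) (2 * Real.pi * a), Real.sqrt_sq hc.le]
  congr 2
  field_simp

theorem summable_gaussDensity_int (y : ℝ) {a : ℝ} (ha : 0 < a) :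
    Summable fun k : ℤ => gaussDensity (y + k) a := by
  refine Summable.of_nonneg_of_le (fun k => gaussDensity_nonneg _ ha.le) (fun k => ?_)
    ((summable_exp_neg_abs_int one_pos).mul_left ((√(2 * Real.pi * a))⁻¹ * Real.exp (a / 2 + |y|)))
  rw [gaussDensity_eq ha, mul_assoc _ (Real.exp _) (Real.exp _), ← Real.exp_add]
  refine mul_le_mul_of_nonneg_left (Real.exp_le_exp.2 ?_) (by positivity)
  have h1 : |(k : ℝ)| ≤ |y + k| + |y| := by
    have := abs_sub (y + k) y
    rwa [add_sub_cancel_left] at this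
  have h2 : |y + k| - a / 2 ≤ (y + k) ^ 2 / (2 * a) := by
    rw [le_div_iff₀ (by positivity), ← sq_abs (y + k)]
    nlinarith [sq_nonneg (|y + k| - a)]
  rw [neg_div]
  linarith

theorem theta_nonneg (y : ℝ) {a : ℝ} (ha : 0 ≤ a) : 0 ≤ theta y a :=
  tsum_nonneg fun _ => gaussDensity_nonneg _ ha

theorem theta_pos (y : ℝ) {a : ℝ} (ha : 0 < a) : 0 < theta y a :=
  (summable_gaussDensity_int y ha).tsum_pos (fun _ => gaussDensity_nonneg _ ha.le) 0
    (gaussDensity_pos _ ha)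

end Kernels

/-! ### Scaling assumptions, and the supercritical and critical cases -/

section Scales

theorem tendsto_div_of_isEquivalent {u L : ℕ → ℝ} {t : ℝ} (ht : t ≠ 0)
    (hL : ∀ᶠ M in atTop, 0 < L M) (h : u ~[atTop] fun M => t * L M) :
    Tendsto (fun M => u M / L M) atTop (𝓝 t) := by
  have h1 : ∀ᶠ M in atTop, t * L M ≠ 0 := hL.mono fun M hM => mul_ne_zero ht hM.ne'
  have h2 := ((isEquivalent_iff_tendsto_one h1).1 h).const_mul t
  rw [mul_one] at h2
  refine h2.congr' ?_
  filter_upwards [hL] with M hM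
  simp only [Pi.div_apply]
  field_simp

/-- Since `L` is at least of order `M ^ (1/3)`, the hypothesis on `M ^ (1/3) λ` forces `λ L → ∞`. As
`n` and `L` are comparable, the holding condition carries over from one to the other. -/
theorem diffusiveScale_of_le {lam L : ℕ → ℝ} (hlam : ∀ M, lam M ∈ Set.Ico (0 : ℝ) 1)
    (hlim : Tendsto (fun M : ℕ => (M : ℝ) ^ (1 / 3 : ℝ) * lam M) atTop atTop) {c : ℝ} (hc : 0 < c)
    (hcL : ∀ᶠ M : ℕ in atTop, c * (M : ℝ) ^ (1 / 3 : ℝ) ≤ L M) {n : ℕ → ℕ} {t : ℝ} (ht : 0 < t)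
    (hn : Tendsto (fun M => (n M : ℝ) / L M) atTop (𝓝 t))
    (hhold : Tendsto (fun M => (n M : ℝ) * (1 - lam M)) atTop atTop) : DiffusiveScale lam L := by
  have hcube : Tendsto (fun M : ℕ => (M : ℝ) ^ (1 / 3 : ℝ)) atTop atTop :=
    (tendsto_rpow_atTop (by norm_num)).comp tendsto_natCast_atTop_atTop
  have hL : Tendsto L atTop atTop := tendsto_atTop_mono' _ hcL (hcube.const_mul_atTop hc)
  refine ⟨hlam, hL, ?_, ?_⟩
  · refine Real.tendsto_sqrt_atTop.comp (tendsto_atTop_mono' _ ?_ (hlim.const_mul_atTop hc))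
    filter_upwards [hcL] with M hM
    nlinarith [(hlam M).1]
  · refine (hhold.atTop_mul_pos (inv_pos.2 ht) (hn.inv₀ ht.ne')).congr' ?_
    filter_upwards [hL.eventually_gt_atTop 0, hn.eventually (lt_mem_nhds ht)] with M hM hM2
    have : (n M : ℝ) ≠ 0 := fun h => by simp [h] at hM2
    field_simp

end Scales

namespace RibbonGraph

variable {s : ℕ} {Γ : RibbonGraph s}

/-- Common to the supercritical and critical cases. With kernels normalised by `D`, the prefactor is
`N ^ (|V| - |E|)`; as `3 (|E| - |V|) = |E| - s`, its product with `L ^ (|E| - s)` is `(L / N ^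
(1/3)) ^ (|E| - s)`, which tends to a power of `c ^ 3`. -/
theorem circle_isEquivalent (hΓ : Γ.IsTypical) (hE : 1 ≤ Γ.numEdges) {D : ℕ → ℕ}
    [∀ M, NeZero (D M)] {lam L N : ℕ → ℝ} (hs : DiffusiveScale lam L)
    (hN : ∀ M, N M = (D M : ℝ) * M) {n : ℕ → Fin s → ℕ} {t : Fin s → ℝ}
    (he : ∀ M, Even (∑ i, n M i)) (ht : ∀ i, 0 < t i)
    (hn : ∀ i, Tendsto (fun M => (n M i : ℝ) / L M) atTop (𝓝 (t i))) {c : ℝ} (hc0 : 0 < c)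
    (hLN : Tendsto (fun M => L M / N M ^ (1 / 3 : ℝ)) atTop (𝓝 c)) {K₀ : ℝ}
    (hD : ∀ᶠ M in atTop, (D M : ℝ) / √(lam M * L M) ≤ K₀) {K : ℝ → ℝ → ℝ}
    (hK0 : ∀ y a, 0 ≤ a → 0 ≤ K y a) (hKpos : ∀ y a, 0 < a → 0 < K y a)
    (hK : ∀ y y' : ℝ, y ∈ Set.Ico (0 : ℝ) 1 → y' ∈ Set.Ico (0 : ℝ) 1 → ∀ a, 0 < a →
      ∀ w : ℕ → ℕ, (∀ M, 1 ≤ w M) → Tendsto (fun M => (w M : ℝ) / L M) atTop (𝓝 a) →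
        Tendsto (fun M => (D M : ℝ) * torusWalk (lam M) (D M) (w M)
          (⌊(D M : ℝ) * y⌋ - ⌊(D M : ℝ) * y'⌋)) atTop (𝓝 (K (y - y') a))) :
    (fun M => 1 / (∏ i, (n M i : ℝ)) * wegnerF Γ 1 (D M) M (lam M) (n M)) ~[atTop]
      fun _ => (c ^ 3) ^ ((Γ.numEdges : ℤ) - (Fintype.card Γ.Vertex : ℤ)) *
        (Γ.parityConst / (∏ i, t i) *
          ∫ x in Set.univ.pi (fun _ : Γ.Vertex => Set.Ico (0 : ℝ) 1), ∫ a in Γ.region t,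
            ∏ e, K (x (Γ.src e) - x (Γ.tgt e)) (a e)) := by
  obtain ⟨hI, h1⟩ := tendsto_sum_circle hΓ.connected hs ht hn he hD hK0 hKpos hK
  have hprod : 0 < ∏ i, t i := Finset.prod_pos fun i _ => ht i
  have hpc := Γ.parityConst_pos
  refine (isEquivalent_const_iff_tendsto (by positivity)).2 ?_
  have h3 : Tendsto (fun M => ∏ i, ((n M i : ℝ) / L M)) atTop (𝓝 (∏ i, t i)) :=
    tendsto_finsetProd _ fun i _ => hn i
  have h4 := (((hLN.pow Γ.numEdges).mul ((hLN.pow s).inv₀ (pow_pos hc0 _).ne')).mul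
    (h3.inv₀ hprod.ne')).mul h1
  have hV := hΓ.three_mul_card hE
  have hcz : (c ^ 3) ^ ((Γ.numEdges : ℤ) - (Fintype.card Γ.Vertex : ℤ)) =
      c ^ Γ.numEdges * (c ^ s)⁻¹ := by
    rw [zpow_sub₀ (by positivity), zpow_natCast, zpow_natCast, ← pow_mul, ← pow_mul, hV, pow_add,
      div_eq_mul_inv]
    have : c ^ (3 * Γ.numEdges) = c ^ Γ.numEdges * c ^ (2 * Γ.numEdges) := by
      rw [← pow_add]; congr 1; ring
    rw [this]
    field_simp
  rw [hcz]
  rw [show ∀ I : ℝ, c ^ Γ.numEdges * (c ^ s)⁻¹ * (∏ i, t i)⁻¹ * (Γ.parityConst * I) =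
    c ^ Γ.numEdges * (c ^ s)⁻¹ * (Γ.parityConst / (∏ i, t i) * I) from fun I => by ring] at h4
  refine h4.congr' ?_
  filter_upwards [hs.tendsto_time.eventually_gt_atTop 0, eventually_ge_atTop 1] with M hM hM1
  have hM0 : (0 : ℝ) < M := by exact_mod_cast hM1
  have hD0 : (0 : ℝ) < D M := by exact_mod_cast NeZero.pos (D M)
  have hN0 : 0 < N M := by rw [hN]; positivity
  rw [Γ.wegnerF_eq hM1, Finset.prod_div_distrib, Finset.prod_const, Finset.card_univ,
    Fintype.card_fin]
  simp only [← Finset.mul_sum]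
  generalize ∑ x : Γ.Vertex → Fin 1 → ZMod (D M), ∑ q ∈ Γ.solutions (n M),
    Γ.blockWeight (lam M) x q.2 = S
  generalize ∏ i, (n M i : ℝ) = p
  set r := N M ^ (1 / 3 : ℝ) with hr
  have hr0 : 0 < r := Real.rpow_pos_of_pos hN0 _
  have hr3 : (M : ℝ) = r ^ 3 / D M := by
    rw [eq_div_iff hD0.ne', mul_comm, ← hN, hr, ← Real.rpow_natCast, ← Real.rpow_mul hN0.le]
    norm_num
  have e1 : r ^ (3 * Γ.numEdges) = r ^ Γ.numEdges * r ^ (2 * Γ.numEdges) := by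
    rw [← pow_add]; congr 1; ring
  rw [hr3, div_pow, div_pow, div_pow, div_pow, ← pow_mul, ← pow_mul, hV, e1, pow_add]
  rcases eq_or_ne p 0 with h0 | h0
  · simp [h0]
  · field_simp

/-- For `L = N ^ (1/3)` one has `D / ℓ = N ^ (5/6) / W → 0`: the walk equidistributes, every
normalised kernel tends to `1`, and only the volume remains. -/
theorem supercritical_isEquivalent (hs : 1 ≤ s) (hΓ : Γ.IsTypical) (hE : 1 ≤ Γ.numEdges)
    {D : ℕ → ℕ} [∀ M, NeZero (D M)] {lam : ℕ → ℝ} (hlam : ∀ M, lam M ∈ Set.Ico (0 : ℝ) 1)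
    (hlim : Tendsto (fun M : ℕ => (M : ℝ) ^ (1 / 3 : ℝ) * lam M) atTop atTop) {N W : ℕ → ℝ}
    (hN : ∀ M, N M = (D M : ℝ) * M) (hW : ∀ M, W M = √(lam M) * M)
    {n : ℕ → Fin s → ℕ} {t : Fin s → ℝ} (he : ∀ M, Even (∑ i, n M i)) (ht : ∀ i, 0 < t i)
    (hhold : ∀ i, Tendsto (fun M => (n M i : ℝ) * (1 - lam M)) atTop atTop)
    (hWN : (fun M => N M ^ (5 / 6 : ℝ)) =o[atTop] W)
    (hn : ∀ i, (fun M => (n M i : ℝ)) ~[atTop] fun M => t i * N M ^ (1 / 3 : ℝ)) :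
    (fun M => 1 / (∏ i, (n M i : ℝ)) * wegnerF Γ 1 (D M) M (lam M) (n M)) ~[atTop]
      fun _ => Γ.parityConst / (∏ i, t i) * volume.real (Γ.region t) := by
  have hD0 : ∀ M, (1 : ℝ) ≤ D M := fun M => by exact_mod_cast NeZero.pos (D M)
  have hNM : ∀ M : ℕ, (M : ℝ) ≤ N M := fun M => by
    rw [hN]; exact le_mul_of_one_le_left (Nat.cast_nonneg M) (hD0 M)
  have hNpos : ∀ᶠ M : ℕ in atTop, 0 < N M := by
    filter_upwards [eventually_ge_atTop 1] with M hM
    exact lt_of_lt_of_le (by exact_mod_cast hM) (hNM M)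
  have hn' : ∀ i, Tendsto (fun M => (n M i : ℝ) / N M ^ (1 / 3 : ℝ)) atTop (𝓝 (t i)) := fun i =>
    tendsto_div_of_isEquivalent (ht i).ne' (hNpos.mono fun M hM => Real.rpow_pos_of_pos hM _) (hn i)
  have hsc : DiffusiveScale lam fun M => N M ^ (1 / 3 : ℝ) :=
    diffusiveScale_of_le hlam hlim one_pos (Eventually.of_forall fun M => by
      rw [one_mul]; exact Real.rpow_le_rpow (Nat.cast_nonneg M) (hNM M) (by norm_num))
      (ht ⟨0, hs⟩) (hn' ⟨0, hs⟩) (hhold ⟨0, hs⟩)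
  have hratio : Tendsto (fun M => (D M : ℝ) / √(lam M * N M ^ (1 / 3 : ℝ))) atTop (𝓝 0) := by
    refine hWN.tendsto_div_nhds_zero.congr' ?_
    filter_upwards [hNpos, eventually_ge_atTop 1] with M hM hM1
    have hM0 : (0 : ℝ) < M := by exact_mod_cast hM1
    rw [Real.sqrt_mul (hlam M).1, hW, Real.sqrt_eq_rpow (N M ^ _), ← Real.rpow_mul hM.le]
    have e1 : N M ^ (5 / 6 : ℝ) * N M ^ (1 / 3 * (1 / 2) : ℝ) = D M * M := by
      rw [← Real.rpow_add hM, ← hN]; norm_num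
    have hp : N M ^ (1 / 3 * (1 / 2) : ℝ) ≠ 0 := (Real.rpow_pos_of_pos hM _).ne'
    rw [eq_div_of_mul_eq hp e1]
    rcases eq_or_ne √(lam M) 0 with h | h
    · simp [h]
    · field_simp
  have h := circle_isEquivalent hΓ hE hsc hN he ht hn' one_pos (tendsto_const_nhds.congr' ?_)
    (hratio.eventually (ge_mem_nhds one_pos)) (K := fun _ _ => 1) (fun _ _ _ => zero_le_one)
    (fun _ _ _ => one_pos) ?_
  · have hUv : volume.real (Set.univ.pi fun _ : Γ.Vertex => Set.Ico (0 : ℝ) 1) = 1 := by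
      rw [measureReal_def, volume_pi_pi]; simp
    simpa [hUv] using h
  · filter_upwards [hNpos] with M hM
    rw [div_self (Real.rpow_pos_of_pos hM _).ne']
  · intro y y' hy hy' a ha w hw1 hw
    refine tendsto_torusWalk_supercritical hsc (fun M => NeZero.ne _) ha hw1 hw ?_ ?_
    · refine squeeze_zero_norm (fun M => ?_) hratio
      rw [Real.norm_eq_abs, abs_div, abs_of_nonneg (Real.sqrt_nonneg _)]
      refine div_le_div_of_nonneg_right ?_ (Real.sqrt_nonneg _)
      have h0 : ∀ z : ℝ, z ∈ Set.Ico (0 : ℝ) 1 → 0 ≤ ⌊(D M : ℝ) * z⌋ ∧ ⌊(D M : ℝ) * z⌋ < (D M : ℤ) :=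
        fun z hz => ⟨Int.floor_nonneg.2 (mul_nonneg (Nat.cast_nonneg _) hz.1), by
          rw [Int.floor_lt]; push_cast; nlinarith [hz.2, hD0 M]⟩
      have h1 : |⌊(D M : ℝ) * y⌋ - ⌊(D M : ℝ) * y'⌋| ≤ (D M : ℤ) := by
        have := h0 y hy
        have := h0 y' hy'
        rw [abs_le]; constructor <;> omega
      exact_mod_cast h1
    · have h2 : Tendsto (fun M => (D M : ℝ) / √(lam M * N M ^ (1 / 3 : ℝ))) atTop (𝓝[>] 0) := by
        refine tendsto_nhdsWithin_iff.2 ⟨hratio, ?_⟩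
        filter_upwards [hsc.tendsto_length.eventually_gt_atTop 0] with M hM
        exact div_pos (by linarith [hD0 M]) hM
      refine (tendsto_inv_nhdsGT_zero.comp h2).congr fun M => ?_
      rw [Function.comp_apply, inv_div]

/-- For `L = W ^ (2/5)` one has `ℓ = W ^ (6/5) / M`, hence `D / ℓ = N / W ^ (6/5) → γ⁻¹` and `L / N
^ (1/3) → γ ^ (1/3)`. Rescaling the periodised Gaussian to period `1` multiplies the variance by `γ
^ 2`. -/
theorem critical_isEquivalent (hs : 1 ≤ s) (hΓ : Γ.IsTypical) (hE : 1 ≤ Γ.numEdges)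
    {D : ℕ → ℕ} [∀ M, NeZero (D M)] {lam : ℕ → ℝ} (hlam : ∀ M, lam M ∈ Set.Ico (0 : ℝ) 1)
    (hlim : Tendsto (fun M : ℕ => (M : ℝ) ^ (1 / 3 : ℝ) * lam M) atTop atTop) {N W : ℕ → ℝ}
    (hN : ∀ M, N M = (D M : ℝ) * M) (hW : ∀ M, W M = √(lam M) * M)
    {n : ℕ → Fin s → ℕ} {t : Fin s → ℝ} (he : ∀ M, Even (∑ i, n M i)) (ht : ∀ i, 0 < t i)
    (hhold : ∀ i, Tendsto (fun M => (n M i : ℝ) * (1 - lam M)) atTop atTop) {γ : ℝ} (hγ : 0 < γ)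
    (hWN : W ~[atTop] fun M => (γ * N M) ^ (5 / 6 : ℝ))
    (hn : ∀ i, (fun M => (n M i : ℝ)) ~[atTop] fun M => t i * W M ^ (2 / 5 : ℝ)) :
    (fun M => 1 / (∏ i, (n M i : ℝ)) * wegnerF Γ 1 (D M) M (lam M) (n M)) ~[atTop]
      fun _ => γ ^ ((Γ.numEdges : ℤ) - (Fintype.card Γ.Vertex : ℤ)) *
        (Γ.parityConst / (∏ i, t i) *
          ∫ x in Set.univ.pi (fun _ : Γ.Vertex => Set.Ico (0 : ℝ) 1), ∫ a in Γ.region t,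
            ∏ e, theta (x (Γ.src e) - x (Γ.tgt e)) (a e * γ ^ 2)) := by
  have hD0 : ∀ M, (1 : ℝ) ≤ D M := fun M => by exact_mod_cast NeZero.pos (D M)
  have hNM : ∀ M : ℕ, (M : ℝ) ≤ N M := fun M => by
    rw [hN]; exact le_mul_of_one_le_left (Nat.cast_nonneg M) (hD0 M)
  have hNpos : ∀ᶠ M : ℕ in atTop, 0 < N M := by
    filter_upwards [eventually_ge_atTop 1] with M hM
    exact lt_of_lt_of_le (by exact_mod_cast hM) (hNM M)
  have hW0 : ∀ M, 0 ≤ W M := fun M => by rw [hW]; positivity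
  -- `W / N ^ (5 / 6)` converges
  have hWN' : Tendsto (fun M => W M / N M ^ (5 / 6 : ℝ)) atTop (𝓝 (γ ^ (5 / 6 : ℝ))) := by
    refine tendsto_div_of_isEquivalent (Real.rpow_pos_of_pos hγ _).ne'
      (hNpos.mono fun M hM => Real.rpow_pos_of_pos hM _) (hWN.congr_right ?_)
    filter_upwards [hNpos] with M hM
    rw [Real.mul_rpow hγ.le hM.le]
  have hLN : Tendsto (fun M => W M ^ (2 / 5 : ℝ) / N M ^ (1 / 3 : ℝ)) atTop
      (𝓝 (γ ^ (1 / 3 : ℝ))) := by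
    have h1 := hWN'.rpow_const (p := (2 / 5 : ℝ)) (Or.inr (by norm_num))
    rw [← Real.rpow_mul hγ.le] at h1
    norm_num at h1 ⊢
    refine h1.congr' ?_
    filter_upwards [hNpos] with M hM
    rw [Real.div_rpow (hW0 M) (Real.rpow_nonneg hM.le _), ← Real.rpow_mul hM.le]
    norm_num
  have hc0 : 0 < γ ^ (1 / 3 : ℝ) := Real.rpow_pos_of_pos hγ _
  have hWpos : ∀ᶠ M in atTop, 0 < W M := by
    filter_upwards [hWN'.eventually (lt_mem_nhds (Real.rpow_pos_of_pos hγ _))] with M hM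
    exact (hW0 M).lt_of_ne fun h => by simp [← h] at hM
  have hn' : ∀ i, Tendsto (fun M => (n M i : ℝ) / W M ^ (2 / 5 : ℝ)) atTop (𝓝 (t i)) := fun i =>
    tendsto_div_of_isEquivalent (ht i).ne' (hWpos.mono fun M hM => Real.rpow_pos_of_pos hM _) (hn i)
  have hsc : DiffusiveScale lam fun M => W M ^ (2 / 5 : ℝ) := by
    refine diffusiveScale_of_le hlam hlim (half_pos hc0) ?_ (ht ⟨0, hs⟩) (hn' ⟨0, hs⟩)
      (hhold ⟨0, hs⟩)
    filter_upwards [hLN.eventually (lt_mem_nhds (half_lt_self hc0)), hNpos] with M hM hN0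
    refine le_trans ?_ ((lt_div_iff₀ (Real.rpow_pos_of_pos hN0 _)).1 hM).le
    exact mul_le_mul_of_nonneg_left
      (Real.rpow_le_rpow (Nat.cast_nonneg M) (hNM M) (by norm_num)) (half_pos hc0).le
  have hratio : Tendsto (fun M => (D M : ℝ) / √(lam M * W M ^ (2 / 5 : ℝ))) atTop (𝓝 γ⁻¹) := by
    have h1 := (hLN.pow 3).inv₀ (pow_pos hc0 3).ne'
    rw [← Real.rpow_mul_natCast hγ.le] at h1
    norm_num at h1
    refine h1.congr' ?_
    filter_upwards [hNpos, hWpos, eventually_ge_atTop 1] with M hM hW1 hM1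
    have hM0 : (0 : ℝ) < M := by exact_mod_cast hM1
    have hl : √(lam M * W M ^ (2 / 5 : ℝ)) = (W M ^ (2 / 5 : ℝ)) ^ 3 / M := by
      rw [Real.sqrt_mul (hlam M).1, eq_div_iff hM0.ne', mul_right_comm, ← hW,
        Real.sqrt_eq_rpow, ← Real.rpow_mul hW1.le, ← Real.rpow_mul_natCast hW1.le]
      nth_rewrite 1 [← Real.rpow_one (W M)]
      rw [← Real.rpow_add hW1]
      norm_num
    have hr : (N M ^ (1 / 3 : ℝ)) ^ 3 = D M * M := by
      rw [← Real.rpow_mul_natCast hM.le, ← hN]; norm_num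
    rw [hl, div_pow, inv_div]
    norm_num at hr
    rw [hr]
    field_simp
  have hDinf : Tendsto (fun M => (D M : ℝ)) atTop atTop := by
    refine (hratio.pos_mul_atTop (inv_pos.2 hγ) hsc.tendsto_length).congr' ?_
    filter_upwards [hsc.tendsto_length.eventually_gt_atTop 0] with M hM
    rw [div_mul_cancel₀ _ hM.ne']
  have hc3 : (γ ^ (1 / 3 : ℝ)) ^ 3 = γ := by
    rw [← Real.rpow_mul_natCast hγ.le]; norm_num
  have h := circle_isEquivalent hΓ hE hsc hN he ht hn' hc0 hLN
    (hratio.eventually (ge_mem_nhds (lt_add_one _))) (K := fun y a => theta y (a * γ ^ 2))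
    (fun y a ha => theta_nonneg y (by positivity)) (fun y a ha => theta_pos y (by positivity)) ?_
  · rwa [hc3] at h
  · intro y y' _ _ a ha w hw1 hw
    have hz : Tendsto (fun M => ((⌊(D M : ℝ) * y⌋ - ⌊(D M : ℝ) * y'⌋ : ℤ) : ℝ) /
        √(lam M * W M ^ (2 / 5 : ℝ))) atTop (𝓝 ((y - y') * γ⁻¹)) := by
      have h1 := (tendsto_floorPoint_div hDinf (fun _ : Unit => y) ()).sub
        (tendsto_floorPoint_div hDinf (fun _ : Unit => y') ())
      refine (h1.mul hratio).congr fun M => ?_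
      have : (D M : ℝ) ≠ 0 := by linarith [hD0 M]
      simp only [floorPoint]
      push_cast
      field_simp
    have h2 := hratio.mul (tendsto_torusWalk_critical hsc ha (inv_pos.2 hγ) hw1 hw hz hratio)
    have e : γ⁻¹ * ∑' m : ℤ, gaussDensity ((y - y') * γ⁻¹ + m * γ⁻¹) a =
        theta (y - y') (a * γ ^ 2) := by
      rw [theta, ← tsum_mul_left]
      refine tsum_congr fun m => ?_
      rw [← add_mul, gaussDensity_scale ha hγ]
    rw [e] at h2
    refine h2.congr' ?_
    filter_upwards [hsc.tendsto_length.eventually_gt_atTop 0] with M hM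
    field_simp

end RibbonGraph

namespace RibbonGraph

variable {s : ℕ} {Γ : RibbonGraph s}

/-! ### Long cycles: distances, pinned labels and the subcritical case -/

section Distance

/-- The number of edges used to join the vertices is chosen before the pseudometric `δ`, so it
serves all labellings of all cycles at once. -/
theorem Connected.exists_dist_le (hc : Γ.Connected) (u v : Γ.Vertex) :
    ∃ k : ℕ, ∀ (δ : Γ.Vertex → Γ.Vertex → ℝ) (m : ℝ), (∀ x, δ x x = 0) →
      (∀ x y, δ x y = δ y x) → (∀ x y z, δ x z ≤ δ x y + δ y z) →
      (∀ e, δ (Γ.src e) (Γ.tgt e) ≤ m) → δ u v ≤ k * m := by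
  induction hc u v with
  | rel x y h =>
    obtain ⟨e, rfl, rfl⟩ := h
    exact ⟨1, fun δ m _ _ _ h => by simpa using h e⟩
  | refl x => exact ⟨0, fun δ m h _ _ _ => by simp [h x]⟩
  | symm x y _ ih =>
    obtain ⟨k, hk⟩ := ih
    exact ⟨k, fun δ m h0 h1 h2 h3 => h1 y x ▸ hk δ m h0 h1 h2 h3⟩
  | trans x y z _ _ ih₁ ih₂ =>
    obtain ⟨k, hk⟩ := ih₁
    obtain ⟨l, hl⟩ := ih₂
    refine ⟨k + l, fun δ m h0 h1 h2 h3 => (h2 x y z).trans ?_⟩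
    have := hk δ m h0 h1 h2 h3
    have := hl δ m h0 h1 h2 h3
    push_cast
    linarith

/-- A uniform lower bound for the total length of the edges. -/
theorem Connected.exists_mul_sum_dist_le (hc : Γ.Connected) (v₀ : Γ.Vertex) :
    ∃ c : ℝ, 0 < c ∧ ∀ δ : Γ.Vertex → Γ.Vertex → ℝ, (∀ x y, 0 ≤ δ x y) → (∀ x, δ x x = 0) →
      (∀ x y, δ x y = δ y x) → (∀ x y z, δ x z ≤ δ x y + δ y z) →
      c * ∑ v : {v : Γ.Vertex // v ≠ v₀}, δ v v₀ ≤ ∑ e, δ (Γ.src e) (Γ.tgt e) := by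
  choose k hk using fun v => hc.exists_dist_le v v₀
  set K : ℝ := ∑ v : {v : Γ.Vertex // v ≠ v₀}, (k v : ℝ) with hK
  have hK0 : 0 ≤ K := Finset.sum_nonneg fun _ _ => Nat.cast_nonneg _
  refine ⟨(K + 1)⁻¹, by positivity, fun δ hp h0 h1 h2 => ?_⟩
  rw [inv_mul_le_iff₀ (by positivity)]
  have hS : 0 ≤ ∑ e, δ (Γ.src e) (Γ.tgt e) := Finset.sum_nonneg fun e _ => hp _ _
  calc ∑ v : {v : Γ.Vertex // v ≠ v₀}, δ v v₀
      ≤ ∑ v : {v : Γ.Vertex // v ≠ v₀}, (k v : ℝ) * ∑ e, δ (Γ.src e) (Γ.tgt e) :=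
        Finset.sum_le_sum fun v _ => hk v δ _ h0 h1 h2 fun e =>
          Finset.single_le_sum (f := fun e => δ (Γ.src e) (Γ.tgt e)) (fun e _ => hp _ _)
            (Finset.mem_univ e)
    _ = K * ∑ e, δ (Γ.src e) (Γ.tgt e) := by rw [← Finset.sum_mul]
    _ ≤ _ := by linarith

theorem abs_valMinAbs_sub_triangle {D : ℕ} (a b c : ZMod D) :
    |((a - c).valMinAbs : ℝ)| ≤ |((a - b).valMinAbs : ℝ)| + |((b - c).valMinAbs : ℝ)| := by
  have h1 := (ZMod.natAbs_valMinAbs_add_le (a - b) (b - c)).trans (Int.natAbs_add_le _ _)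
  rw [sub_add_sub_cancel] at h1
  simp only [← Int.cast_abs, Int.abs_eq_natAbs]
  exact_mod_cast h1

theorem abs_valMinAbs_sub_comm {D : ℕ} (a b : ZMod D) :
    |((a - b).valMinAbs : ℝ)| = |((b - a).valMinAbs : ℝ)| := by
  have h1 := ZMod.natAbs_valMinAbs_neg (a - b)
  rw [neg_sub] at h1
  simp only [← Int.cast_abs, Int.abs_eq_natAbs, h1]

end Distance

section Pinned

/-- Extension of a family of labels by the value `0` at `v₀`. -/
def pinLabel {A : Type*} [Zero A] (v₀ : Γ.Vertex) (x : {v : Γ.Vertex // v ≠ v₀} → A)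
    (v : Γ.Vertex) : A :=
  if h : v = v₀ then 0 else x ⟨v, h⟩

@[simp]
theorem pinLabel_self {A : Type*} [Zero A] (v₀ : Γ.Vertex) (x : {v : Γ.Vertex // v ≠ v₀} → A) :
    pinLabel v₀ x v₀ = 0 := dif_pos rfl

@[simp]
theorem pinLabel_coe {A : Type*} [Zero A] (v₀ : Γ.Vertex) (x : {v : Γ.Vertex // v ≠ v₀} → A)
    (v : {v : Γ.Vertex // v ≠ v₀}) : pinLabel v₀ x v = x v := dif_neg v.2

theorem map_pinLabel {A B : Type*} [Zero A] [Zero B] {f : A → B} (hf : f 0 = 0) (v₀ : Γ.Vertex)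
    (x : {v : Γ.Vertex // v ≠ v₀} → A) (v : Γ.Vertex) :
    f (pinLabel v₀ x v) = pinLabel v₀ (fun u => f (x u)) v := by
  unfold pinLabel
  split_ifs <;> simp [hf]

/-- Labels on a cycle, in terms of the label of `v₀` and the others relative to it. -/
def pinEquiv (D : ℕ) (v₀ : Γ.Vertex) :
    ZMod D × ({v : Γ.Vertex // v ≠ v₀} → ZMod D) ≃ (Γ.Vertex → Fin 1 → ZMod D) where
  toFun p v _ := p.1 + pinLabel v₀ p.2 v
  invFun x := (x v₀ 0, fun v => x v 0 - x v₀ 0)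
  left_inv p := by
    ext
    · simp
    · simp
  right_inv x := by
    ext v i
    rw [Subsingleton.elim i 0]
    by_cases h : v = v₀
    · subst h; simp
    · simp [pinLabel, h]

/-- The kernels depend on differences of labels only, so the label of `v₀` contributes a free factor
`D`. -/
theorem sum_blockWeight_eq_pinned {D : ℕ} [NeZero D] (lam : ℝ) (v₀ : Γ.Vertex) (n : Fin s → ℕ) :
    ∑ x : Γ.Vertex → Fin 1 → ZMod D, ∑ q ∈ Γ.solutions n, Γ.blockWeight lam x q.2 =
      D * ∑ x : {v : Γ.Vertex // v ≠ v₀} → ZMod D, ∑ q ∈ Γ.solutions n,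
        Γ.blockWeight lam (fun v (_ : Fin 1) => pinLabel v₀ x v) q.2 := by
  rw [← (pinEquiv D v₀).sum_comp, Fintype.sum_prod_type]
  have h : ∀ (c : ZMod D) (x : {v : Γ.Vertex // v ≠ v₀} → ZMod D) (w : Γ.Edge → ℕ),
      Γ.blockWeight lam (pinEquiv D v₀ (c, x)) w =
        Γ.blockWeight lam (fun v (_ : Fin 1) => pinLabel v₀ x v) w := by
    intro c x w
    refine Finset.prod_congr rfl fun e _ => ?_
    have hz : ((pinLabel v₀ x (Γ.src e) - pinLabel v₀ x (Γ.tgt e)).valMinAbs : ZMod D) =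
      pinLabel v₀ x (Γ.src e) - pinLabel v₀ x (Γ.tgt e) := ZMod.coe_valMinAbs _
    rw [blockWalk_one_pow_apply (w e) (hz.trans (by simp [pinEquiv])),
      blockWalk_one_pow_apply (w e) hz]
  simp only [h, Finset.sum_const, Finset.card_univ, ZMod.card, nsmul_eq_mul]

end Pinned

section Line

variable {L lam : ℕ → ℝ}

theorem mem_image_valMinAbs {ι : Type*} {D : ℕ} [Fintype (ι → ZMod D)]
    [DecidableEq (ι → ℤ)] {z : ι → ℤ} :
    z ∈ (Finset.univ.image fun (x : ι → ZMod D) v => (x v).valMinAbs) ↔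
      ∀ v, ((z v : ZMod D)).valMinAbs = z v := by
  simp only [Finset.mem_image, Finset.mem_univ, true_and]
  constructor
  · rintro ⟨x, rfl⟩ v
    rw [ZMod.coe_valMinAbs]
  · exact fun h => ⟨fun v => (z v : ZMod D), funext h⟩

theorem exp_neg_floor_le {l c : ℝ} (hl : 1 ≤ l) (hc : 0 < c) (y : ℝ) :
    Real.exp (-(c * (|(⌊l * y⌋ : ℝ)| / l))) ≤ Real.exp c * Real.exp (-(c * |y|)) := by
  rw [← Real.exp_add, Real.exp_le_exp]
  have hl0 : 0 < l := by linarith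
  have h1 : |y| ≤ |(⌊l * y⌋ : ℝ)| / l + 1 := by
    rw [← sub_le_iff_le_add, le_div_iff₀ hl0]
    have h2 : |l * y| ≤ |(⌊l * y⌋ : ℝ)| + 1 := by
      have h3 : |l * y - ⌊l * y⌋| ≤ 1 := by
        rw [abs_le]
        constructor <;> linarith [Int.floor_le (l * y), Int.lt_floor_add_one (l * y)]
      have h4 := abs_sub_abs_le_abs_sub (l * y) ⌊l * y⌋
      linarith
    rw [abs_mul, abs_of_pos hl0] at h2
    linarith
  nlinarith

theorem pow_mul_prod_edges (r : ℝ) (f : Γ.Edge → ℝ) :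
    r ^ Γ.numEdges * ∏ e, f e = ∏ e, r * f e := by
  rw [Finset.prod_mul_distrib, Finset.prod_const, Finset.card_univ, Fintype.card_fin]

/-- The product of the edge decays is `exp (-total edge length / ℓ)`, with lengths measured on the
cycle. By `hc` the total length dominates a multiple of the sum of the distances to `v₀`, which
yields decay in every pinned label although the diagram has edges only between some pairs of
vertices. -/
theorem abs_mul_blockWeight_pinned_le {v₀ : Γ.Vertex} {c : ℝ}
    (hc : ∀ δ : Γ.Vertex → Γ.Vertex → ℝ, (∀ x y, 0 ≤ δ x y) → (∀ x, δ x x = 0) →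
      (∀ x y, δ x y = δ y x) → (∀ x y z, δ x z ≤ δ x y + δ y z) →
      c * ∑ v : {v : Γ.Vertex // v ≠ v₀}, δ v v₀ ≤ ∑ e, δ (Γ.src e) (Γ.tgt e))
    {lam L T : ℝ} (h : lam ∈ Set.Ico (0 : ℝ) 1) {D : ℕ} [NeZero D] (hL : 0 < L)
    (hl : 1 ≤ √(lam * L)) (hlD : √(lam * L) / D ≤ 1) {w : Γ.Edge → ℕ} (hw : ∀ e, 1 ≤ w e)
    (hwT : ∀ e, (w e : ℝ) ≤ T * L) {z : {v : Γ.Vertex // v ≠ v₀} → ℤ}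
    (hz : ∀ v, ((z v : ZMod D)).valMinAbs = z v) :
    |√(lam * L) ^ Γ.numEdges * Γ.blockWeight (d := 1) (D := D) lam
        (fun v _ => pinLabel v₀ (fun u => (z u : ZMod D)) v) w| ≤
      (2 * Real.exp (2 * T) * 5) ^ Γ.numEdges *
        Real.exp (-∑ v, c * (|(z v : ℝ)| / √(lam * L))) * ∏ e, (√((w e : ℝ) / L))⁻¹ := by
  generalize hldef : √(lam * L) = l at *
  have hl0 : 0 < l := by linarith
  generalize hX : pinLabel v₀ (fun u => (z u : ZMod D)) = X
  have hδ := hc (fun u v => |((X u - X v).valMinAbs : ℝ)|) (fun _ _ => abs_nonneg _)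
    (fun x => by simp) (fun x y => abs_valMinAbs_sub_comm _ _)
    fun x y z => abs_valMinAbs_sub_triangle _ _ _
  have hδ0 : ∀ v : {v : Γ.Vertex // v ≠ v₀}, |((X v - X v₀).valMinAbs : ℝ)| = |(z v : ℝ)| := by
    intro v
    rw [← hX, pinLabel_self, pinLabel_coe, sub_zero, hz v]
  simp only [hδ0] at hδ
  have hfac : ∀ e, l * (blockWalk 1 D lam ^ w e) (fun _ => X (Γ.src e))
      (fun _ => X (Γ.tgt e)) ≤ 2 * Real.exp (2 * T) * 5 *
        (Real.exp (-(|((X (Γ.src e) - X (Γ.tgt e)).valMinAbs : ℝ)| / l)) *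
          (√((w e : ℝ) / L))⁻¹) := by
    intro e
    have h1 := mul_blockWalk_one_pow_le h (D := D) hL (hldef.symm ▸ hl) (hw e) (hwT e)
      (fun _ => X (Γ.src e)) (fun _ => X (Γ.tgt e))
    rw [hldef] at h1
    refine h1.trans ?_
    rw [mul_assoc]
    have : 3 + 2 * (l / D) ≤ 5 := by linarith
    gcongr
  have hmain := abs_prod_le (fun e => mul_nonneg hl0.le (blockWalk_pow_nonneg h (w e) _ _)) hfac
  rw [blockWeight, pow_mul_prod_edges]
  refine hmain.trans ?_
  rw [Finset.prod_mul_distrib, ← mul_assoc]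
  refine mul_le_mul_of_nonneg_right (mul_le_mul_of_nonneg_left ?_ (by positivity)) (by positivity)
  rw [← Real.exp_sum, Real.exp_le_exp, Finset.sum_neg_distrib, neg_le_neg_iff,
    ← Finset.mul_sum, ← Finset.sum_div, ← Finset.sum_div, ← mul_div_assoc]
  exact div_le_div_of_nonneg_right hδ hl0.le

open Classical in
/-- The diagram sums on a cycle which is long on the diffusive scale. -/
theorem tendsto_sum_line (hc : Γ.Connected) (hs : DiffusiveScale lam L) {D : ℕ → ℕ}
    [∀ M, NeZero (D M)] {n : ℕ → Fin s → ℕ} {t : Fin s → ℝ} (ht : ∀ i, 0 < t i)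
    (hn : ∀ i, Tendsto (fun M => (n M i : ℝ) / L M) atTop (𝓝 (t i)))
    (he : ∀ M, Even (∑ i, n M i))
    (hD : Tendsto (fun M => (D M : ℝ) / √(lam M * L M)) atTop atTop) (v₀ : Γ.Vertex) :
    0 < ∫ x : {v : Γ.Vertex // v ≠ v₀} → ℝ, ∫ a in Γ.region t,
        ∏ e, gaussDensity (Γ.pin v₀ x (Γ.src e) - Γ.pin v₀ x (Γ.tgt e)) (a e) ∧
      Tendsto (fun M => (L M ^ Γ.numEdges)⁻¹ *
          ((√(lam M * L M) ^ Fintype.card {v : Γ.Vertex // v ≠ v₀})⁻¹ *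
          ∑ x : {v : Γ.Vertex // v ≠ v₀} → ZMod (D M), ∑ q ∈ Γ.solutions (n M),
            √(lam M * L M) ^ Γ.numEdges *
              Γ.blockWeight (lam M) (fun v (_ : Fin 1) => pinLabel v₀ x v) q.2)) atTop
        (𝓝 (Γ.parityConst * ∫ x : {v : Γ.Vertex // v ≠ v₀} → ℝ, ∫ a in Γ.region t,
          ∏ e, gaussDensity (Γ.pin v₀ x (Γ.src e) - Γ.pin v₀ x (Γ.tgt e)) (a e))) := by
  obtain ⟨T, hT0, hT⟩ : ∃ T, 0 < T ∧ ∀ i, t i < T :=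
    ⟨∑ i, t i + 1, by have := Finset.sum_nonneg fun i (_ : i ∈ Finset.univ) => (ht i).le; linarith,
      fun i => (Finset.single_le_sum (f := t) (fun j _ => (ht j).le)
        (Finset.mem_univ i)).trans_lt (lt_add_one _)⟩
  obtain ⟨c, hc0, hcδ⟩ := hc.exists_mul_sum_dist_le v₀
  set C := 2 * Real.exp (2 * T) * 5 with hC
  have hC0 : 0 ≤ C := by positivity
  have key := tendsto_sum_labels (ι := {v : Γ.Vertex // v ≠ v₀}) hc hs.tendsto_time
    (ρ := fun M => √(lam M * L M)) (hs.tendsto_length.eventually_gt_atTop 0) ht hn he hT0.le hT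
    (J := fun M => Finset.univ.image fun (x : {v : Γ.Vertex // v ≠ v₀} → ZMod (D M)) v =>
      (x v).valMinAbs) (U := Set.univ) MeasurableSet.univ ?_ (fun y hy => absurd trivial hy)
    (g := fun M z w => √(lam M * L M) ^ Γ.numEdges * Γ.blockWeight (d := 1) (D := D M) (lam M)
      (fun v _ => pinLabel v₀ (fun u => (z u : ZMod (D M))) v) w)
    (b := fun y => C ^ Γ.numEdges * ∏ v, (Real.exp c * Real.exp (-(c * |y v|))))
    (fun y => by positivity)
    ((Integrable.fintype_prod fun v =>
      (integrable_exp_neg_mul_abs hc0).const_mul (Real.exp c)).const_mul _)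
    (G := fun y a => ∏ e, gaussDensity (Γ.pin v₀ y (Γ.src e) - Γ.pin v₀ y (Γ.tgt e)) (a e)) ?_ ?_
  · have hpos := setIntegral_setIntegral_region_pos ht MeasurableSet.univ
      (Measure.measure_univ_pos.2 (NeZero.ne _)) key.1.1 key.1.2
      (fun y a ha => Finset.prod_nonneg fun e _ => gaussDensity_nonneg _ (ha e))
      fun y a ha => Finset.prod_pos fun e _ => gaussDensity_pos _ (ha e)
    have hlim := key.2
    rw [Measure.restrict_univ] at hpos hlim
    refine ⟨hpos, hlim.congr fun M => ?_⟩
    rw [Finset.sum_image]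
    · simp only [ZMod.coe_valMinAbs]
    · intro x _ x' _ hxx
      ext v
      exact ZMod.injective_valMinAbs (congrFun hxx v)
  -- Every fixed position on the scale `ℓ` is eventually shorter than half the cycle, hence is its
  -- own representative of least absolute value.
  · intro y _
    have h1 : ∀ v, ∀ᶠ M in atTop,
        |(⌊√(lam M * L M) * y v⌋ : ℝ)| / √(lam M * L M) * 2 < D M / √(lam M * L M) := by
      intro v
      have h2 := ((tendsto_floorPoint_div hs.tendsto_length y v).abs.mul_const 2).eventually
        (gt_mem_nhds (lt_add_one _))
      filter_upwards [h2, hD.eventually_ge_atTop (|y v| * 2 + 1),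
        hs.tendsto_length.eventually_gt_atTop 0] with M hM hM2 hl
      rw [abs_div, abs_of_pos hl] at hM
      exact lt_of_lt_of_le hM hM2
    filter_upwards [eventually_all.2 h1, hs.tendsto_length.eventually_gt_atTop 0] with M hM hl
    rw [mem_image_valMinAbs]
    intro v
    rw [ZMod.valMinAbs_spec]
    refine ⟨rfl, ?_⟩
    have h2 := hM v
    rw [div_mul_eq_mul_div, div_lt_div_iff_of_pos_right hl] at h2
    have h3 : |⌊√(lam M * L M) * y v⌋| * 2 < (D M : ℤ) := by exact_mod_cast h2
    rw [floorPoint]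
    rcases abs_cases ⌊√(lam M * L M) * y v⌋ with h | h <;> constructor <;> omega
  · filter_upwards [hs.tendsto_time.eventually_gt_atTop 0, hs.tendsto_length.eventually_ge_atTop 1,
      hD.eventually_ge_atTop 1] with M hL hl hD y hy w hw hwT
    have hlD : √(lam M * L M) / D M ≤ 1 := by
      have hD0 : (0 : ℝ) < D M := by exact_mod_cast NeZero.pos (D M)
      rw [div_le_one hD0]
      exact (one_le_div (by linarith)).1 hD
    refine (abs_mul_blockWeight_pinned_le hcδ (hs.mem M) hL hl hlD hw hwT
      (mem_image_valMinAbs.1 hy)).trans ?_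
    refine mul_le_mul_of_nonneg_right (mul_le_mul_of_nonneg_left ?_ (by positivity))
      (by positivity)
    rw [← Finset.sum_neg_distrib, Real.exp_sum]
    exact Finset.prod_le_prod (fun v _ => (Real.exp_pos _).le) fun v _ => exp_neg_floor_le hl hc0 _
  · intro y _ a ha w hw1 hw
    simp only [blockWeight, pow_mul_prod_edges]
    refine tendsto_finsetProd _ fun e _ => ?_
    have hz : ∀ v, Tendsto (fun M => ((pinLabel v₀ (floorPoint √(lam M * L M) y) v : ℤ) : ℝ) /
        √(lam M * L M)) atTop (𝓝 (Γ.pin v₀ y v)) := by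
      intro v
      by_cases h : v = v₀
      · simp [pinLabel, pin, h]
      · simp only [pinLabel, pin, h, dif_neg, not_false_eq_true]
        exact tendsto_floorPoint_div hs.tendsto_length y _
    have h1 := tendsto_torusWalk_subcritical hs (ha e) (fun M => hw1 M e) (hw e)
      (z := fun M => pinLabel v₀ (floorPoint √(lam M * L M) y) (Γ.src e) -
        pinLabel v₀ (floorPoint √(lam M * L M) y) (Γ.tgt e))
      (((hz (Γ.src e)).sub (hz (Γ.tgt e))).congr fun M => by push_cast; ring) hD
    refine h1.congr fun M => ?_
    congr 1
    refine (blockWalk_one_pow_apply _ ?_).symm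
    rw [Int.cast_sub, map_pinLabel (f := fun z : ℤ => (z : ZMod (D M))) Int.cast_zero,
      map_pinLabel (f := fun z : ℤ => (z : ZMod (D M))) Int.cast_zero]

/-- For `L = W ^ (2/5)` one has `ℓ = W ^ (6/5) / M`, so `D / ℓ = N W ^ (-6/5) → ∞` and the cycle
looks like a line. The free label gives `D` and the scaling of the others `ℓ ^ (|V| - 1)`; with the
vertex count all powers combine to `D / ℓ`. -/
theorem subcritical_isEquivalent (hs : 1 ≤ s) (hΓ : Γ.IsTypical) (hE : 1 ≤ Γ.numEdges)
    {D : ℕ → ℕ} [∀ M, NeZero (D M)] {lam : ℕ → ℝ} (hlam : ∀ M, lam M ∈ Set.Ico (0 : ℝ) 1)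
    (hlim : Tendsto (fun M : ℕ => (M : ℝ) ^ (1 / 3 : ℝ) * lam M) atTop atTop) {N W : ℕ → ℝ}
    (hN : ∀ M, N M = (D M : ℝ) * M) (hW : ∀ M, W M = √(lam M) * M)
    {n : ℕ → Fin s → ℕ} {t : Fin s → ℝ} (he : ∀ M, Even (∑ i, n M i)) (ht : ∀ i, 0 < t i)
    (hhold : ∀ i, Tendsto (fun M => (n M i : ℝ) * (1 - lam M)) atTop atTop)
    (hWN : W =o[atTop] fun M => N M ^ (5 / 6 : ℝ))
    (hn : ∀ i, (fun M => (n M i : ℝ)) ~[atTop] fun M => t i * W M ^ (2 / 5 : ℝ))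
    (v₀ : Γ.Vertex) :
    (fun M => 1 / (∏ i, (n M i : ℝ)) * wegnerF Γ 1 (D M) M (lam M) (n M)) ~[atTop]
      fun M => N M * W M ^ (-(6 / 5 : ℝ)) * (Γ.parityConst / (∏ i, t i) *
        ∫ x : {v : Γ.Vertex // v ≠ v₀} → ℝ, ∫ a in Γ.region t,
          ∏ e, gaussDensity (Γ.pin v₀ x (Γ.src e) - Γ.pin v₀ x (Γ.tgt e)) (a e)) := by
  have hD0 : ∀ M, (1 : ℝ) ≤ D M := fun M => by exact_mod_cast NeZero.pos (D M)
  have hcube : Tendsto (fun M : ℕ => (M : ℝ) ^ (1 / 3 : ℝ)) atTop atTop :=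
    (tendsto_rpow_atTop (by norm_num)).comp tendsto_natCast_atTop_atTop
  -- Eventually `M ^ (1/3) λ ≥ 1`, so `W ^ 2 = λ M ^ 2 ≥ M ^ (5/3)`; the fifth root gives the bound.
  have hWL : ∀ᶠ M : ℕ in atTop, 1 * (M : ℝ) ^ (1 / 3 : ℝ) ≤ W M ^ (2 / 5 : ℝ) := by
    filter_upwards [hlim.eventually_ge_atTop 1, eventually_ge_atTop 1] with M hM hM1
    have hM0 : (0 : ℝ) < M := by exact_mod_cast hM1
    have h1 : (M : ℝ) ^ (5 / 3 : ℝ) ≤ W M ^ 2 := by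
      rw [hW, mul_pow, Real.sq_sqrt (hlam M).1]
      calc (M : ℝ) ^ (5 / 3 : ℝ) = 1 * (M : ℝ) ^ (5 / 3 : ℝ) := (one_mul _).symm
        _ ≤ ((M : ℝ) ^ (1 / 3 : ℝ) * lam M) * (M : ℝ) ^ (5 / 3 : ℝ) := by gcongr
        _ = lam M * ((M : ℝ) ^ (1 / 3 : ℝ) * (M : ℝ) ^ (5 / 3 : ℝ)) := by ring
        _ = lam M * (M : ℝ) ^ 2 := by rw [← Real.rpow_add hM0]; norm_num
    have hW0 : 0 ≤ W M := by rw [hW]; positivity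
    have h2 := Real.rpow_le_rpow (by positivity) h1 (show (0 : ℝ) ≤ 1 / 5 by norm_num)
    rw [← Real.rpow_mul hM0.le, ← Real.rpow_natCast, ← Real.rpow_mul hW0] at h2
    norm_num at h2 ⊢
    exact h2
  have hLinf : Tendsto (fun M => W M ^ (2 / 5 : ℝ)) atTop atTop :=
    tendsto_atTop_mono' _ hWL (hcube.const_mul_atTop one_pos)
  have hW0 : ∀ M, 0 ≤ W M := fun M => by rw [hW]; positivity
  have hWpos : ∀ᶠ M in atTop, 0 < W M := by
    filter_upwards [hLinf.eventually_gt_atTop 0] with M hM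
    refine (hW0 M).lt_of_ne fun h => ?_
    rw [← h, Real.zero_rpow (by norm_num)] at hM
    exact hM.false
  have hn' : ∀ i, Tendsto (fun M => (n M i : ℝ) / W M ^ (2 / 5 : ℝ)) atTop (𝓝 (t i)) := fun i =>
    tendsto_div_of_isEquivalent (ht i).ne' (hLinf.eventually_gt_atTop 0) (hn i)
  have hsc : DiffusiveScale lam fun M => W M ^ (2 / 5 : ℝ) :=
    diffusiveScale_of_le hlam hlim one_pos hWL (ht ⟨0, hs⟩) (hn' ⟨0, hs⟩) (hhold ⟨0, hs⟩)
  have hlen : ∀ᶠ M : ℕ in atTop, √(lam M * W M ^ (2 / 5 : ℝ)) = (W M ^ (2 / 5 : ℝ)) ^ 3 / M := by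
    filter_upwards [hWpos, eventually_ge_atTop 1] with M hW1 hM1
    have hM0 : (0 : ℝ) < M := by exact_mod_cast hM1
    rw [Real.sqrt_mul (hlam M).1, eq_div_iff hM0.ne', mul_right_comm, ← hW,
      Real.sqrt_eq_rpow, ← Real.rpow_mul hW1.le, ← Real.rpow_mul_natCast hW1.le]
    nth_rewrite 1 [← Real.rpow_one (W M)]
    rw [← Real.rpow_add hW1]
    norm_num
  have hW6 : ∀ᶠ M in atTop, W M ^ (-(6 / 5 : ℝ)) = ((W M ^ (2 / 5 : ℝ)) ^ 3)⁻¹ := by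
    filter_upwards [hWpos] with M hM
    rw [Real.rpow_neg hM.le, ← Real.rpow_mul_natCast hM.le]
    norm_num
  have hDl : Tendsto (fun M => (D M : ℝ) / √(lam M * W M ^ (2 / 5 : ℝ))) atTop atTop := by
    have h1 := hWN.tendsto_div_nhds_zero.rpow_const (p := (6 / 5 : ℝ)) (Or.inr (by norm_num))
    rw [Real.zero_rpow (by norm_num)] at h1
    have hNpos : ∀ᶠ M : ℕ in atTop, 0 < N M := by
      filter_upwards [eventually_ge_atTop 1] with M hM
      have hM0 : (0 : ℝ) < M := by exact_mod_cast hM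
      rw [hN]
      exact mul_pos (by linarith [hD0 M]) hM0
    have h2 : Tendsto (fun M => (W M / N M ^ (5 / 6 : ℝ)) ^ (6 / 5 : ℝ)) atTop (𝓝[>] 0) := by
      refine tendsto_nhdsWithin_iff.2 ⟨h1, ?_⟩
      filter_upwards [hNpos, hWpos] with M hM hM2
      exact Real.rpow_pos_of_pos (div_pos hM2 (Real.rpow_pos_of_pos hM _)) _
    refine (tendsto_inv_nhdsGT_zero.comp h2).congr' ?_
    filter_upwards [hNpos, hWpos, hlen, eventually_ge_atTop 1] with M hM hM2 hl hM1
    have hM0 : (0 : ℝ) < M := by exact_mod_cast hM1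
    rw [Function.comp_apply, hl, Real.div_rpow hM2.le (Real.rpow_nonneg hM.le _),
      ← Real.rpow_mul hM.le, ← Real.rpow_mul_natCast hM2.le, inv_div, div_div_eq_mul_div, ← hN]
    norm_num
  obtain ⟨hI, h1⟩ := tendsto_sum_line hΓ.connected hsc ht hn' he hDl v₀
  have hprod : 0 < ∏ i, t i := Finset.prod_pos fun i _ => ht i
  have hpc := Γ.parityConst_pos
  have h3 : Tendsto (fun M => ∏ i, ((n M i : ℝ) / W M ^ (2 / 5 : ℝ))) atTop (𝓝 (∏ i, t i)) :=
    tendsto_finsetProd _ fun i _ => hn' i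
  have h4 := (h3.inv₀ hprod.ne').mul h1
  rw [show ∀ I : ℝ, (∏ i, t i)⁻¹ * (Γ.parityConst * I) = Γ.parityConst / (∏ i, t i) * I from
    fun I => by ring] at h4
  have h5 := (IsEquivalent.refl (u := fun M => N M * W M ^ (-(6 / 5 : ℝ))) (l := atTop)).mul
    ((isEquivalent_const_iff_tendsto (by positivity)).2 h4)
  refine h5.congr_left ?_
  have hV := hΓ.three_mul_card hE
  -- Pinning removes one vertex; this missing power of `ℓ` is the `ℓ` in the factor `D / ℓ`.
  have hcard : Fintype.card Γ.Vertex = Fintype.card {v : Γ.Vertex // v ≠ v₀} + 1 := by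
    have h6 := Fintype.card_subtype_compl (fun v : Γ.Vertex => v = v₀)
    rw [Fintype.card_subtype_eq] at h6
    have h7 : 0 < Fintype.card Γ.Vertex := Fintype.card_pos_iff.2 ⟨v₀⟩
    have h8 : Fintype.card {v : Γ.Vertex // v ≠ v₀} = Fintype.card {v : Γ.Vertex // ¬ v = v₀} := rfl
    omega
  filter_upwards [hLinf.eventually_gt_atTop 0, hlen, hW6, eventually_ge_atTop 1] with M hL hl hw6 hM1
  have hM0 : (0 : ℝ) < M := by exact_mod_cast hM1
  simp only [Pi.mul_apply]
  rw [Γ.wegnerF_eq hM1, sum_blockWeight_eq_pinned _ v₀, hl, hw6, hN, Finset.prod_div_distrib,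
    Finset.prod_const, Finset.card_univ, Fintype.card_fin]
  simp only [← Finset.mul_sum]
  generalize ∑ x : {v : Γ.Vertex // v ≠ v₀} → ZMod (D M), ∑ q ∈ Γ.solutions (n M),
    Γ.blockWeight (lam M) (fun v (_ : Fin 1) => pinLabel v₀ x v) q.2 = S
  generalize ∏ i, (n M i : ℝ) = p
  rw [hcard] at hV ⊢
  generalize Fintype.card {v : Γ.Vertex // v ≠ v₀} = k at hV ⊢
  generalize W M ^ (2 / 5 : ℝ) = r at hL ⊢
  have e1 : r ^ s * r ^ (2 * Γ.numEdges) = r ^ (3 * k) * r ^ 3 := by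
    rw [← pow_add, ← pow_add]
    congr 1
    omega
  have e2 : r ^ (3 * Γ.numEdges) = r ^ Γ.numEdges * r ^ (2 * Γ.numEdges) := by
    rw [← pow_add]; congr 1; ring
  have e3 : r ^ s = r ^ (3 * k) * r ^ 3 / r ^ (2 * Γ.numEdges) := by
    rw [← e1, mul_div_cancel_right₀ _ (by positivity)]
  rw [div_pow, div_pow, ← pow_mul, ← pow_mul, e2, e3, pow_succ (M : ℝ)]
  rcases eq_or_ne p 0 with h0 | h0
  · simp [h0]
  · field_simp

end Line

end RibbonGraph

end

/-! ### Assembly of the regimes -/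

theorem theorem5p2 {s : ℕ} (hs : 1 ≤ s) (Γ : RibbonGraph s) (hΓ : Γ.IsTypical) :
    -- the constant `C_Γ` is well defined and positive
    (Tendsto Γ.countRatio (RibbonGraph.evenAtTop s) (𝓝 Γ.combConst) ∧ 0 < Γ.combConst) ∧
    -- frozen regime
    (∀ (d D : ℕ) [NeZero D], 1 ≤ d → 2 ≤ D →
      ∀ lam : ℕ → ℝ, (∀ M, lam M ∈ Set.Ico (0 : ℝ) 1) →
      Tendsto (fun M : ℕ => (M : ℝ) ^ (1 / 3 : ℝ) * lam M) atTop (𝓝 0) →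
      ∀ (C : ℝ) (n : ℕ → Fin s → ℕ), (∀ M i, 1 ≤ n M i) →
      (∀ᶠ M : ℕ in atTop, ∀ i, (n M i : ℝ) ≤ C * M) →
      (∀ i, Tendsto (fun M => (n M i : ℝ) * lam M) atTop (𝓝 0)) →
      (fun M => 1 / (∏ i, (n M i : ℝ)) * wegnerF Γ d D M (lam M) (n M)) ~[atTop]
        (fun M => 1 / (∏ i, (n M i : ℝ)) * wegnerF Γ d D M 0 (n M)) ∧
      (fun M => 1 / (∏ i, (n M i : ℝ)) * wegnerF Γ d D M (lam M) (n M)) ~[atTop]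
        (fun M => 1 / (∏ i, (n M i : ℝ)) * ((D : ℝ) ^ d * gbeF Γ M (n M)))) ∧
    -- Skellam regime
    (1 ≤ Γ.numEdges → ∀ (d D : ℕ) [NeZero D], 1 ≤ d → 2 ≤ D →
      ∀ lam : ℕ → ℝ, (∀ M, lam M ∈ Set.Ico (0 : ℝ) 1) →
      ∀ μ : ℝ, 0 < μ →
      Tendsto (fun M : ℕ => (M : ℝ) ^ (1 / 3 : ℝ) * lam M) atTop (𝓝 μ) →
      ∀ (n : ℕ → Fin s → ℕ) (t : Fin s → ℝ), (∀ M, Even (∑ i, n M i)) → (∀ i, 0 < t i) →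
      (∀ i, Tendsto (fun M => (n M i : ℝ) * lam M) atTop (𝓝 (t i))) →
      (fun M => 1 / (∏ i, (n M i : ℝ)) * wegnerF Γ d D M (lam M) (n M)) ~[atTop]
        (fun _ => Γ.combConst / (∏ i, t i) * μ ^ (-(Γ.numEdges : ℤ) + (s : ℤ)) *
          Γ.skellamIntegral d D t)) ∧
    -- diffusive regime, `d = 1`, with `N = D M`, `W = √lam M`
    (1 ≤ Γ.numEdges → ∀ (D : ℕ → ℕ) [∀ M, NeZero (D M)], (∀ M, 2 ≤ D M) →
      ∀ lam : ℕ → ℝ, (∀ M, lam M ∈ Set.Ico (0 : ℝ) 1) →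
      Tendsto (fun M : ℕ => (M : ℝ) ^ (1 / 3 : ℝ) * lam M) atTop atTop →
      ∀ N W : ℕ → ℝ, (∀ M, N M = (D M : ℝ) * M) → (∀ M, W M = √(lam M) * M) →
      ∀ (n : ℕ → Fin s → ℕ) (t : Fin s → ℝ), (∀ M, Even (∑ i, n M i)) → (∀ i, 0 < t i) →
      (∀ i, Tendsto (fun M => (n M i : ℝ) * (1 - lam M)) atTop atTop) →
      -- supercritical case
      ((fun M => N M ^ (5 / 6 : ℝ)) =o[atTop] W →
        (∀ i, (fun M => (n M i : ℝ)) ~[atTop] (fun M => t i * N M ^ (1 / 3 : ℝ))) →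
        (fun M => 1 / (∏ i, (n M i : ℝ)) * wegnerF Γ 1 (D M) M (lam M) (n M)) ~[atTop]
          (fun _ => Γ.limitSuper t)) ∧
      -- subcritical case
      ((fun M => Real.log (N M) ^ (1 / 2 : ℝ)) =o[atTop] W →
        W =o[atTop] (fun M => N M ^ (5 / 6 : ℝ)) →
        (∀ i, (fun M => (n M i : ℝ)) ~[atTop] (fun M => t i * W M ^ (2 / 5 : ℝ))) →
        ∀ v₀ : Γ.Vertex,
        (fun M => 1 / (∏ i, (n M i : ℝ)) * wegnerF Γ 1 (D M) M (lam M) (n M)) ~[atTop]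
          (fun M => N M * W M ^ (-(6 / 5 : ℝ)) * Γ.limitSub v₀ t)) ∧
      -- critical case
      (∀ γ : ℝ, 0 < γ → W ~[atTop] (fun M => (γ * N M) ^ (5 / 6 : ℝ)) →
        (∀ i, (fun M => (n M i : ℝ)) ~[atTop] (fun M => t i * W M ^ (2 / 5 : ℝ))) →
        (fun M => 1 / (∏ i, (n M i : ℝ)) * wegnerF Γ 1 (D M) M (lam M) (n M)) ~[atTop]
          (fun _ => γ ^ ((Γ.numEdges : ℤ) - (Fintype.card Γ.Vertex : ℤ)) *
            Γ.limitCrit t (γ ^ 2)))) := by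
  have hc := hΓ.connected
  refine ⟨?_, fun d D _ hd _ lam hlam _ C n _ _ hn => ?_,
    fun hE d D _ hd _ lam hlam μ hμ hlim n t he ht hn => ?_,
    fun hE D _ _ lam hlam hlim N W hN hW n t he ht hhold => ⟨fun hWN hn => ?_,
      fun _ hWN hn v₀ => ?_, fun γ hγ hWN hn => ?_⟩⟩
  · rw [RibbonGraph.combConst_eq hc]
    exact ⟨RibbonGraph.tendsto_countRatio hc, Γ.parityConst_pos⟩
  · have h := RibbonGraph.frozen_isEquivalent hs hc (D := D) hd hlam hn
    refine ⟨h.congr_right ?_, h⟩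
    -- At zero coupling the identity with the single-block function is exact once the blocks are
    -- non-empty.
    filter_upwards [eventually_ge_atTop 1] with M hM
    rw [RibbonGraph.wegnerF_zero hs hc hd hM]
  · rw [RibbonGraph.combConst_eq hc]
    exact RibbonGraph.skellam_isEquivalent hΓ hE hd hlam hμ hlim he ht hn
  · unfold RibbonGraph.limitSuper
    rw [RibbonGraph.combConst_eq hc]
    exact RibbonGraph.supercritical_isEquivalent hs hΓ hE hlam hlim hN hW he ht hhold hWN hn
  · unfold RibbonGraph.limitSub
    rw [RibbonGraph.combConst_eq hc]
    exact RibbonGraph.subcritical_isEquivalent hs hΓ hE hlam hlim hN hW he ht hhold hWN hn v₀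
  · unfold RibbonGraph.limitCrit
    rw [RibbonGraph.combConst_eq hc]
    exact RibbonGraph.critical_isEquivalent hs hΓ hE hlam hlim hN hW he ht hhold hγ hWN hn
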